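/- All manifolds are smooth, finite-dimensional, Hausdorff and second countable. Let $\mathcal G\rightrightarrows M$ be a Lie groupoid with source $\mathbf s$ and target $\mathbf t$, where $gh$ is defined if $\mathbf s(g)=\mathbf t(h)$. For $p\ge 1$ let $B_p\mathcal G$ be the manifold of composable $p$-tuples $(g_1,\dots,g_p)$, and let $B_0\mathcal G=M$. The space $C^p(\mathcal G)$ of (normalized) $p$-cochains consists of the smooth functions $f:B_p\mathcal G\to\mathbb R$ with $f(g_1,\dots,g_p)=0$ whenever some $g_i$ is a unit. With the face maps $\partial_0(g_1,\dots,g_p)=(g_2,\dots,g_p)$, $\partial_i(g_1,\dots,g_p)=(g_1,\dots,g_ig_{i+1},\dots,g_p)$ for $1\le i\le p-1$, $\partial_p(g_1,\dots,g_p)=(g_1,\dots,g_{p-1})$ (for $p=1$: $\partial_0=\mathbf s$, $\partial_1=\mathbf t$) and $\delta=\sum_i(-1)^i\partial_i^*$, this is a cochain complex, and its cohomology $H^\bullet(\mathcal G)$ is a graded ring under the cup product $(f_1\star f_2)(g_1,\dots,g_{p+q})=f_1(g_1,\dots,g_p)\,f_2(g_{p+1},\dots,g_{p+q})$. Let $\mathcal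 V\rightrightarrows E$ be a VB-groupoid over $\mathcal G\rightrightarrows M$: a Lie groupoid such that $\pi:\mathcal V\to\mathcal G$ and $E\to M$ are vector bundles whose projections form a morphism of Lie groupoids, and such that for every $\lambda\ge 0$ the fiberwise multiplications by $\lambda$ on $\mathcal V$ and on $E$ form a morphism of Lie groupoids. Let $C^p_{1\text{-}\hom}(\mathcal V)\subset C^p(\mathcal V)$ be the space of the cochains $\phi$ with $\phi(\lambda\xi_1,\dots,\lambda\xi_p)=\lambda\,\phi(\xi_1,\dots,\xi_p)$ for all $\lambda\ge 0$ (for $p=0$: $\phi(\lambda e)=\lambda\phi(e)$ for $e\in E$), and let $C^p_{VB}(\mathcal V)\subset C^p_{1\text{-}\hom}(\mathcal V)$ be the subspace of those $\phi$ which, if $p\ge1$, satisfy 1. $\phi(0_g,\xi_1,\dots,\xi_{p-1})=0$ for all composable $(0_g,\xi_1,\dots,\xi_{p-1})$, and 2. $\phi(0_g\cdot\xi_1,\xi_2,\dots,\xi_p)=\phi(\xi_1,\dots,\xi_p)$ for all $(\xi_1,\dots,\xi_p)\in B_p\mathcal V$ and $g\in\mathcal G$ with $(0_g,\xi_1)$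 composable, where $0_g$ is the zero of the fiber $\mathcal V_g$. Both are subcomplexes of $(C^\bullet(\mathcal V),\delta)$, and the products $(\phi\star f)(\xi_1,\dots,\xi_{p+q})=\phi(\xi_1,\dots,\xi_p)\,f(\pi(\xi_{p+1}),\dots,\pi(\xi_{p+q}))$ with $f\in C^q(\mathcal G)$ make their cohomologies right $H^\bullet(\mathcal G)$-modules. Then the inclusion $C^\bullet_{VB}(\mathcal V)\hookrightarrow C^\bullet_{1\text{-}\hom}(\mathcal V)$ induces an isomorphism in cohomology, in every degree, and this is an isomorphism of right $H^\bullet(\mathcal G)$-modules. -/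

import Mathlib

open scoped Manifold ContDiff
open Bundle Set DirectSum

noncomputable section

section Smooth

variable {E₁ H₁ X E₂ H₂ Y E₃ H₃ Z : Type*}
  [NormedAddCommGroup E₁] [NormedSpace ℝ E₁] [TopologicalSpace H₁] [TopologicalSpace X]
  [ChartedSpace H₁ X]
  [NormedAddCommGroup E₂] [NormedSpace ℝ E₂] [TopologicalSpace H₂] [TopologicalSpace Y]
  [ChartedSpace H₂ Y]
  [NormedAddCommGroup E₃] [NormedSpace ℝ E₃] [TopologicalSpace H₃] [TopologicalSpace Z]
  [ChartedSpace H₃ Z]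
  (I₁ : ModelWithCorners ℝ E₁ H₁) (I₂ : ModelWithCorners ℝ E₂ H₂) (I₃ : ModelWithCorners ℝ E₃ H₃)

/-- A map defined on a subset `S` of a manifold is smooth if it extends, locally around each point
of `S`, to a smooth map on an open set of the ambient manifold. If `S` is an embedded submanifold,
this is smoothness for the manifold structure of `S`. -/
def SmoothOnSubset (S : Set X) (f : S → Y) : Prop :=
  ∀ x : S, ∃ U : Set X, IsOpen U ∧ (x : X) ∈ U ∧
    ∃ F : X → Y, ContMDiffOn I₁ I₂ ∞ F U ∧ ∀ y : S, (y : X) ∈ U → F y = f y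

variable {I₁ I₂ I₃}

theorem SmoothOnSubset.of_contMDiff {S : Set X} {F : X → Y} (hF : ContMDiff I₁ I₂ ∞ F) :
    SmoothOnSubset I₁ I₂ S (fun x => F x) :=
  fun _ => ⟨univ, isOpen_univ, mem_univ _, F, hF.contMDiffOn, fun _ _ => rfl⟩

theorem SmoothOnSubset.comp {S : Set X} {T : Set Y} {f : T → Z} {g : S → T}
    (hf : SmoothOnSubset I₂ I₃ T f) (hg : SmoothOnSubset I₁ I₂ S (fun x => (g x : Y))) :
    SmoothOnSubset I₁ I₃ S (fun x => f (g x)) := by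
  intro x
  obtain ⟨U, hU, hxU, G, hG, hGg⟩ := hg x
  obtain ⟨V, hV, hxV, F, hF, hFf⟩ := hf (g x)
  refine ⟨U ∩ G ⁻¹' V, hG.continuousOn.isOpen_inter_preimage hU hV,
    ⟨hxU, by simpa [hGg x hxU] using hxV⟩, F ∘ G,
    hF.comp (hG.mono inter_subset_left) (fun y hy => hy.2), ?_⟩
  rintro y ⟨hyU, hyV⟩
  have h := hGg y hyU
  rw [mem_preimage, h] at hyV
  simp only [Function.comp, h, hFf _ hyV]

theorem SmoothOnSubset.contMDiff_comp {S : Set X} {F : Y → Z} {g : S → Y}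
    (hF : ContMDiff I₂ I₃ ∞ F) (hg : SmoothOnSubset I₁ I₂ S g) :
    SmoothOnSubset I₁ I₃ S (fun x => F (g x)) := by
  intro x
  obtain ⟨U, hU, hxU, G, hG, hGg⟩ := hg x
  exact ⟨U, hU, hxU, F ∘ G, hF.comp_contMDiffOn hG, fun y hy => by simp [hGg y hy]⟩

theorem SmoothOnSubset.prodMk {S : Set X} {f : S → Y} {g : S → Z}
    (hf : SmoothOnSubset I₁ I₂ S f) (hg : SmoothOnSubset I₁ I₃ S g) :
    SmoothOnSubset I₁ (I₂.prod I₃) S (fun x => (f x, g x)) := by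
  intro x
  obtain ⟨U, hU, hxU, F, hF, hFf⟩ := hf x
  obtain ⟨V, hV, hxV, G, hG, hGg⟩ := hg x
  exact ⟨U ∩ V, hU.inter hV, ⟨hxU, hxV⟩, fun y => (F y, G y),
    (hF.mono inter_subset_left).prodMk (hG.mono inter_subset_right),
    fun y hy => Prod.ext (hFf y hy.1) (hGg y hy.2)⟩

theorem contMDiff_pi_apply {n : ℕ} (i : Fin n) :
    ContMDiff (ModelWithCorners.pi fun _ : Fin n => I₁) I₁ ∞ (fun x : Fin n → X => x i) := by
  intro x
  refine contMDiffAt_iff.2 ⟨(continuous_apply i).continuousAt, ?_⟩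
  have hsub : ContDiffWithinAt ℝ ∞ (fun z : Fin n → E₁ => z i)
      (range (ModelWithCorners.pi fun _ : Fin n => I₁))
      (extChartAt (ModelWithCorners.pi fun _ : Fin n => I₁) x x) :=
    (contDiff_apply ℝ E₁ i).contDiffWithinAt
  refine hsub.congr_of_eventuallyEq ?_ ?_
  · filter_upwards [extChartAt_target_mem_nhdsWithin (I := ModelWithCorners.pi fun _ : Fin n => I₁) x]
      with z hz
    have hz' : z i ∈ (extChartAt I₁ (x i)).target := by
      have h := (extChartAt (ModelWithCorners.pi fun _ : Fin n => I₁) x).map_target hz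
      have h2 := (extChartAt (ModelWithCorners.pi fun _ : Fin n => I₁) x).right_inv hz
      have h3 : (extChartAt I₁ (x i))
        ((extChartAt (ModelWithCorners.pi fun _ : Fin n => I₁) x).symm z i) = z i := congrFun h2 i
      rw [← h3]
      apply (extChartAt I₁ (x i)).map_source
      rw [extChartAt_source] at h ⊢
      rw [piChartedSpace_chartAt] at h
      exact h i (mem_univ _)
    exact (extChartAt I₁ (x i)).right_inv hz'
  · exact (extChartAt I₁ (x i)).right_inv (mem_extChartAt_target (x i))

theorem ContMDiffOn.piMk {n : ℕ} {U : Set X} {F : X → Fin n → Y}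
    (hF : ∀ i, ContMDiffOn I₁ I₂ ∞ (fun x => F x i) U) :
    ContMDiffOn I₁ (ModelWithCorners.pi fun _ : Fin n => I₂) ∞ F U := by
  intro x hx
  refine contMDiffWithinAt_iff.2
    ⟨continuousWithinAt_pi.2 fun i => (hF i x hx).continuousWithinAt, ?_⟩
  exact contDiffWithinAt_pi.2 fun i => (contMDiffWithinAt_iff.1 (hF i x hx)).2

theorem SmoothOnSubset.piMk {n : ℕ} {S : Set X} {f : S → Fin n → Y}
    (hf : ∀ i, SmoothOnSubset I₁ I₂ S (fun x => f x i)) :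
    SmoothOnSubset I₁ (ModelWithCorners.pi fun _ : Fin n => I₂) S f := by
  intro x
  choose U hU hxU F hF hFf using fun i => hf i x
  refine ⟨⋂ i, U i, isOpen_iInter_of_finite hU, mem_iInter.2 hxU, fun y i => F i y,
    ContMDiffOn.piMk fun i => (hF i).mono (iInter_subset _ i), fun y hy => ?_⟩
  funext i
  exact hFf i y (mem_iInter.1 hy i)

end Smooth

/-- A Lie groupoid `G ⇉ M`. A pair `(g, h)` is composable if `src g = tgt h`; the values of `mul`
on pairs that are not composable are irrelevant and nothing is required of them. -/
structure LieGroupoid {EM HM EG HG : Type*}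
    [NormedAddCommGroup EM] [NormedSpace ℝ EM] [TopologicalSpace HM]
    [NormedAddCommGroup EG] [NormedSpace ℝ EG] [TopologicalSpace HG]
    (I : ModelWithCorners ℝ EM HM) (J : ModelWithCorners ℝ EG HG)
    (M G : Type*) [TopologicalSpace M] [ChartedSpace HM M] [TopologicalSpace G]
    [ChartedSpace HG G] where
  src : G → M
  tgt : G → M
  one : M → G
  inv : G → G
  mul : G → G → G
  src_one : ∀ x, src (one x) = x
  tgt_one : ∀ x, tgt (one x) = x
  src_inv : ∀ g, src (inv g) = tgt g
  tgt_inv : ∀ g, tgt (inv g) = src g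
  src_mul : ∀ g h, src g = tgt h → src (mul g h) = src h
  tgt_mul : ∀ g h, src g = tgt h → tgt (mul g h) = tgt g
  protected mul_assoc : ∀ g h k, src g = tgt h → src h = tgt k → mul (mul g h) k = mul g (mul h k)
  protected one_mul : ∀ g, mul (one (tgt g)) g = g
  protected mul_one : ∀ g, mul g (one (src g)) = g
  protected mul_inv : ∀ g, mul g (inv g) = one (tgt g)
  protected inv_mul : ∀ g, mul (inv g) g = one (src g)
  contMDiff_src : ContMDiff J I ∞ src
  contMDiff_tgt : ContMDiff J I ∞ tgt
  contMDiff_one : ContMDiff I J ∞ one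
  contMDiff_inv : ContMDiff J J ∞ inv
  submersion_src : ∀ g, Function.Surjective (mfderiv J I src g)
  submersion_tgt : ∀ g, Function.Surjective (mfderiv J I tgt g)
  smooth_mul : SmoothOnSubset (J.prod J) J {p : G × G | src p.1 = tgt p.2}
    (fun p => mul p.1.1 p.1.2)

section Groupoids

variable {EM HM M EG HG G EM' HM' M' EG' HG' G' : Type*}
  [NormedAddCommGroup EM] [NormedSpace ℝ EM] [TopologicalSpace HM]
  [NormedAddCommGroup EG] [NormedSpace ℝ EG] [TopologicalSpace HG]
  [TopologicalSpace M] [ChartedSpace HM M] [TopologicalSpace G] [ChartedSpace HG G]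
  [NormedAddCommGroup EM'] [NormedSpace ℝ EM'] [TopologicalSpace HM']
  [NormedAddCommGroup EG'] [NormedSpace ℝ EG'] [TopologicalSpace HG']
  [TopologicalSpace M'] [ChartedSpace HM' M'] [TopologicalSpace G'] [ChartedSpace HG' G']
  {I : ModelWithCorners ℝ EM HM} {J : ModelWithCorners ℝ EG HG}
  {I' : ModelWithCorners ℝ EM' HM'} {J' : ModelWithCorners ℝ EG' HG'}

/-- `f : G → G'` is a morphism of Lie groupoids over `f₀ : M → M'`. -/
structure IsLieGroupoidMorphism (K : LieGroupoid I J M G) (L : LieGroupoid I' J' M' G')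
    (f : G → G') (f₀ : M → M') : Prop where
  contMDiff : ContMDiff J J' ∞ f
  contMDiff_base : ContMDiff I I' ∞ f₀
  src : ∀ g, L.src (f g) = f₀ (K.src g)
  tgt : ∀ g, L.tgt (f g) = f₀ (K.tgt g)
  one : ∀ x, f (K.one x) = L.one (f₀ x)
  mul : ∀ g h, K.src g = K.tgt h → f (K.mul g h) = L.mul (f g) (f h)

theorem IsLieGroupoidMorphism.id (K : LieGroupoid I J M G) :
    IsLieGroupoidMorphism K K (fun g => g) (fun x => x) :=
  ⟨contMDiff_id, contMDiff_id, fun _ => rfl, fun _ => rfl, fun _ => rfl, fun _ _ _ => rfl⟩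

namespace LieGroupoid

variable (K : LieGroupoid I J M G) (L : LieGroupoid I' J' M' G')

/-- The space `B_p` of chains `x₀ ←g₁— x₁ ←g₂— ⋯ ←g_p— x_p` of composable arrows, as a subset of
`M^(p+1) × G^p`; the arrow `g_(i+1)` is stored at the index `i : Fin p`. The objects are listed so
that `p = 0` needs no separate treatment: `B_0` is `M`, and for `p ≥ 1` the objects are determined
by the arrows, so that `B_p` is the space of composable `p`-tuples. -/
def nerveSet (p : ℕ) : Set ((Fin (p + 1) → M) × (Fin p → G)) :=
  {x | ∀ i : Fin p, K.tgt (x.2 i) = x.1 i.castSucc ∧ K.src (x.2 i) = x.1 i.succ}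

/-- The space `B_p` of the nerve, as a type. -/
abbrev Nerve (p : ℕ) : Type _ := K.nerveSet p

variable {K L}

namespace Nerve

variable {p q n m : ℕ}

/-- The objects of a chain. -/
def obj (x : K.Nerve p) : Fin (p + 1) → M := x.1.1

/-- The arrows of a chain. -/
def arr (x : K.Nerve p) : Fin p → G := x.1.2

theorem tgt_arr (x : K.Nerve p) (i : Fin p) : K.tgt (x.arr i) = x.obj i.castSucc := (x.2 i).1

theorem src_arr (x : K.Nerve p) (i : Fin p) : K.src (x.arr i) = x.obj i.succ := (x.2 i).2

theorem ext' {x y : K.Nerve p} (h₀ : ∀ i, x.obj i = y.obj i) (h : ∀ i, x.arr i = y.arr i) :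
    x = y :=
  Subtype.ext (Prod.ext (funext h₀) (funext h))

theorem composable (x : K.Nerve (p + 1)) (j : Fin p) :
    K.src (x.arr j.castSucc) = K.tgt (x.arr j.succ) := by
  rw [x.src_arr, x.tgt_arr]; rfl

/-- The arrows of the `i`-th face: `(g₁, …, g_(i-1), g_i g_(i+1), g_(i+2), …, g_(p+1))`, where the
first, respectively last, arrow is dropped if `i = 0`, respectively `i = p + 1`. -/
def faceArr (i : Fin (p + 2)) (x : K.Nerve (p + 1)) (j : Fin p) : G :=
  if (j : ℕ) + 1 < i then x.arr j.castSucc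
  else if (j : ℕ) + 1 = i then K.mul (x.arr j.castSucc) (x.arr j.succ)
  else x.arr j.succ

/-- The face map `∂_i : B_(p+1) → B_p`, which drops the `i`-th object. For `p = 0`, `∂_0` is the
source and `∂_1` the target. -/
def face (i : Fin (p + 2)) (x : K.Nerve (p + 1)) : K.Nerve p :=
  ⟨(fun j => x.obj (i.succAbove j), faceArr i x), by
    intro j
    have hj := j.2
    have key : ∀ a b : Fin (p + 2), (a : ℕ) = b → x.obj a = x.obj b :=
      fun a b h => congrArg _ (Fin.ext h)
    simp only [faceArr]
    split_ifs with h1 h2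
    · exact ⟨(x.tgt_arr _).trans (key _ _ (by simp [Fin.succAbove, Fin.lt_def]; grind)),
        (x.src_arr _).trans (key _ _ (by simp [Fin.succAbove, Fin.lt_def]; grind))⟩
    · exact ⟨((K.tgt_mul _ _ (x.composable j)).trans (x.tgt_arr _)).trans
          (key _ _ (by simp [Fin.succAbove, Fin.lt_def]; grind)),
        ((K.src_mul _ _ (x.composable j)).trans (x.src_arr _)).trans
          (key _ _ (by simp [Fin.succAbove, Fin.lt_def]; grind))⟩
    · exact ⟨(x.tgt_arr _).trans (key _ _ (by simp [Fin.succAbove, Fin.lt_def]; grind)),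
        (x.src_arr _).trans (key _ _ (by simp [Fin.succAbove, Fin.lt_def]; grind))⟩⟩

/-- The part `x_a ← ⋯ ← x_(a+n)` of a chain. -/
def seg (a n : ℕ) (h : a + n ≤ m) (x : K.Nerve m) : K.Nerve n :=
  ⟨(fun j => x.obj ⟨a + j, by omega⟩, fun j => x.arr ⟨a + j, by omega⟩),
    fun _ => ⟨x.tgt_arr _, x.src_arr _⟩⟩

/-- The map `B_p f : B_p K → B_p L` induced by a morphism of groupoids. -/
def map {f : G → G'} {f₀ : M → M'} (hf : IsLieGroupoidMorphism K L f f₀) (x : K.Nerve p) :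
    L.Nerve p :=
  ⟨(fun j => f₀ (x.obj j), fun j => f (x.arr j)),
    fun j => ⟨(hf.tgt _).trans (congrArg f₀ (x.tgt_arr j)),
      (hf.src _).trans (congrArg f₀ (x.src_arr j))⟩⟩

@[simp] theorem obj_face (i : Fin (p + 2)) (x : K.Nerve (p + 1)) (j) :
    (face i x).obj j = x.obj (i.succAbove j) := rfl
@[simp] theorem arr_face (i : Fin (p + 2)) (x : K.Nerve (p + 1)) (j) :
    (face i x).arr j = faceArr i x j := rfl
@[simp] theorem obj_seg (a n : ℕ) (h : a + n ≤ m) (x : K.Nerve m) (j) :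
    (seg a n h x).obj j = x.obj ⟨a + j, by omega⟩ := rfl
@[simp] theorem arr_seg (a n : ℕ) (h : a + n ≤ m) (x : K.Nerve m) (j) :
    (seg a n h x).arr j = x.arr ⟨a + j, by omega⟩ := rfl
@[simp] theorem obj_map {f : G → G'} {f₀ : M → M'} (hf : IsLieGroupoidMorphism K L f f₀)
    (x : K.Nerve p) (j) : (map hf x).obj j = f₀ (x.obj j) := rfl
@[simp] theorem arr_map {f : G → G'} {f₀ : M → M'} (hf : IsLieGroupoidMorphism K L f f₀)
    (x : K.Nerve p) (j) : (map hf x).arr j = f (x.arr j) := rfl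

theorem map_face {f : G → G'} {f₀ : M → M'} (hf : IsLieGroupoidMorphism K L f f₀)
    (i : Fin (p + 2)) (x : K.Nerve (p + 1)) : map hf (face i x) = face i (map hf x) := by
  refine ext' (fun _ => rfl) fun j => ?_
  simp only [arr_map, arr_face, faceArr]
  split_ifs
  · rfl
  · exact hf.mul _ _ (x.composable j)
  · rfl

theorem map_seg {f : G → G'} {f₀ : M → M'} (hf : IsLieGroupoidMorphism K L f f₀)
    (a n : ℕ) (h : a + n ≤ m) (x : K.Nerve m) : map hf (seg a n h x) = seg a n h (map hf x) :=
  rfl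

theorem seg_seg (a n b k : ℕ) (h : a + n ≤ m) (h' : b + k ≤ n) (h'' : a + b + k ≤ m)
    (x : K.Nerve m) : seg b k h' (seg a n h x) = seg (a + b) k h'' x :=
  ext' (fun j => congrArg x.obj (Fin.ext (by simp [add_assoc])))
    (fun j => congrArg x.arr (Fin.ext (by simp [add_assoc])))

/-- A face of a chain, restricted to its part of length `p` at the beginning. -/
theorem seg_face_front (i : Fin (n + 2)) (hp : 0 + p ≤ n) (hp' : 0 + (p + 1) ≤ n + 1)
    (hi : (i : ℕ) < p + 2) (x : K.Nerve (n + 1)) :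
    seg 0 p hp (face i x) = face ⟨i, hi⟩ (seg 0 (p + 1) hp' x) := by
  refine ext' (fun j => congrArg x.obj (Fin.ext ?_)) fun j => ?_
  · simp [Fin.succAbove, Fin.lt_def]; grind
  · simp only [arr_seg, arr_face, faceArr]
    simp only [Nat.zero_add]; rfl


theorem seg_face_of_le (i : Fin (n + 2)) (hi : (i : ℕ) ≤ p) (h : p + q ≤ n)
    (h' : p + 1 + q ≤ n + 1) (x : K.Nerve (n + 1)) :
    seg p q h (face i x) = seg (p + 1) q h' x := by
  refine ext' (fun j => congrArg x.obj (Fin.ext ?_)) fun j => ?_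
  · simp [Fin.succAbove, Fin.lt_def]; grind
  · simp only [arr_seg, arr_face, faceArr]
    rw [if_neg (by omega), if_neg (by omega)]
    exact congrArg x.arr (Fin.ext (by simp; omega))

theorem seg_face_of_lt (i : Fin (n + 2)) (hi : p < (i : ℕ)) (h : 0 + p ≤ n)
    (h' : 0 + p ≤ n + 1) (x : K.Nerve (n + 1)) :
    seg 0 p h (face i x) = seg 0 p h' x := by
  refine ext' (fun j => congrArg x.obj (Fin.ext ?_)) fun j => ?_
  · simp [Fin.succAbove, Fin.lt_def]; grind
  · simp only [arr_seg, arr_face, faceArr]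
    rw [if_pos (by omega)]
    rfl

theorem seg_face_back (i : Fin (n + 2)) (k : Fin (q + 2)) (hk : (i : ℕ) = p + k)
    (_ : 0 < (k : ℕ)) (h : p + q ≤ n) (h' : p + (q + 1) ≤ n + 1) (x : K.Nerve (n + 1)) :
    seg p q h (face i x) = face k (seg p (q + 1) h' x) := by
  refine ext' (fun j => congrArg x.obj (Fin.ext ?_)) fun j => ?_
  · simp [Fin.succAbove, Fin.lt_def]; grind
  · simp only [arr_seg, arr_face, faceArr]
    have e1 : (p + (j : ℕ) + 1 < (i : ℕ)) ↔ ((j : ℕ) + 1 < k) := by omega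
    have e2 : (p + (j : ℕ) + 1 = (i : ℕ)) ↔ ((j : ℕ) + 1 = k) := by omega
    simp only [e1, e2]
    rfl

theorem face_last_seg (h : 0 + (p + 1) ≤ m) (h' : 0 + p ≤ m) (x : K.Nerve m) :
    face (Fin.last (p + 1)) (seg 0 (p + 1) h x) = seg 0 p h' x := by
  refine ext' (fun j => congrArg x.obj (Fin.ext ?_)) fun j => ?_
  · simp
  · simp only [arr_seg, arr_face, faceArr]
    rw [if_pos (by simp)]
    rfl

theorem face_zero_seg (h : p + (q + 1) ≤ m) (h' : p + 1 + q ≤ m) (x : K.Nerve m) :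
    face 0 (seg p (q + 1) h x) = seg (p + 1) q h' x := by
  refine ext' (fun j => congrArg x.obj (Fin.ext ?_)) fun j => ?_
  · simp; omega
  · simp only [arr_seg, arr_face, faceArr]
    rw [if_neg (by simp), if_neg (by simp)]
    exact congrArg x.arr (Fin.ext (by simp; omega))

/-- The simplicial identity for the face maps. -/
theorem face_face (i j : Fin (p + 2)) (hij : i ≤ j) (x : K.Nerve (p + 2)) :
    face i (face j.succ x) = face j (face i.castSucc x) := by
  refine ext' (fun k => congrArg x.obj (Fin.ext ?_)) fun k => ?_
  · rw [Fin.le_def] at hij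
    simp only [Fin.succAbove, Fin.lt_def, Fin.val_castSucc, Fin.val_succ]
    split_ifs <;> simp only [Fin.val_castSucc, Fin.val_succ] at * <;> omega
  · simp only [arr_face, faceArr]
    rw [Fin.le_def] at hij
    have ha := K.mul_assoc _ _ _ (x.composable k.castSucc) (x.composable k.succ)
    simp only [Fin.val_castSucc, Fin.val_succ]
    rcases lt_trichotomy ((k : ℕ) + 1) i with h | h | h
    · rw [if_pos h, if_pos (by omega), if_pos (by omega), if_pos (by omega)]
    · rw [if_neg (by omega), if_pos h, if_pos (by omega : (k : ℕ) + 1 < j + 1)]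
      rcases (by omega : (k : ℕ) + 1 < j ∨ (k : ℕ) + 1 = j) with h' | h'
      · rw [if_pos h', if_pos (by omega), if_neg (by omega), if_pos h]; rfl
      · split_ifs <;> first | omega | exact ha.symm
    · rw [if_neg (by omega), if_neg (by omega)]
      rcases lt_trichotomy ((k : ℕ) + 1) j with h' | h' | h'
      · rw [if_pos (by omega), if_pos h', if_neg (by omega), if_neg (by omega)]; rfl
      · rw [if_neg (by omega), if_pos (by omega), if_neg (by omega), if_pos h', if_neg (by omega),
          if_neg (by omega), if_neg (by omega), if_neg (by omega)]; rfl
      · rw [if_neg (by omega), if_neg (by omega), if_neg (by omega), if_neg (by omega),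
          if_neg (by omega), if_neg (by omega)]

end Nerve

/-- The model of the manifold `M^(p+1) × G^p` that contains `B_p`. -/
abbrev nerveModel (I : ModelWithCorners ℝ EM HM) (J : ModelWithCorners ℝ EG HG) (p : ℕ) :=
  (ModelWithCorners.pi fun _ : Fin (p + 1) => I).prod (ModelWithCorners.pi fun _ : Fin p => J)

section SmoothMaps

variable {p n m : ℕ}

theorem smooth_obj (j : Fin (p + 1)) :
    SmoothOnSubset (nerveModel I J p) I (K.nerveSet p) (fun x => Nerve.obj x j) :=
  SmoothOnSubset.of_contMDiff (F := fun x : (Fin (p + 1) → M) × (Fin p → G) => x.1 j)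
    ((contMDiff_pi_apply j).comp contMDiff_fst)

theorem smooth_arr (j : Fin p) :
    SmoothOnSubset (nerveModel I J p) J (K.nerveSet p) (fun x => Nerve.arr x j) :=
  SmoothOnSubset.of_contMDiff (F := fun x : (Fin (p + 1) → M) × (Fin p → G) => x.2 j)
    ((contMDiff_pi_apply j).comp contMDiff_snd)

theorem smooth_face (i : Fin (p + 2)) :
    SmoothOnSubset (nerveModel I J (p + 1)) (nerveModel I J p) (K.nerveSet (p + 1))
      (fun x => (Nerve.face i x : (Fin (p + 1) → M) × (Fin p → G))) := by
  refine SmoothOnSubset.prodMk (SmoothOnSubset.piMk fun j => smooth_obj _)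
    (SmoothOnSubset.piMk fun j => ?_)
  simp only [Nerve.faceArr]
  split_ifs
  · exact smooth_arr _
  · exact K.smooth_mul.comp
      (g := fun x : K.Nerve (p + 1) => ⟨(x.arr j.castSucc, x.arr j.succ), x.composable j⟩)
      ((smooth_arr _).prodMk (smooth_arr _))
  · exact smooth_arr _

theorem smooth_seg (a n : ℕ) (h : a + n ≤ m) :
    SmoothOnSubset (nerveModel I J m) (nerveModel I J n) (K.nerveSet m)
      (fun x => (Nerve.seg a n h x : (Fin (n + 1) → M) × (Fin n → G))) :=
  SmoothOnSubset.prodMk (SmoothOnSubset.piMk fun _ => smooth_obj _)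
    (SmoothOnSubset.piMk fun _ => smooth_arr _)

theorem smooth_map {f : G → G'} {f₀ : M → M'} (hf : IsLieGroupoidMorphism K L f f₀) :
    SmoothOnSubset (nerveModel I J p) (nerveModel I' J' p) (K.nerveSet p)
      (fun x => (Nerve.map hf x : (Fin (p + 1) → M') × (Fin p → G'))) :=
  SmoothOnSubset.prodMk
    (SmoothOnSubset.piMk fun _ => SmoothOnSubset.contMDiff_comp hf.contMDiff_base (smooth_obj _))
    (SmoothOnSubset.piMk fun _ => SmoothOnSubset.contMDiff_comp hf.contMDiff (smooth_arr _))

end SmoothMaps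

section Cochains

variable {p q r n m : ℕ}

variable (K) in
/-- The differential `δ = ∑ (-1)^i ∂_i^*`. -/
def delta (p : ℕ) : (K.Nerve p → ℝ) →ₗ[ℝ] (K.Nerve (p + 1) → ℝ) where
  toFun φ x := ∑ i : Fin (p + 2), (-1) ^ (i : ℕ) * φ (Nerve.face i x)
  map_add' φ ψ := by
    funext x; simp only [Pi.add_apply, mul_add, Finset.sum_add_distrib]
  map_smul' c φ := by
    funext x
    simp only [Pi.smul_apply, smul_eq_mul, RingHom.id_apply, Finset.mul_sum]
    exact Finset.sum_congr rfl fun _ _ => by ring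

theorem delta_apply (φ : K.Nerve p → ℝ) (x : K.Nerve (p + 1)) :
    K.delta p φ x = ∑ i : Fin (p + 2), (-1) ^ (i : ℕ) * φ (Nerve.face i x) := rfl

theorem delta_delta (φ : K.Nerve p → ℝ) : K.delta (p + 1) (K.delta p φ) = 0 := by
  funext x
  simp only [delta_apply, Finset.mul_sum, ← Finset.sum_product', Pi.zero_apply]
  let S : Finset (Fin (p + 3) × Fin (p + 2)) := Finset.univ.filter fun ij : Fin (p + 3) × Fin (p + 2) => (ij.2 : ℕ) < (ij.1 : ℕ)
  rw [Finset.univ_product_univ, ← Finset.sum_add_sum_compl S, ← eq_neg_iff_add_eq_zero,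
    ← Finset.sum_neg_distrib]
  let F : ∀ ij : Fin (p + 3) × Fin (p + 2), ij ∈ S → Fin (p + 3) × Fin (p + 2) := fun ij hij =>
    (Fin.castLT ij.2 (by omega), ij.1.pred (by
      rintro h
      have := (Finset.mem_filter.1 hij).2
      rw [h] at this
      simp at this))
  refine Finset.sum_bij F ?_ ?_ ?_ ?_
  · rintro ⟨i, j⟩ hij
    have := (Finset.mem_filter.1 hij).2
    simp only [S, F, Finset.compl_filter, Finset.mem_filter_univ, Fin.val_castLT, Fin.val_pred]
    simp only at this
    omega
  · rintro ⟨i, j⟩ hij ⟨i', j'⟩ hij' h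
    have h1 := (Finset.mem_filter.1 hij).2
    have h2 := (Finset.mem_filter.1 hij').2
    simp only [F, Prod.mk.injEq, Fin.ext_iff, Fin.val_castLT, Fin.val_pred] at h h1 h2 ⊢
    omega
  · rintro ⟨i, j⟩ hij
    simp only [S, Finset.compl_filter, Finset.mem_filter_univ, not_lt] at hij
    refine ⟨(j.succ, Fin.castLT i (by omega)), ?_, ?_⟩
    · simp only [S, Finset.mem_filter_univ, Fin.val_castLT, Fin.val_succ]; omega
    · rfl
  · rintro ⟨i, j⟩ hij
    have hlt := (Finset.mem_filter.1 hij).2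
    simp only at hlt
    obtain ⟨i', rfl⟩ : ∃ i' : Fin (p + 2), i = i'.succ :=
      ⟨i.pred (by rintro rfl; simp at hlt), by simp⟩
    have hij' : j ≤ i' := by rw [Fin.le_def]; simp at hlt; omega
    have e := Nerve.face_face j i' hij' x
    have e2 : F (i'.succ, j) hij = (j.castSucc, i') := rfl
    rw [e2]
    simp only [e, Fin.val_succ, Fin.val_castSucc, pow_succ]
    ring

/-- The product `(φ ⋆ f)(ξ₁, …, ξ_(p+q)) = φ(ξ₁, …, ξ_p) f(ρ(ξ_(p+1)), …, ρ(ξ_(p+q)))` of a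
`p`-cochain on `K` and a `q`-cochain on `L`, with respect to a morphism `ρ` from `K` to `L`.
For the identity of `K` this is the cup product. -/
def cup {ρ : G → G'} {ρ₀ : M → M'} (hρ : IsLieGroupoidMorphism K L ρ ρ₀) (h : p + q = n)
    (φ : K.Nerve p → ℝ) (f : L.Nerve q → ℝ) (x : K.Nerve n) : ℝ :=
  φ (Nerve.seg 0 p (by omega) x) * f (Nerve.map hρ (Nerve.seg p q (by omega) x))

/-- The Leibniz formula. -/
theorem delta_cup {ρ : G → G'} {ρ₀ : M → M'} (hρ : IsLieGroupoidMorphism K L ρ ρ₀)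
    (h : p + q = n) (φ : K.Nerve p → ℝ) (f : L.Nerve q → ℝ) :
    K.delta n (cup hρ h φ f) = cup hρ (by omega : p + 1 + q = n + 1) (K.delta p φ) f +
      (-1 : ℝ) ^ p • cup hρ (by omega : p + (q + 1) = n + 1) φ (L.delta q f) := by
  subst h
  funext x
  simp only [Pi.add_apply, Pi.smul_apply, smul_eq_mul, cup, delta_apply]
  have hcast : p + 1 + (q + 1) = p + q + 2 := by omega
  rw [← Equiv.sum_comp (finCongr hcast), Fin.sum_univ_add,
    Fin.sum_univ_castSucc (n := p + 1), Fin.sum_univ_succ (n := q + 1), Nerve.map_seg,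
    ← Nerve.map_face, Nerve.face_zero_seg (h' := by omega), Nerve.face_last_seg (h' := by omega)]
  have e1 : ∀ i : Fin (p + 1),
      φ (Nerve.seg 0 p (by omega) (Nerve.face (finCongr hcast (Fin.castAdd (q + 1) i)) x)) =
      φ (Nerve.face i.castSucc (Nerve.seg 0 (p + 1) (by omega) x)) := fun i => by
    rw [Nerve.seg_face_front (hp' := by omega) (hi := by simp; omega)]; rfl
  have e2 : ∀ i : Fin (p + 1),
      Nerve.seg p q (by omega) (Nerve.face (finCongr hcast (Fin.castAdd (q + 1) i)) x) =
      Nerve.seg (p + 1) q (by omega) x := fun i =>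
    Nerve.seg_face_of_le _ (by simp; omega) _ _ _
  have e3 : ∀ i : Fin (q + 1),
      Nerve.seg 0 p (by omega) (Nerve.face (finCongr hcast (Fin.natAdd (p + 1) i)) x) =
      Nerve.seg 0 p (by omega) x := fun i =>
    Nerve.seg_face_of_lt _ (by simp; omega) _ _ _
  have e4 : ∀ i : Fin (q + 1),
      Nerve.seg p q (by omega) (Nerve.face (finCongr hcast (Fin.natAdd (p + 1) i)) x) =
      Nerve.face i.succ (Nerve.seg p (q + 1) (by omega) x) := fun i =>
    Nerve.seg_face_back _ _ (by simp; omega) (by simp) _ _ _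
  simp only [e1, e2, e3, e4]
  simp only [Nerve.map_seg, Nerve.map_face, finCongr_apply, Fin.val_cast,
    Fin.val_castAdd, Fin.val_natAdd, Fin.val_castSucc, Fin.val_last, Fin.val_succ, Fin.val_zero]
  simp only [add_mul, mul_add, Finset.sum_mul, Finset.mul_sum, pow_add, pow_one, pow_zero]
  have key : ∀ A A' b b' c c' : ℝ, A = A' → c = c' → b + b' = 0 → A + c = A' + b + (b' + c') :=
    fun A A' b b' c c' h h' hb => by rw [h, h']; linarith
  exact key _ _ _ _ _ _ (Finset.sum_congr rfl fun _ _ => by ring)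
    (Finset.sum_congr rfl fun _ _ => by ring) (by ring)

theorem smooth_comp_face {φ : K.Nerve p → ℝ}
    (hφ : SmoothOnSubset (nerveModel I J p) 𝓘(ℝ) (K.nerveSet p) φ) (i : Fin (p + 2)) :
    SmoothOnSubset (nerveModel I J (p + 1)) 𝓘(ℝ) (K.nerveSet (p + 1))
      (fun x => φ (Nerve.face i x)) :=
  hφ.comp (smooth_face i)

theorem _root_.SmoothOnSubset.mul {S : Set M} {f g : S → ℝ} (hf : SmoothOnSubset I 𝓘(ℝ) S f)
    (hg : SmoothOnSubset I 𝓘(ℝ) S g) : SmoothOnSubset I 𝓘(ℝ) S (fun x => f x * g x) :=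
  SmoothOnSubset.contMDiff_comp (F := fun z : ℝ × ℝ => z.1 * z.2)
    (contMDiff_fst.mul contMDiff_snd) (hf.prodMk hg)

theorem _root_.SmoothOnSubset.add {S : Set M} {f g : S → ℝ} (hf : SmoothOnSubset I 𝓘(ℝ) S f)
    (hg : SmoothOnSubset I 𝓘(ℝ) S g) : SmoothOnSubset I 𝓘(ℝ) S (fun x => f x + g x) :=
  SmoothOnSubset.contMDiff_comp (F := fun z : ℝ × ℝ => z.1 + z.2)
    (contMDiff_fst.add contMDiff_snd) (hf.prodMk hg)

theorem _root_.SmoothOnSubset.const (S : Set M) (c : ℝ) :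
    SmoothOnSubset I 𝓘(ℝ) S (fun _ => c) :=
  SmoothOnSubset.of_contMDiff (F := fun _ => c) contMDiff_const

theorem _root_.SmoothOnSubset.sum {S : Set M} {ι : Type*} (s : Finset ι) {f : ι → S → ℝ}
    (hf : ∀ i, SmoothOnSubset I 𝓘(ℝ) S (f i)) :
    SmoothOnSubset I 𝓘(ℝ) S (fun x => ∑ i ∈ s, f i x) := by
  classical
  induction s using Finset.induction_on with
  | empty => simpa using SmoothOnSubset.const S 0
  | insert a s ha ih => simpa [Finset.sum_insert ha] using (hf a).add ih

/-- A family of subspaces of the spaces of real functions on `N 0`, `N 1`, …, stable under `d`. -/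
structure _root_.FunctionSubcomplex {N : ℕ → Type*}
    (d : ∀ p, (N p → ℝ) →ₗ[ℝ] (N (p + 1) → ℝ)) where
  carrier : ∀ p, Submodule ℝ (N p → ℝ)
  delta_mem : ∀ p φ, φ ∈ carrier p → d p φ ∈ carrier (p + 1)

variable (K) in
/-- A subcomplex of the complex of all real functions on the spaces `B_p`. -/
abbrev CochainSubcomplex : Type _ := FunctionSubcomplex K.delta

namespace CochainSubcomplex

/-- The cocycles of degree `p`. -/
def cocycles (S : K.CochainSubcomplex) (p : ℕ) : Submodule ℝ (K.Nerve p → ℝ) :=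
  S.carrier p ⊓ LinearMap.ker (K.delta p)

/-- The coboundaries of degree `p`. -/
def coboundaries (S : K.CochainSubcomplex) : ∀ p, Submodule ℝ (K.Nerve p → ℝ)
  | 0 => ⊥
  | p + 1 => (S.carrier p).map (K.delta p)

theorem coboundaries_le (S : K.CochainSubcomplex) : ∀ p, S.coboundaries p ≤ S.cocycles p
  | 0 => bot_le
  | p + 1 => by
    rintro _ ⟨ψ, hψ, rfl⟩
    exact ⟨S.delta_mem p ψ hψ, delta_delta ψ⟩

/-- The cohomology in degree `p`: cocycles modulo coboundaries. -/
def H (S : K.CochainSubcomplex) (p : ℕ) : Type _ :=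
  S.cocycles p ⧸ (S.coboundaries p).submoduleOf (S.cocycles p)

instance (S : K.CochainSubcomplex) (p : ℕ) : AddCommGroup (S.H p) :=
  inferInstanceAs (AddCommGroup (S.cocycles p ⧸ (S.coboundaries p).submoduleOf (S.cocycles p)))

instance (S : K.CochainSubcomplex) (p : ℕ) : Module ℝ (S.H p) :=
  inferInstanceAs (Module ℝ (S.cocycles p ⧸ (S.coboundaries p).submoduleOf (S.cocycles p)))

/-- The class of a cocycle. -/
def toH (S : K.CochainSubcomplex) (p : ℕ) : S.cocycles p →ₗ[ℝ] S.H p :=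
  ((S.coboundaries p).submoduleOf (S.cocycles p)).mkQ

theorem toH_surjective (S : K.CochainSubcomplex) (p : ℕ) : Function.Surjective (S.toH p) :=
  Submodule.mkQ_surjective _

theorem toH_eq_zero {S : K.CochainSubcomplex} {p : ℕ} {φ : S.cocycles p} :
    S.toH p φ = 0 ↔ (φ : K.Nerve p → ℝ) ∈ S.coboundaries p :=
  Submodule.Quotient.mk_eq_zero _

instance : LE K.CochainSubcomplex := ⟨fun S T => ∀ p, S.carrier p ≤ T.carrier p⟩

theorem cocycles_mono {S T : K.CochainSubcomplex} (h : S ≤ T) (p : ℕ) :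
    S.cocycles p ≤ T.cocycles p :=
  inf_le_inf_right _ (h p)

theorem coboundaries_mono {S T : K.CochainSubcomplex} (h : S ≤ T) :
    ∀ p, S.coboundaries p ≤ T.coboundaries p
  | 0 => le_rfl
  | p + 1 => Submodule.map_mono (h p)

/-- The map induced in cohomology by the inclusion of a subcomplex, in degree `p`. -/
def inclusionH {S T : K.CochainSubcomplex} (h : S ≤ T) (p : ℕ) : S.H p →ₗ[ℝ] T.H p :=
  Submodule.mapQ _ _ (Submodule.inclusion (cocycles_mono h p))
    (fun _ hx => coboundaries_mono h p hx)

/-- The map induced in total cohomology by the inclusion of a subcomplex. -/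
def totalInclusionH {S T : K.CochainSubcomplex} (h : S ≤ T) :
    (⨁ p, S.H p) →ₗ[ℝ] (⨁ p, T.H p) :=
  DirectSum.lmap (inclusionH h)

variable {ρ : G → G'} {ρ₀ : M → M'} {hρ : IsLieGroupoidMorphism K L ρ ρ₀}
  {S : K.CochainSubcomplex} {T : L.CochainSubcomplex}

/-- `S ⋆ T ⊆ S` with respect to a morphism from `K` to `L`. -/
def CupStable (hρ : IsLieGroupoidMorphism K L ρ ρ₀) (S : K.CochainSubcomplex)
    (T : L.CochainSubcomplex) : Prop :=
  ∀ (p q n : ℕ) (h : p + q = n) (φ : K.Nerve p → ℝ) (f : L.Nerve q → ℝ),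
    φ ∈ S.carrier p → f ∈ T.carrier q → cup hρ h φ f ∈ S.carrier n

theorem cup_mem_cocycles (hs : CupStable hρ S T) (h : p + q = n) {φ : K.Nerve p → ℝ}
    {f : L.Nerve q → ℝ} (hφ : φ ∈ S.cocycles p) (hf : f ∈ T.cocycles q) :
    cup hρ h φ f ∈ S.cocycles n := by
  refine ⟨hs _ _ _ h _ _ hφ.1 hf.1, ?_⟩
  have h1 : K.delta p φ = 0 := hφ.2
  have h2 : L.delta q f = 0 := hf.2
  change K.delta n (cup hρ h φ f) = 0
  rw [delta_cup, h1, h2]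
  funext x
  simp [cup]

theorem cup_mem_coboundaries_left (hs : CupStable hρ S T) (h : p + q = n) {φ : K.Nerve p → ℝ}
    {f : L.Nerve q → ℝ} (hφ : φ ∈ S.coboundaries p) (hf : f ∈ T.cocycles q) :
    cup hρ h φ f ∈ S.coboundaries n := by
  have h2 : L.delta q f = 0 := hf.2
  cases p with
  | zero =>
    have h1 : φ = 0 := hφ
    have : cup hρ h φ f = 0 := by funext x; simp [cup, h1]
    rw [this]; exact zero_mem _
  | succ p =>
    obtain ⟨ψ, hψ, rfl⟩ := hφ
    obtain ⟨n, rfl⟩ : ∃ k, n = k + 1 := ⟨p + q, by omega⟩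
    refine ⟨cup hρ (by omega) ψ f, hs _ _ _ _ _ _ hψ hf.1, ?_⟩
    rw [delta_cup, h2]
    funext x
    simp [cup]

theorem cup_mem_coboundaries_right (hs : CupStable hρ S T) (h : p + q = n) {φ : K.Nerve p → ℝ}
    {f : L.Nerve q → ℝ} (hφ : φ ∈ S.cocycles p) (hf : f ∈ T.coboundaries q) :
    cup hρ h φ f ∈ S.coboundaries n := by
  have h2 : K.delta p φ = 0 := hφ.2
  cases q with
  | zero =>
    have h1 : f = 0 := hf
    have : cup hρ h φ f = 0 := by funext x; simp [cup, h1]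
    rw [this]; exact zero_mem _
  | succ q =>
    obtain ⟨ψ, hψ, rfl⟩ := hf
    obtain ⟨n, rfl⟩ : ∃ k, n = k + 1 := ⟨p + q, by omega⟩
    refine ⟨(-1 : ℝ) ^ p • cup hρ (by omega) φ ψ,
      Submodule.smul_mem _ _ (hs _ _ _ _ _ _ hφ.1 hψ), ?_⟩
    rw [map_smul, delta_cup, h2]
    funext x
    simp only [cup, Pi.smul_apply, Pi.add_apply, Pi.zero_apply, zero_mul, zero_add, smul_eq_mul]
    rw [← mul_assoc, ← pow_add, ← two_mul, pow_mul]
    simp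

/-- The product of cocycles. -/
def cupCocycles (hs : CupStable hρ S T) (h : p + q = n) :
    S.cocycles p →ₗ[ℝ] T.cocycles q →ₗ[ℝ] S.cocycles n :=
  LinearMap.mk₂ ℝ (fun φ f => ⟨cup hρ h φ f, cup_mem_cocycles hs h φ.2 f.2⟩)
    (fun _ _ _ => Subtype.ext (funext fun _ => by simp [cup, add_mul]))
    (fun _ _ _ => Subtype.ext (funext fun _ => by simp [cup, _root_.mul_assoc]))
    (fun _ _ _ => Subtype.ext (funext fun _ => by simp [cup, mul_add]))
    (fun _ _ _ => Subtype.ext (funext fun _ => by simp [cup, mul_left_comm]))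

/-- The product in cohomology, `[φ] ⋆ [f] = [φ ⋆ f]`. -/
def cupH (hs : CupStable hρ S T) (h : p + q = n) : S.H p →ₗ[ℝ] T.H q →ₗ[ℝ] S.H n :=
  (Submodule.liftQ _
    (Submodule.liftQ _ ((cupCocycles hs h).compr₂ (S.toH n)) (by
      intro φ hφ
      refine LinearMap.ext fun f => ?_
      exact toH_eq_zero.2
        (cup_mem_coboundaries_left hs h hφ f.2))).flip (by
    intro f hf
    refine LinearMap.ext fun a => ?_
    obtain ⟨φ, rfl⟩ := CochainSubcomplex.toH_surjective _ _ a
    exact toH_eq_zero.2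
      (cup_mem_coboundaries_right hs h φ.2 hf))).flip

theorem cupH_mk (hs : CupStable hρ S T) (h : p + q = n) (φ : S.cocycles p) (f : T.cocycles q) :
    cupH hs h (S.toH p φ) (T.toH q f) = S.toH n (cupCocycles hs h φ f) := rfl

/-- The product `⨁ Hᵖ(S) × ⨁ H^q(T) → ⨁ Hⁿ(S)`. -/
def act (hs : CupStable hρ S T) :
    (⨁ p, S.H p) →ₗ[ℝ] (⨁ q, T.H q) →ₗ[ℝ] (⨁ n, S.H n) :=
  DirectSum.toModule ℝ ℕ _ fun p => LinearMap.flip <|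
    DirectSum.toModule ℝ ℕ _ fun q => LinearMap.flip <|
      (cupH hs (rfl : p + q = p + q)).compr₂ (DirectSum.lof ℝ ℕ (fun n => S.H n) (p + q))

theorem act_lof (hs : CupStable hρ S T) (h : p + q = n) (a : S.H p) (b : T.H q) :
    act hs (DirectSum.lof ℝ ℕ (fun n => S.H n) p a) (DirectSum.lof ℝ ℕ (fun n => T.H n) q b) =
      DirectSum.lof ℝ ℕ (fun n => S.H n) n (cupH hs h a b) := by
  subst h
  simp [act]

theorem act_assoc (hs : CupStable hρ S T) (ht : CupStable (IsLieGroupoidMorphism.id L) T T)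
    (x : ⨁ p, S.H p) (y z : ⨁ q, T.H q) : act hs (act hs x y) z = act hs x (act ht y z) := by
  induction x using DirectSum.induction_on with
  | zero => simp
  | add x x' hx hx' => simp only [map_add, LinearMap.add_apply, hx, hx']
  | of p a =>
  induction y using DirectSum.induction_on with
  | zero => simp
  | add x x' hx hx' => simp only [map_add, LinearMap.add_apply, hx, hx']
  | of q b =>
  induction z using DirectSum.induction_on with
  | zero => simp
  | add x x' hx hx' => simp only [map_add, hx, hx']
  | of r c =>
  change act hs (act hs (DirectSum.lof ℝ ℕ (fun n => S.H n) p a)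
    (DirectSum.lof ℝ ℕ (fun n => T.H n) q b)) (DirectSum.lof ℝ ℕ (fun n => T.H n) r c) =
    act hs (DirectSum.lof ℝ ℕ (fun n => S.H n) p a) (act ht (DirectSum.lof ℝ ℕ (fun n => T.H n) q b)
      (DirectSum.lof ℝ ℕ (fun n => T.H n) r c))
  rw [act_lof hs rfl, act_lof hs rfl, act_lof ht rfl, act_lof hs (add_assoc p q r).symm]
  congr 1
  obtain ⟨φ, rfl⟩ := CochainSubcomplex.toH_surjective _ _ a
  obtain ⟨f, rfl⟩ := CochainSubcomplex.toH_surjective _ _ b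
  obtain ⟨g, rfl⟩ := CochainSubcomplex.toH_surjective _ _ c
  refine congrArg (S.toH _) (Subtype.ext (funext fun x => ?_))
  change φ.1 (Nerve.seg 0 p (by omega) (Nerve.seg 0 (p + q) (by omega) x)) *
    f.1 (Nerve.map hρ (Nerve.seg p q (by omega) (Nerve.seg 0 (p + q) (by omega) x))) *
    g.1 (Nerve.map hρ (Nerve.seg (p + q) r (by omega) x)) =
    φ.1 (Nerve.seg 0 p (by omega) x) *
      (f.1 (Nerve.seg 0 q (by omega) (Nerve.map hρ (Nerve.seg p (q + r) (by omega) x))) *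
        g.1 (Nerve.seg q r (by omega) (Nerve.map hρ (Nerve.seg p (q + r) (by omega) x))))
  rw [← Nerve.map_seg hρ 0 q (by omega), ← Nerve.map_seg hρ q r (by omega), mul_assoc]
  rw [Nerve.seg_seg 0 (p + q) 0 p (h'' := by omega), Nerve.seg_seg 0 (p + q) p q (h'' := by omega),
    Nerve.seg_seg p (q + r) 0 q (h'' := by omega), Nerve.seg_seg p (q + r) q r (h'' := by omega)]
  simp only [zero_add, add_zero]

end CochainSubcomplex

variable (K) in
/-- The complex of smooth normalized cochains: smooth functions on `B_p` which vanish on the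
chains that contain a unit, that is, on the images of the degeneracy maps. -/
def cochains : K.CochainSubcomplex where
  carrier p :=
    { carrier := {φ | SmoothOnSubset (nerveModel I J p) 𝓘(ℝ) (K.nerveSet p) φ ∧
        ∀ (x : K.Nerve p) (i : Fin p) (m : M), x.arr i = K.one m → φ x = 0}
      zero_mem' := ⟨SmoothOnSubset.const _ 0, fun _ _ _ _ => rfl⟩
      add_mem' := fun h h' => ⟨h.1.add h'.1, fun x i m hx => by
        simp [h.2 x i m hx, h'.2 x i m hx]⟩
      smul_mem' := fun c _ h => ⟨(SmoothOnSubset.const _ c).mul h.1, fun x i m hx => by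
        simp [h.2 x i m hx]⟩ }
  delta_mem p φ h := by
    refine ⟨SmoothOnSubset.sum Finset.univ fun i : Fin (p + 2) =>
      (SmoothOnSubset.const _ ((-1) ^ (i : ℕ))).mul (smooth_comp_face h.1 i), fun x i m hx => ?_⟩
    have hobj : x.obj i.castSucc = x.obj i.succ := by
      rw [← x.tgt_arr, ← x.src_arr, hx, K.tgt_one, K.src_one]
    have hface : Nerve.face i.castSucc x = Nerve.face i.succ x := by
      refine Nerve.ext' (fun j => ?_) fun j => ?_
      · simp only [Nerve.obj_face]
        rcases lt_trichotomy (j : ℕ) i with hj | hj | hj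
        · rw [Fin.succAbove_of_castSucc_lt _ _ hj,
            Fin.succAbove_of_castSucc_lt _ _ (by rw [Fin.lt_def]; simp; omega)]
        · obtain rfl : j = i := Fin.ext hj
          simp [hobj]
        · rw [Fin.succAbove_of_le_castSucc _ _ (by rw [Fin.le_def]; simp; omega),
            Fin.succAbove_of_le_castSucc _ _ (by rw [Fin.le_def]; simp; omega)]
      · simp only [Nerve.arr_face, Nerve.faceArr, Fin.val_castSucc, Fin.val_succ]
        rcases lt_trichotomy ((j : ℕ) + 1) i with hj | hj | hj
        · rw [if_pos hj, if_pos (by omega)]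
        · rw [if_neg (by omega), if_pos hj, if_pos (by omega)]
          have e : j.succ = i := Fin.ext hj
          rw [e, hx]
          have : m = K.src (x.arr j.castSucc) := by
            rw [x.composable, e, hx, K.tgt_one]
          rw [this, K.mul_one]
        · rw [if_neg (by omega), if_neg (by omega), if_neg (by omega)]
          split_ifs with h3
          · have e : j.castSucc = i := Fin.ext (by simpa using h3)
            have : m = K.tgt (x.arr j.succ) := by
              rw [← x.composable, e, hx, K.src_one]
            rw [e, hx, this, K.one_mul]
          · rfl
    rw [delta_apply, Finset.sum_eq_add i.castSucc i.succ (by simp [Fin.ext_iff])]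
    · rw [hface]; simp [pow_succ]
    · rintro k - ⟨hk1, hk2⟩
      simp only [ne_eq, Fin.ext_iff, Fin.val_castSucc, Fin.val_succ] at hk1 hk2
      have hi := i.2
      have hk := k.2
      rcases lt_or_ge (k : ℕ) i with hlt | hge
      · rw [h.2 (Nerve.face k x) ⟨i - 1, by omega⟩ m ?_, mul_zero]
        rw [← hx, Nerve.arr_face, Nerve.faceArr, if_neg (by simp; omega), if_neg (by simp; omega)]
        exact congrArg x.arr (Fin.ext (by simp; omega))
      · rw [h.2 (Nerve.face k x) ⟨i, by omega⟩ m ?_, mul_zero]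
        rw [← hx, Nerve.arr_face, Nerve.faceArr, if_pos (by simp; omega)]
        rfl
    · simp
    · simp

theorem cochains_cupStable {ρ : G → G'} {ρ₀ : M → M'} (hρ : IsLieGroupoidMorphism K L ρ ρ₀) :
    CochainSubcomplex.CupStable hρ K.cochains L.cochains := by
  intro p q n h φ f hφ hf
  refine ⟨(hφ.1.comp (smooth_seg _ _ _)).mul
    ((hf.1.comp (smooth_map hρ)).comp (smooth_seg _ _ _)), fun x i m hx => ?_⟩
  rcases lt_or_ge (i : ℕ) p with hi | hi
  · rw [cup, hφ.2 _ ⟨i, hi⟩ m, zero_mul]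
    rw [← hx]
    exact congrArg x.arr (Fin.ext (by simp))
  · rw [cup, hf.2 _ ⟨i - p, by omega⟩ (ρ₀ m), mul_zero]
    rw [← hρ.one, ← hx]
    exact congrArg ρ (congrArg x.arr (Fin.ext (by simp; omega)))

variable (K) in
/-- The differentiable cohomology `H(K) = ⨁ Hᵖ(K)`. -/
abbrev Cohomology : Type _ := ⨁ p, K.cochains.H p

variable (K) in
/-- The constant function `1`, as a cocycle of degree zero. -/
def oneCocycle : K.cochains.cocycles 0 :=
  ⟨fun _ => 1, ⟨SmoothOnSubset.const _ 1, fun _ i => i.elim0⟩, by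
    change K.delta 0 _ = 0
    funext x; simp [delta_apply, Fin.sum_univ_two]⟩

instance : One K.Cohomology :=
  ⟨DirectSum.lof ℝ ℕ (fun n => K.cochains.H n) 0 (K.cochains.toH 0 K.oneCocycle)⟩

theorem act_one {ρ : G → G'} {ρ₀ : M → M'} {hρ : IsLieGroupoidMorphism K L ρ ρ₀}
    {S : K.CochainSubcomplex} (hs : CochainSubcomplex.CupStable hρ S L.cochains)
    (x : ⨁ p, S.H p) : CochainSubcomplex.act hs x 1 = x := by
  induction x using DirectSum.induction_on with
  | zero => simp
  | add x x' hx hx' => simp only [map_add, LinearMap.add_apply, hx, hx']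
  | of p a =>
  refine (CochainSubcomplex.act_lof hs (add_zero p) a _).trans ?_
  refine congrArg (DirectSum.lof ℝ ℕ (fun n => S.H n) p) ?_
  obtain ⟨φ, rfl⟩ := CochainSubcomplex.toH_surjective _ _ a
  refine congrArg (S.toH _) (Subtype.ext (funext fun x => ?_))
  change φ.1 (Nerve.seg 0 p _ x) * 1 = φ.1 x
  rw [mul_one]
  exact congrArg φ.1 (Nerve.ext' (fun j => congrArg x.obj (Fin.ext (by simp)))
    (fun j => congrArg x.arr (Fin.ext (by simp))))

theorem one_act (x : K.Cohomology) :
    CochainSubcomplex.act (cochains_cupStable (IsLieGroupoidMorphism.id K)) 1 x = x := by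
  induction x using DirectSum.induction_on with
  | zero => simp
  | add x x' hx hx' => simp only [map_add, hx, hx']
  | of p a =>
  refine (CochainSubcomplex.act_lof _ (zero_add p) _ a).trans ?_
  refine congrArg (DirectSum.lof ℝ ℕ (fun n => K.cochains.H n) p) ?_
  obtain ⟨φ, rfl⟩ := CochainSubcomplex.toH_surjective _ _ a
  refine congrArg (K.cochains.toH _) (Subtype.ext (funext fun x => ?_))
  change 1 * φ.1 (Nerve.map _ (Nerve.seg 0 p _ x)) = φ.1 x
  rw [one_mul]
  exact congrArg φ.1 (Nerve.ext' (fun j => congrArg x.obj (Fin.ext (by simp)))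
    (fun j => congrArg x.arr (Fin.ext (by simp))))

variable (K) in
/-- The cup product on `H(K)`. -/
def cupProduct : K.Cohomology →ₗ[ℝ] K.Cohomology →ₗ[ℝ] K.Cohomology :=
  CochainSubcomplex.act (cochains_cupStable (IsLieGroupoidMorphism.id K))

theorem cupProduct_assoc (x y z : K.Cohomology) :
    K.cupProduct (K.cupProduct x y) z = K.cupProduct x (K.cupProduct y z) :=
  CochainSubcomplex.act_assoc _ _ x y z

theorem one_cupProduct (x : K.Cohomology) : K.cupProduct 1 x = x := one_act x

theorem cupProduct_one (x : K.Cohomology) : K.cupProduct x 1 = x := act_one _ x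

/-- The ring structure of `H(K)` given by the cup product. -/
instance cohomologyRing : Ring K.Cohomology :=
  { (inferInstance : AddCommGroup (⨁ p, K.cochains.H p)) with
    mul := fun x y => K.cupProduct x y
    one := 1
    left_distrib := fun x y z => LinearMap.map_add (K.cupProduct x) y z
    right_distrib := fun x y z => LinearMap.map_add₂ K.cupProduct x y z
    zero_mul := fun x => LinearMap.map_zero₂ K.cupProduct x
    mul_zero := fun x => LinearMap.map_zero (K.cupProduct x)
    mul_assoc := cupProduct_assoc
    one_mul := one_cupProduct
    mul_one := cupProduct_one }

/-- The right `H(L)`-module structure on the cohomology of a subcomplex `S` with `S ⋆ C(L) ⊆ S`. -/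
abbrev rightModule {ρ : G → G'} {ρ₀ : M → M'} {hρ : IsLieGroupoidMorphism K L ρ ρ₀}
    {S : K.CochainSubcomplex} (hs : CochainSubcomplex.CupStable hρ S L.cochains) :
    Module (L.Cohomology)ᵐᵒᵖ (⨁ p, S.H p) where
  smul a x := CochainSubcomplex.act hs x a.unop
  one_smul x := act_one hs x
  mul_smul a b x := (CochainSubcomplex.act_assoc hs _ x b.unop a.unop).symm
  smul_zero a := by
    change CochainSubcomplex.act hs 0 _ = 0
    rw [map_zero]; rfl
  smul_add a x y := by
    change CochainSubcomplex.act hs (x + y) _ = _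
    rw [map_add]; rfl
  add_smul a b x := map_add (CochainSubcomplex.act hs x) a.unop b.unop
  zero_smul x := map_zero (CochainSubcomplex.act hs x)

end Cochains

end LieGroupoid

end Groupoids

section VB

variable {EM HM M EG HG G : Type*}
  [NormedAddCommGroup EM] [NormedSpace ℝ EM] [TopologicalSpace HM]
  [NormedAddCommGroup EG] [NormedSpace ℝ EG] [TopologicalSpace HG]
  [TopologicalSpace M] [ChartedSpace HM M] [TopologicalSpace G] [ChartedSpace HG G]
  {I : ModelWithCorners ℝ EM HM} {J : ModelWithCorners ℝ EG HG}

/-- Fiberwise multiplication by `c` on the total space of a vector bundle. -/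
def fiberScale {B : Type*} {F : Type*} {V : B → Type*} [∀ b, AddCommMonoid (V b)]
    [∀ b, Module ℝ (V b)] (c : ℝ) (v : TotalSpace F V) : TotalSpace F V :=
  ⟨v.proj, c • v.snd⟩

/-- The Lie groupoid `W` with arrows `V` and objects `E`, where `V → G` and `E → M` are smooth vector
bundles, is a VB-groupoid over the Lie groupoid `K` with arrows `G` and objects `M`: the bundle
projections form a morphism of Lie groupoids, and so do the fiberwise multiplications by each
`c ≥ 0`. -/
structure IsVBGroupoid (K : LieGroupoid I J M G)
    {FE : Type*} [NormedAddCommGroup FE] [NormedSpace ℝ FE]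
    {E : M → Type*} [∀ x, AddCommGroup (E x)] [∀ x, Module ℝ (E x)]
    [∀ x, TopologicalSpace (E x)] [TopologicalSpace (TotalSpace FE E)]
    [FiberBundle FE E] [VectorBundle ℝ FE E] [ContMDiffVectorBundle ∞ FE E I]
    {FV : Type*} [NormedAddCommGroup FV] [NormedSpace ℝ FV]
    {V : G → Type*} [∀ g, AddCommGroup (V g)] [∀ g, Module ℝ (V g)]
    [∀ g, TopologicalSpace (V g)] [TopologicalSpace (TotalSpace FV V)]
    [FiberBundle FV V] [VectorBundle ℝ FV V] [ContMDiffVectorBundle ∞ FV V J]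
    (W : LieGroupoid (I.prod 𝓘(ℝ, FE)) (J.prod 𝓘(ℝ, FV)) (TotalSpace FE E) (TotalSpace FV V)) :
    Prop where
  proj : IsLieGroupoidMorphism W K TotalSpace.proj TotalSpace.proj
  scale : ∀ c : ℝ, 0 ≤ c → IsLieGroupoidMorphism W W (fiberScale c) (fiberScale c)

namespace IsVBGroupoid

open LieGroupoid

variable {K : LieGroupoid I J M G}
  {FE : Type*} [NormedAddCommGroup FE] [NormedSpace ℝ FE]
  {E : M → Type*} [∀ x, AddCommGroup (E x)] [∀ x, Module ℝ (E x)]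
  [∀ x, TopologicalSpace (E x)] [TopologicalSpace (TotalSpace FE E)]
  [FiberBundle FE E] [VectorBundle ℝ FE E] [ContMDiffVectorBundle ∞ FE E I]
  {FV : Type*} [NormedAddCommGroup FV] [NormedSpace ℝ FV]
  {V : G → Type*} [∀ g, AddCommGroup (V g)] [∀ g, Module ℝ (V g)]
  [∀ g, TopologicalSpace (V g)] [TopologicalSpace (TotalSpace FV V)]
  [FiberBundle FV V] [VectorBundle ℝ FV V] [ContMDiffVectorBundle ∞ FV V J]
  {W : LieGroupoid (I.prod 𝓘(ℝ, FE)) (J.prod 𝓘(ℝ, FV)) (TotalSpace FE E) (TotalSpace FV V)}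
  (𝒱 : IsVBGroupoid K W)

/-- The zero `0_g` of the fiber `V_g`. -/
abbrev zeroArr (_ : IsVBGroupoid K W) (g : G) : TotalSpace FV V := ⟨g, 0⟩

/-- The complex of `k`-homogeneous cochains: the smooth normalized cochains `φ` of the Lie groupoid
`V ⇉ E` with `φ(c ξ₁, …, c ξ_p) = c ^ k φ(ξ₁, …, ξ_p)` for all `c ≥ 0`. -/
def homCochains (k : ℕ) : W.CochainSubcomplex where
  carrier p :=
    { carrier := {φ | φ ∈ W.cochains.carrier p ∧
        ∀ (c : ℝ) (hc : 0 ≤ c) (x : W.Nerve p), φ (Nerve.map (𝒱.scale c hc) x) = c ^ k * φ x}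
      zero_mem' := ⟨zero_mem _, fun _ _ _ => by simp⟩
      add_mem' := fun h h' => ⟨add_mem h.1 h'.1, fun c hc x => by
        simp only [Pi.add_apply, h.2 c hc x, h'.2 c hc x, mul_add]⟩
      smul_mem' := fun a _ h => ⟨Submodule.smul_mem _ a h.1, fun c hc x => by
        simp only [Pi.smul_apply, smul_eq_mul, h.2 c hc x]; ring⟩ }
  delta_mem p φ h := by
    refine ⟨W.cochains.delta_mem p φ h.1, fun c hc x => ?_⟩
    simp only [delta_apply, ← Nerve.map_face, h.2 c hc, Finset.mul_sum]
    exact Finset.sum_congr rfl fun _ _ => by ring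

/-- The two additional conditions on VB-groupoid cochains of degree `p ≥ 1`:
`φ(0_g, ξ₁, …, ξ_(p-1)) = 0` and `φ(0_g ξ₁, ξ₂, …, ξ_p) = φ(ξ₁, …, ξ_p)` whenever these make
sense. There is no condition in degree zero. -/
def IsLeftProjectable : ∀ p : ℕ, (W.Nerve p → ℝ) → Prop
  | 0, _ => True
  | p + 1, φ =>
    (∀ (x : W.Nerve (p + 1)) (g : G), x.arr 0 = 𝒱.zeroArr g → φ x = 0) ∧
    (∀ (x x' : W.Nerve (p + 1)) (g : G),
      W.src (𝒱.zeroArr g) = W.tgt (x.arr 0) →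
      x'.arr 0 = W.mul (𝒱.zeroArr g) (x.arr 0) →
      (∀ j : Fin p, x'.arr j.succ = x.arr j.succ) → φ x' = φ x)

theorem tgt_zeroArr (g : G) : W.tgt (𝒱.zeroArr g) = ⟨K.tgt g, 0⟩ := by
  have h := (𝒱.scale 0 le_rfl).tgt (𝒱.zeroArr g)
  have h' := 𝒱.proj.tgt (𝒱.zeroArr g)
  have e : fiberScale 0 (𝒱.zeroArr g) = 𝒱.zeroArr g := by simp [fiberScale]
  rw [e] at h
  rw [h, fiberScale, zero_smul, ← h']

theorem src_zeroArr (g : G) : W.src (𝒱.zeroArr g) = ⟨K.src g, 0⟩ := by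
  have h := (𝒱.scale 0 le_rfl).src (𝒱.zeroArr g)
  have h' := 𝒱.proj.src (𝒱.zeroArr g)
  have e : fiberScale 0 (𝒱.zeroArr g) = 𝒱.zeroArr g := by simp [fiberScale]
  rw [e] at h
  rw [h, fiberScale, zero_smul, ← h']

theorem homCochains_one_zero {φ : W.Nerve 0 → ℝ} (hφ : φ ∈ (𝒱.homCochains 1).carrier 0)
    (x : W.Nerve 0) {m : M} (hx : x.obj 0 = ⟨m, 0⟩) : φ x = 0 := by
  have h := hφ.2 0 le_rfl x
  have e : Nerve.map (𝒱.scale 0 le_rfl) x = x := by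
    refine Nerve.ext' (fun i => ?_) fun i => i.elim0
    obtain rfl : i = 0 := Fin.ext (by omega)
    rw [Nerve.obj_map, hx, fiberScale, smul_zero]
  rw [e] at h
  simpa using h

/-- Chains that differ only in their first arrow have the same objects, except for the first. -/
theorem obj_succ_eq {p : ℕ} {x x' : W.Nerve (p + 1)} {g : G}
    (h : W.src (𝒱.zeroArr g) = W.tgt (x.arr 0))
    (h0 : x'.arr 0 = W.mul (𝒱.zeroArr g) (x.arr 0))
    (hs : ∀ j : Fin p, x'.arr j.succ = x.arr j.succ) (j : Fin (p + 1)) :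
    x'.obj j.succ = x.obj j.succ := by
  rw [← Nerve.src_arr, ← Nerve.src_arr]
  induction j using Fin.cases with
  | zero => rw [h0, W.src_mul _ _ h]
  | succ j => rw [hs]

theorem IsLeftProjectable.delta {p : ℕ} {φ : W.Nerve p → ℝ}
    (hφ : φ ∈ (𝒱.homCochains 1).carrier p) (h : 𝒱.IsLeftProjectable p φ) :
    𝒱.IsLeftProjectable (p + 1) (W.delta p φ) := by
  cases p with
  | zero =>
    refine ⟨fun x g hx => ?_, fun x x' g hc h0 hs => ?_⟩
    · rw [delta_apply, Fin.sum_univ_two,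
        𝒱.homCochains_one_zero hφ (Nerve.face 0 x) (m := K.src g),
        𝒱.homCochains_one_zero hφ (Nerve.face 1 x) (m := K.tgt g)]
      · simp
      · rw [← 𝒱.tgt_zeroArr, ← hx, Nerve.tgt_arr]; rfl
      · rw [← 𝒱.src_zeroArr, ← hx, Nerve.src_arr]; rfl
    · have e : Nerve.face 0 x' = Nerve.face 0 x := by
        refine Nerve.ext' (fun j => ?_) fun j => j.elim0
        simpa using 𝒱.obj_succ_eq hc h0 hs j
      rw [delta_apply, delta_apply, Fin.sum_univ_two, Fin.sum_univ_two, e,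
        𝒱.homCochains_one_zero hφ (Nerve.face 1 x) (m := K.src g),
        𝒱.homCochains_one_zero hφ (Nerve.face 1 x') (m := K.tgt g)]
      · rw [← 𝒱.tgt_zeroArr, ← W.tgt_mul _ _ hc, ← h0, Nerve.tgt_arr]; rfl
      · rw [← 𝒱.src_zeroArr, hc, Nerve.tgt_arr]; rfl
  | succ p =>
    refine ⟨fun x g hx => ?_, fun x x' g hc h0 hs => ?_⟩
    · rw [delta_apply, Fin.sum_univ_succ, Fin.sum_univ_succ, Finset.sum_eq_zero, add_zero]
      · have hcomp : W.src (𝒱.zeroArr g) = W.tgt ((Nerve.face 0 x).arr 0) := by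
          rw [← hx]; exact x.composable 0
        rw [h.2 (Nerve.face 0 x) (Nerve.face (Fin.succ 0) x) g hcomp]
        · simp
        · rw [← hx]; rfl
        · intro j; rfl
      · intro j _
        rw [h.1 _ g, mul_zero]
        rw [← hx]
        simp [Nerve.faceArr]
    · rw [delta_apply, delta_apply, Fin.sum_univ_succ, Fin.sum_univ_succ (n := p + 2)]
      have e : Nerve.face 0 x' = Nerve.face 0 x := by
        refine Nerve.ext' (fun j => ?_) fun j => hs j
        simpa using 𝒱.obj_succ_eq hc h0 hs j
      rw [e]
      congr 1
      refine Finset.sum_congr rfl fun k _ => ?_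
      congr 1
      have hxc := x.composable 0
      refine h.2 _ _ g ?_ ?_ fun j => ?_
      · simp only [Nerve.arr_face, Nerve.faceArr]
        split_ifs with h1 h2
        · exact hc
        · exact hc.trans (W.tgt_mul _ _ hxc).symm
        · simp at h1 h2; omega
      · simp only [Nerve.arr_face, Nerve.faceArr]
        split_ifs with h1 h2
        · exact h0
        · have h0' : x'.arr (Fin.castSucc 0) = _ := h0
          rw [h0', hs, W.mul_assoc _ _ _ hc hxc]; rfl
        · simp at h1 h2; omega
      · have hs' : x'.arr j.succ.castSucc = x.arr j.succ.castSucc := hs j.castSucc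
        simp only [Nerve.arr_face, Nerve.faceArr, hs, hs']

theorem IsLeftProjectable.add {p : ℕ} {φ ψ : W.Nerve p → ℝ}
    (h : 𝒱.IsLeftProjectable p φ) (h' : 𝒱.IsLeftProjectable p ψ) :
    𝒱.IsLeftProjectable p (φ + ψ) := by
  cases p with
  | zero => trivial
  | succ p =>
    refine ⟨fun x g hx => ?_, fun x x' g hc h0 hs => ?_⟩
    · rw [Pi.add_apply, h.1 x g hx, h'.1 x g hx, add_zero]
    · rw [Pi.add_apply, Pi.add_apply, h.2 x x' g hc h0 hs, h'.2 x x' g hc h0 hs]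

theorem IsLeftProjectable.smul {p : ℕ} {φ : W.Nerve p → ℝ} (a : ℝ)
    (h : 𝒱.IsLeftProjectable p φ) : 𝒱.IsLeftProjectable p (a • φ) := by
  cases p with
  | zero => trivial
  | succ p =>
    refine ⟨fun x g hx => ?_, fun x x' g hc h0 hs => ?_⟩
    · rw [Pi.smul_apply, h.1 x g hx, smul_zero]
    · rw [Pi.smul_apply, Pi.smul_apply, h.2 x x' g hc h0 hs]

theorem IsLeftProjectable.zero (p : ℕ) : 𝒱.IsLeftProjectable p 0 := by
  cases p with
  | zero => trivial
  | succ p => exact ⟨fun _ _ _ => rfl, fun _ _ _ _ _ _ => rfl⟩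

/-- The VB-groupoid cochain complex. -/
def vbCochains : W.CochainSubcomplex where
  carrier p :=
    { carrier := {φ | φ ∈ (𝒱.homCochains 1).carrier p ∧ 𝒱.IsLeftProjectable p φ}
      zero_mem' := ⟨zero_mem _, .zero 𝒱 p⟩
      add_mem' := fun h h' => ⟨add_mem h.1 h'.1, h.2.add 𝒱 h'.2⟩
      smul_mem' := fun a _ h => ⟨Submodule.smul_mem _ a h.1, h.2.smul 𝒱 a⟩ }
  delta_mem p φ h := ⟨(𝒱.homCochains 1).delta_mem p φ h.1, h.2.delta 𝒱 h.1⟩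

theorem vbCochains_le : 𝒱.vbCochains ≤ 𝒱.homCochains 1 := fun _ _ h => h.1

theorem homCochains_cupStable (k : ℕ) :
    CochainSubcomplex.CupStable 𝒱.proj (𝒱.homCochains k) K.cochains := by
  intro p q n h φ f hφ hf
  refine ⟨cochains_cupStable 𝒱.proj p q n h φ f hφ.1 hf, fun c hc x => ?_⟩
  rw [cup, ← Nerve.map_seg, hφ.2 c hc, mul_assoc]
  rfl

theorem vbCochains_cupStable :
    CochainSubcomplex.CupStable 𝒱.proj 𝒱.vbCochains K.cochains := by
  intro p q n h φ f hφ hf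
  refine ⟨𝒱.homCochains_cupStable 1 p q n h φ f hφ.1 hf, ?_⟩
  cases n with
  | zero => trivial
  | succ n =>
    cases p with
    | zero =>
      have key : ∀ (x : W.Nerve (n + 1)) (m : M), W.tgt (x.arr 0) = ⟨m, 0⟩ →
          cup 𝒱.proj h φ f x = 0 := fun x m hx => by
        rw [cup, 𝒱.homCochains_one_zero hφ.1 _ (m := m), zero_mul]
        rw [← hx, Nerve.tgt_arr]; rfl
      refine ⟨fun x g hx => key x (K.tgt g) ?_, fun x x' g hc h0 hs => ?_⟩
      · rw [hx, 𝒱.tgt_zeroArr]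
      · rw [key x (K.src g), key x' (K.tgt g)]
        · rw [h0, W.tgt_mul _ _ hc, 𝒱.tgt_zeroArr]
        · rw [← hc, 𝒱.src_zeroArr]
    | succ p =>
      refine ⟨fun x g hx => ?_, fun x x' g hc h0 hs => ?_⟩
      · rw [cup, hφ.2.1 _ g, zero_mul]
        rw [← hx]; rfl
      · rw [cup, cup, hφ.2.2 (Nerve.seg 0 (p + 1) (by omega) x)
          (Nerve.seg 0 (p + 1) (by omega) x') g hc h0]
        · congr 2
          refine congrArg _ (Nerve.ext' (fun j => ?_) fun j => ?_)
          · have e : (⟨p + 1 + j, by omega⟩ : Fin (n + 2)) =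
              Fin.succ ⟨p + j, by omega⟩ := Fin.ext (by simp; omega)
            rw [Nerve.obj_seg, Nerve.obj_seg, e]
            exact 𝒱.obj_succ_eq hc h0 hs _
          · have e : (⟨p + 1 + j, by omega⟩ : Fin (n + 1)) =
              Fin.succ ⟨p + j, by omega⟩ := Fin.ext (by simp; omega)
            rw [Nerve.arr_seg, Nerve.arr_seg, e]
            exact hs _
        · intro j
          have e : (⟨0 + (j.succ : Fin (p + 1)), by omega⟩ : Fin (n + 1)) =
              Fin.succ ⟨j, by omega⟩ := Fin.ext (by simp)
          rw [Nerve.arr_seg, Nerve.arr_seg, e]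
          exact hs _

/-- The right `H(K)`-module structure on the cohomology of `k`-homogeneous cochains. -/
instance homModule (k : ℕ) : Module (K.Cohomology)ᵐᵒᵖ (⨁ p, (𝒱.homCochains k).H p) :=
  rightModule (𝒱.homCochains_cupStable k)

/-- The right `H(K)`-module structure on the VB-groupoid cohomology. -/
instance vbModule : Module (K.Cohomology)ᵐᵒᵖ (⨁ p, 𝒱.vbCochains.H p) :=
  rightModule 𝒱.vbCochains_cupStable

end IsVBGroupoid

end VB

end

set_option linter.unusedSectionVars false

/-! A tuple `(a₀, …, a_n)` of arrows with a common target gives the chain of the arrows `a_k⁻¹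
a_(k+1)`, and every chain arises in this way from its partial products `1, ξ₁, ξ₁ξ₂, …`. The `i`-th
face of the chain is the omission of `a_i`, and left multiplication of the tuple by an arrow does
not change the chain. So, on tuples of arrows with target `0_x`, the differential `δ` becomes the
simplicial one (`coneFun_delta`). The map `z` that sends an arrow to the zero of its fiber acts on
these tuples, and the prism operator `P` is a homotopy between the identity and `z^*`
(`prismSum_omitSum`). A linear cochain vanishes on tuples of zeros, so `z^*` kills it. Moreover `Pψ`
is invariant under left multiplication by the zero arrows, because `z` fixes them.

Let `ψ` be linear with `δψ` left-projectable, and let `y = (ξ₁, ξ₂, …)` start at `0_x`. Then `Pδψ`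
vanishes on the partial products of `y`: the chains of the prism start with a zero arrow. Suppose
that a linear cochain `β` is given by `Pψ` on the chains that start at a zero. The faces of `y`
other than the zeroth still start at `0_x`, so the homotopy formula becomes `(ψ - δβ)(y) = Pψ(ξ₁,
ξ₁ξ₂, …) - β(∂₀ y)` (`sub_delta_correction`). The two conditions of left-projectability concern only
chains that start at a zero, and both can be read off: if `ξ₁` is a zero arrow, then the two terms
agree by invariance, and replacing `ξ₁` by `0_g ξ₁` changes neither of them.

It remains to define `β` on all chains. A smooth linear splitting `h` of the target map `V → t^*E`
that equals the unit map over the units exists by a partition of unity, since these conditions are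
fiberwise convex. The operation `Λ(v, e) = v + h(e - t(v))` then moves the first object of a chain
to zero and drags the later ones along, and `β` is `Pψ` of the resulting chain (`correction`). The
properties of `Λ` make `β` smooth, normalized and linear (`correction_mem`).

Thus every linear cochain whose coboundary is left-projectable becomes left-projectable after
subtraction of the coboundary of a linear cochain. This formally implies that the inclusion is a
quasi-isomorphism (`bijective_inclusionH`). It respects the module structures because both products
are given by one formula on cochains. -/

noncomputable section

/-! ### The prism operator on tuples of a set with a self-map. -/

section Prism

variable {S : Type*}

/-- The alternating sum over the omissions of one entry, for functions of `n`-tuples. -/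
def omitSum {n : ℕ} (F : (Fin n → S) → ℝ) (a : Fin (n + 1) → S) : ℝ :=
  ∑ i : Fin (n + 1), (-1) ^ (i : ℕ) * F (fun k => a (i.succAbove k))

/-- The tuple `(z a₀, …, z a_i, a_i, …, a_(n-1))`. -/
def prism (z : S → S) {n : ℕ} (i : Fin n) (a : Fin n → S) (k : Fin (n + 1)) : S :=
  if k ≤ i.castSucc then z (a (i.predAbove k)) else a (i.predAbove k)

/-- The prism operator. -/
def prismSum (z : S → S) {n : ℕ} (F : (Fin (n + 1) → S) → ℝ) (a : Fin n → S) : ℝ :=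
  ∑ i : Fin n, (-1) ^ (i : ℕ) * F (prism z i a)

/-- Splitting off the first entry, here and in `prismSum_cons`, turns the homotopy formula into an
induction on the length without double sums. -/
theorem omitSum_cons {n : ℕ} (F : (Fin (n + 1) → S) → ℝ) (x : S) (b : Fin (n + 1) → S) :
    omitSum F (Fin.cons x b) = F b - omitSum (fun c => F (Fin.cons x c)) b := by
  rw [omitSum, Fin.sum_univ_succ, omitSum, sub_eq_add_neg, ← Finset.sum_neg_distrib]
  congr 1
  · simp
  · refine Finset.sum_congr rfl fun i _ => ?_
    have : (fun k => (Fin.cons x b : Fin (n + 2) → S) (i.succ.succAbove k)) =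
        Fin.cons x (fun k => b (i.succAbove k)) := by
      funext k
      induction k using Fin.cases with
      | zero => simp
      | succ k => simp
    rw [this, Fin.val_succ, pow_succ]
    ring

theorem prism_zero_cons (z : S → S) {n : ℕ} (x : S) (b : Fin n → S) :
    prism z 0 (Fin.cons x b : Fin (n + 1) → S) = Fin.cons (z x) (Fin.cons x b) := by
  funext k
  induction k using Fin.cases with
  | zero => simp [prism]
  | succ k => simp [prism]

theorem prism_succ_cons (z : S → S) {n : ℕ} (i : Fin n) (x : S) (b : Fin n → S) :
    prism z i.succ (Fin.cons x b : Fin (n + 1) → S) = Fin.cons (z x) (prism z i b) := by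
  funext k
  induction k using Fin.cases with
  | zero => simp [prism]
  | succ k => simp [prism, Fin.le_def]

theorem prismSum_cons (z : S → S) {n : ℕ} (F : (Fin (n + 2) → S) → ℝ) (x : S) (b : Fin n → S) :
    prismSum z F (Fin.cons x b : Fin (n + 1) → S) =
      F (Fin.cons (z x) (Fin.cons x b)) - prismSum z (fun c => F (Fin.cons (z x) c)) b := by
  rw [prismSum, Fin.sum_univ_succ, prismSum, sub_eq_add_neg, ← Finset.sum_neg_distrib,
    prism_zero_cons]
  congr 1
  · simp
  · refine Finset.sum_congr rfl fun i _ => ?_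
    rw [prism_succ_cons, Fin.val_succ, pow_succ]
    ring

theorem prismSum_sub (z : S → S) {n : ℕ} (F F' : (Fin (n + 1) → S) → ℝ) (a : Fin n → S) :
    prismSum z (fun c => F c - F' c) a = prismSum z F a - prismSum z F' a := by
  simp [prismSum, mul_sub, Finset.sum_sub_distrib]

theorem omitSum_sub {n : ℕ} (F F' : (Fin n → S) → ℝ) (a : Fin (n + 1) → S) :
    omitSum (fun c => F c - F' c) a = omitSum F a - omitSum F' a := by
  simp [omitSum, mul_sub, Finset.sum_sub_distrib]

/-- The prism operator is a chain homotopy between the identity and `z`. -/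
theorem prismSum_omitSum (z : S → S) {n : ℕ} (F : (Fin (n + 1) → S) → ℝ) (a : Fin (n + 1) → S) :
    prismSum z (omitSum F) a + omitSum (prismSum z F) a = F a - F (fun k => z (a k)) := by
  induction n with
  | zero =>
    obtain ⟨x, b, rfl⟩ : ∃ x b, a = Fin.cons x b := ⟨a 0, Fin.tail a, (Fin.cons_self_tail a).symm⟩
    have e : (fun k => z ((Fin.cons x b : Fin 1 → S) k)) =
        (fun k => (Fin.cons (z x) b : Fin 1 → S) k) := by
      funext k; obtain rfl : k = 0 := Fin.ext (by omega)
      rfl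
    rw [prismSum_cons, omitSum_cons, e]
    simp only [omitSum, prismSum]
    simp
  | succ n ih =>
    obtain ⟨x, b, rfl⟩ : ∃ x b, a = Fin.cons x b := ⟨a 0, Fin.tail a, (Fin.cons_self_tail a).symm⟩
    have e : (fun k => z ((Fin.cons x b : Fin (n + 2) → S) k)) =
        Fin.cons (z x) (fun k => z (b k)) := by
      funext k
      induction k using Fin.cases <;> simp
    rw [prismSum_cons, omitSum_cons, omitSum_cons, omitSum_cons, e]
    simp only [omitSum_cons, prismSum_cons]
    -- The terms with both `z x` and `x` in front cancel, as do the prism sums of `F` over `b`. What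
    -- remains is the homotopy formula for `F` with `z x` fixed as first entry.
    have h := ih (fun c => F (Fin.cons (z x) c)) b
    rw [prismSum_sub, omitSum_sub]
    linarith

end Prism

/-! ### Chains as tuples of arrows with a common target. -/

section Groupoids

variable {EM HM M EG HG G EM' HM' M' EG' HG' G' : Type*}
  [NormedAddCommGroup EM] [NormedSpace ℝ EM] [TopologicalSpace HM]
  [NormedAddCommGroup EG] [NormedSpace ℝ EG] [TopologicalSpace HG]
  [TopologicalSpace M] [ChartedSpace HM M] [TopologicalSpace G] [ChartedSpace HG G]
  [NormedAddCommGroup EM'] [NormedSpace ℝ EM'] [TopologicalSpace HM']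
  [NormedAddCommGroup EG'] [NormedSpace ℝ EG'] [TopologicalSpace HG']
  [TopologicalSpace M'] [ChartedSpace HM' M'] [TopologicalSpace G'] [ChartedSpace HG' G']
  {I : ModelWithCorners ℝ EM HM} {J : ModelWithCorners ℝ EG HG}
  {I' : ModelWithCorners ℝ EM' HM'} {J' : ModelWithCorners ℝ EG' HG'}

namespace LieGroupoid

variable {K : LieGroupoid I J M G} {L : LieGroupoid I' J' M' G'}

theorem inv_mul_cancel_left {g h : G} (hc : K.src g = K.tgt h) :
    K.mul (K.inv g) (K.mul g h) = h := by
  rw [← K.mul_assoc _ _ _ (K.src_inv g) hc, K.inv_mul, hc, K.one_mul]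

theorem mul_inv_cancel_left {g h : G} (hc : K.tgt g = K.tgt h) :
    K.mul g (K.mul (K.inv g) h) = h := by
  rw [← K.mul_assoc _ _ _ (K.tgt_inv g).symm ((K.src_inv g).trans hc), K.mul_inv, hc, K.one_mul]

theorem mul_left_cancel {g h k : G} (hc : K.src g = K.tgt h) (hc' : K.src g = K.tgt k)
    (e : K.mul g h = K.mul g k) : h = k := by
  rw [← inv_mul_cancel_left hc, e, inv_mul_cancel_left hc']

/-- This cancellation is why the chain of a cone does not see left multiplication. -/
theorem mul_inv_rev_mul {g a b : G} (ha : K.src g = K.tgt a) (hb : K.src g = K.tgt b) :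
    K.mul (K.inv (K.mul g a)) (K.mul g b) = K.mul (K.inv a) b := by
  have hga : K.tgt (K.mul g a) = K.tgt g := K.tgt_mul _ _ ha
  have hgb : K.tgt (K.mul g b) = K.tgt g := K.tgt_mul _ _ hb
  have hab : K.src (K.inv a) = K.tgt b := by rw [K.src_inv, ← ha, hb]
  refine K.mul_left_cancel (g := K.mul g a) ?_ ?_ ?_
  · rw [K.tgt_mul, K.tgt_inv]; rw [K.src_inv, hga, hgb]
  · rw [K.tgt_mul _ _ hab, K.src_mul _ _ ha, K.tgt_inv]
  · rw [mul_inv_cancel_left (hga.trans hgb.symm), K.mul_assoc _ _ _ ha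
      (by rw [K.tgt_mul _ _ hab, K.tgt_inv]), mul_inv_cancel_left (ha.symm.trans hb)]

theorem _root_.IsLieGroupoidMorphism.inv {f : G → G'} {f₀ : M → M'}
    (hf : IsLieGroupoidMorphism K L f f₀) (g : G) : f (K.inv g) = L.inv (f g) := by
  refine L.mul_left_cancel (g := f g) ?_ ?_ ?_
  · rw [hf.src, hf.tgt, K.tgt_inv]
  · rw [L.tgt_inv]
  · rw [← hf.mul _ _ (K.tgt_inv g).symm, K.mul_inv, hf.one, L.mul_inv, hf.tgt]

variable (K) in
/-- The tuples of arrows with a common target. -/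
def coneSet (n : ℕ) : Set (Fin (n + 1) → G) := {a | ∀ j k, K.tgt (a j) = K.tgt (a k)}

/-- The chain `s(a₀) ← s(a₁) ← ⋯ ← s(a_n)` with the arrows `a_k⁻¹ a_(k+1)`. -/
def ofCone {n : ℕ} (a : K.coneSet n) : K.Nerve n :=
  ⟨(fun k => K.src (a.1 k), fun k => K.mul (K.inv (a.1 k.castSucc)) (a.1 k.succ)), fun k => by
    have h : K.src (K.inv (a.1 k.castSucc)) = K.tgt (a.1 k.succ) :=
      (K.src_inv _).trans (a.2 _ _)
    exact ⟨(K.tgt_mul _ _ h).trans (K.tgt_inv _), K.src_mul _ _ h⟩⟩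

@[simp] theorem obj_ofCone {n : ℕ} (a : K.coneSet n) (k) :
    (ofCone a).obj k = K.src (a.1 k) := rfl
@[simp] theorem arr_ofCone {n : ℕ} (a : K.coneSet n) (k : Fin n) :
    (ofCone a).arr k = K.mul (K.inv (a.1 k.castSucc)) (a.1 k.succ) := rfl

/-- The cone without its `i`-th entry. -/
def coneOmit {n : ℕ} (i : Fin (n + 2)) (a : K.coneSet (n + 1)) : K.coneSet n :=
  ⟨fun k => a.1 (i.succAbove k), fun _ _ => a.2 _ _⟩

/-- At an inner vertex the product of the two adjacent arrows telescopes, `(a⁻¹ b)(b⁻¹ c) = a⁻¹ c`.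
This makes `δ` the simplicial differential on cones. -/
theorem face_ofCone {n : ℕ} (i : Fin (n + 2)) (a : K.coneSet (n + 1)) :
    Nerve.face i (ofCone a) = ofCone (coneOmit i a) := by
  refine Nerve.ext' (fun _ => rfl) fun j => ?_
  have key : ∀ b b' c c' : Fin (n + 2), (b : ℕ) = b' → (c : ℕ) = c' →
      K.mul (K.inv (a.1 b)) (a.1 c) = K.mul (K.inv (a.1 b')) (a.1 c') := by
    intro b b' c c' h h'
    rw [Fin.ext h, Fin.ext h']
  simp only [Nerve.arr_face, Nerve.faceArr, arr_ofCone, coneOmit]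
  split_ifs with h1 h2
  · exact key _ _ _ _ (by simp [Fin.succAbove, Fin.lt_def]; grind)
      (by simp [Fin.succAbove, Fin.lt_def]; grind)
  · have hc : K.src (K.inv (a.1 j.castSucc.castSucc)) = K.tgt (a.1 j.castSucc.succ) :=
      (K.src_inv _).trans (a.2 _ _)
    have hd : K.src (K.inv (a.1 j.castSucc.succ)) = K.tgt (a.1 j.succ.succ) :=
      (K.src_inv _).trans (a.2 _ _)
    have e : K.mul (K.mul (K.inv (a.1 j.castSucc.castSucc)) (a.1 j.castSucc.succ))
        (K.mul (K.inv (a.1 j.castSucc.succ)) (a.1 j.succ.succ)) =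
        K.mul (K.inv (a.1 j.castSucc.castSucc)) (a.1 j.succ.succ) := by
      rw [K.mul_assoc _ _ _ hc ((K.tgt_inv _).symm.trans (K.tgt_mul _ _ hd).symm),
        mul_inv_cancel_left (a.2 _ _)]
    exact e.trans (key _ _ _ _ (by simp [Fin.succAbove, Fin.lt_def]; grind)
      (by simp [Fin.succAbove, Fin.lt_def]; grind))
  · exact key _ _ _ _ (by simp [Fin.succAbove, Fin.lt_def]; grind)
      (by simp [Fin.succAbove, Fin.lt_def]; grind)

theorem ofCone_mul_left {n : ℕ} (g : G) (a b : K.coneSet n)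
    (hc : ∀ k, K.src g = K.tgt (a.1 k)) (hb : ∀ k, b.1 k = K.mul g (a.1 k)) :
    ofCone b = ofCone a := by
  refine Nerve.ext' (fun k => ?_) fun k => ?_
  · rw [obj_ofCone, obj_ofCone, hb, K.src_mul _ _ (hc k)]
  · rw [arr_ofCone, arr_ofCone, hb, hb, mul_inv_rev_mul (hc _) (hc _)]

theorem map_ofCone {f : G → G'} {f₀ : M → M'} (hf : IsLieGroupoidMorphism K L f f₀) {n : ℕ}
    (a : K.coneSet n) (b : L.coneSet n) (hb : ∀ k, b.1 k = f (a.1 k)) :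
    Nerve.map hf (ofCone a) = ofCone b := by
  refine Nerve.ext' (fun k => ?_) fun k => ?_
  · rw [Nerve.obj_map, obj_ofCone, obj_ofCone, hb, hf.src]
  · have hc : K.src (K.inv (a.1 k.castSucc)) = K.tgt (a.1 k.succ) :=
      (K.src_inv _).trans (a.2 _ _)
    rw [Nerve.arr_map, arr_ofCone, arr_ofCone, hf.mul _ _ hc, hf.inv, hb, hb]

/-- The partial products `1, g₁, g₁g₂, …` of a chain. -/
def partialProd {n : ℕ} (x : K.Nerve n) : Fin (n + 1) → G :=
  Fin.induction (K.one (x.obj 0)) (fun k a => K.mul a (x.arr k))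

theorem partialProd_zero {n : ℕ} (x : K.Nerve n) : partialProd x 0 = K.one (x.obj 0) := rfl

theorem partialProd_succ {n : ℕ} (x : K.Nerve n) (k : Fin n) :
    partialProd x k.succ = K.mul (partialProd x k.castSucc) (x.arr k) := rfl

theorem src_tgt_partialProd {n : ℕ} (x : K.Nerve n) (k : Fin (n + 1)) :
    K.src (partialProd x k) = x.obj k ∧ K.tgt (partialProd x k) = x.obj 0 := by
  induction k using Fin.induction with
  | zero => rw [partialProd_zero, K.src_one, K.tgt_one]; exact ⟨rfl, rfl⟩
  | succ k ih =>
    have hc := ih.1.trans (x.tgt_arr k).symm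
    rw [partialProd_succ, K.src_mul _ _ hc, K.tgt_mul _ _ hc]
    exact ⟨x.src_arr k, ih.2⟩

theorem composable_partialProd {n : ℕ} (x : K.Nerve n) (k : Fin n) :
    K.src (partialProd x k.castSucc) = K.tgt (x.arr k) :=
  (src_tgt_partialProd x _).1.trans (x.tgt_arr k).symm

/-- The cone of the partial products of a chain. -/
def toCone {n : ℕ} (x : K.Nerve n) : K.coneSet n :=
  ⟨partialProd x, fun j k => (src_tgt_partialProd x j).2.trans (src_tgt_partialProd x k).2.symm⟩

theorem ofCone_toCone {n : ℕ} (x : K.Nerve n) : ofCone (toCone x) = x := by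
  refine Nerve.ext' (fun k => (src_tgt_partialProd x k).1) fun k => ?_
  exact inv_mul_cancel_left (composable_partialProd x k)

/-- The partial products telescope to `a₀⁻¹ a_k`. A cone is therefore determined by its chain up to
left multiplication, and exactly if it starts with a unit. -/
theorem partialProd_ofCone {n : ℕ} (a : K.coneSet n) (k : Fin (n + 1)) :
    K.mul (a.1 0) (partialProd (ofCone a) k) = a.1 k := by
  induction k using Fin.induction with
  | zero => rw [partialProd_zero, obj_ofCone, K.mul_one]
  | succ k ih =>
    have h0 : K.src (a.1 0) = K.tgt (partialProd (ofCone a) k.castSucc) :=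
      (src_tgt_partialProd (ofCone a) _).2.symm
    rw [partialProd_succ, ← K.mul_assoc _ _ _ h0 (composable_partialProd _ k), ih, arr_ofCone,
      mul_inv_cancel_left (a.2 _ _)]

theorem partialProd_ofCone_of_unit {n : ℕ} (a : K.coneSet n) {x : M} (h0 : a.1 0 = K.one x) :
    partialProd (ofCone a) = a.1 := by
  funext k
  have h := partialProd_ofCone a k
  have h1 : x = K.tgt (partialProd (ofCone a) k) := by
    rw [(src_tgt_partialProd _ k).2, obj_ofCone, h0, K.src_one]
  rwa [h0, h1, K.one_mul] at h

/-- The partial products of `(g₂, …, g_n)`, multiplied by `g₁` from the left, are those of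
`(g₁, …, g_n)`. -/
theorem partialProd_succ_eq {n : ℕ} (x : K.Nerve (n + 1)) (k : Fin (n + 1)) :
    partialProd x k.succ = K.mul (x.arr 0) (partialProd (Nerve.face 0 x) k) := by
  -- Without its initial unit, the cone of `x` is `(g₁, g₁g₂, …)`. It has the chain `∂₀ x` and first
  -- entry `g₁`.
  have h := partialProd_ofCone (coneOmit 0 (toCone x)) k
  rw [← face_ofCone, ofCone_toCone] at h
  have e : (coneOmit 0 (toCone x)).1 k = partialProd x k.succ := by simp [coneOmit, toCone]
  have e0 : (coneOmit 0 (toCone x)).1 0 = x.arr 0 := by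
    simp only [coneOmit, toCone, Fin.succAbove_zero]
    rw [partialProd_succ, Fin.castSucc_zero, partialProd_zero]
    have := K.one_mul (x.arr 0)
    rwa [x.tgt_arr] at this
  rw [e, e0] at h
  exact h.symm

/-- Omitting a later entry keeps the initial unit, so no left multiplication intervenes. The zeroth
face behaves differently, see `partialProd_succ_eq`. -/
theorem partialProd_face_succ {n : ℕ} (x : K.Nerve (n + 1)) (j : Fin (n + 1)) :
    partialProd (Nerve.face j.succ x) = fun k => partialProd x (j.succ.succAbove k) := by
  have h : Nerve.face j.succ x = ofCone (coneOmit j.succ (toCone x)) := by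
    rw [← face_ofCone, ofCone_toCone]
  rw [h]
  refine partialProd_ofCone_of_unit _ (x := x.obj 0) ?_
  simp [coneOmit, toCone, partialProd_zero]

theorem partialProd_map {f : G → G'} {f₀ : M → M'} (hf : IsLieGroupoidMorphism K L f f₀) {n : ℕ}
    (x : K.Nerve n) (k : Fin (n + 1)) : partialProd (Nerve.map hf x) k = f (partialProd x k) := by
  induction k using Fin.induction with
  | zero => rw [partialProd_zero, partialProd_zero, hf.one]; rfl
  | succ k ih =>
    rw [partialProd_succ, partialProd_succ, ih, hf.mul _ _ (composable_partialProd x k)]; rfl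

theorem smooth_mul_comp {X EX HX : Type*} [NormedAddCommGroup EX] [NormedSpace ℝ EX]
    [TopologicalSpace HX] [TopologicalSpace X] [ChartedSpace HX X] {IX : ModelWithCorners ℝ EX HX}
    {S : Set X} {f g : S → G} (hf : SmoothOnSubset IX J S f) (hg : SmoothOnSubset IX J S g)
    (hc : ∀ x, K.src (f x) = K.tgt (g x)) : SmoothOnSubset IX J S (fun x => K.mul (f x) (g x)) :=
  K.smooth_mul.comp (g := fun x => ⟨(f x, g x), hc x⟩) (hf.prodMk hg)

theorem smooth_partialProd {n : ℕ} (k : Fin (n + 1)) :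
    SmoothOnSubset (nerveModel I J n) J (K.nerveSet n) (fun x => partialProd x k) := by
  induction k using Fin.induction with
  | zero =>
    simp only [partialProd_zero]
    exact SmoothOnSubset.contMDiff_comp K.contMDiff_one (smooth_obj 0)
  | succ k ih =>
    simp only [partialProd_succ]
    exact smooth_mul_comp ih (smooth_arr k) fun x => composable_partialProd x k

theorem smooth_ofCone {n : ℕ} {X EX HX : Type*} [NormedAddCommGroup EX] [NormedSpace ℝ EX]
    [TopologicalSpace HX] [TopologicalSpace X] [ChartedSpace HX X] {IX : ModelWithCorners ℝ EX HX}
    {S : Set X} (a : S → K.coneSet n) (ha : ∀ k, SmoothOnSubset IX J S (fun x => (a x).1 k)) :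
    SmoothOnSubset IX (nerveModel I J n) S (fun x => ((ofCone (a x)).1)) :=
  SmoothOnSubset.prodMk
    (SmoothOnSubset.piMk fun k => SmoothOnSubset.contMDiff_comp K.contMDiff_src (ha k))
    (SmoothOnSubset.piMk fun _ => smooth_mul_comp
      (SmoothOnSubset.contMDiff_comp K.contMDiff_inv (ha _)) (ha _)
      fun x => (K.src_inv _).trans ((a x).2 _ _))

end LieGroupoid

end Groupoids

/-! ### Retargeting, and moving the first object of a chain to zero. -/

section VB

variable {EM HM M EG HG G : Type*}
  [NormedAddCommGroup EM] [NormedSpace ℝ EM] [TopologicalSpace HM]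
  [NormedAddCommGroup EG] [NormedSpace ℝ EG] [TopologicalSpace HG]
  [TopologicalSpace M] [ChartedSpace HM M] [TopologicalSpace G] [ChartedSpace HG G]
  {I : ModelWithCorners ℝ EM HM} {J : ModelWithCorners ℝ EG HG}

section FiberScale

variable {B : Type*} {F : Type*} {V : B → Type*} [∀ b, AddCommMonoid (V b)] [∀ b, Module ℝ (V b)]

theorem fiberScale_zero (v : TotalSpace F V) : fiberScale 0 v = ⟨v.proj, 0⟩ := by
  simp [fiberScale]

theorem fiberScale_fiberScale_zero (c : ℝ) (v : TotalSpace F V) :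
    fiberScale c (fiberScale 0 v) = fiberScale 0 v := by
  rw [fiberScale_zero, fiberScale, smul_zero]

theorem fiberScale_zero_fiberScale (c : ℝ) (v : TotalSpace F V) :
    fiberScale 0 (fiberScale c v) = fiberScale 0 v := by
  rw [fiberScale_zero, fiberScale_zero, fiberScale]

end FiberScale

namespace IsVBGroupoid

open LieGroupoid

variable {K : LieGroupoid I J M G}
  {FE : Type*} [NormedAddCommGroup FE] [NormedSpace ℝ FE]
  {E : M → Type*} [∀ x, AddCommGroup (E x)] [∀ x, Module ℝ (E x)]
  [∀ x, TopologicalSpace (E x)] [TopologicalSpace (TotalSpace FE E)]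
  [FiberBundle FE E] [VectorBundle ℝ FE E] [ContMDiffVectorBundle ∞ FE E I]
  {FV : Type*} [NormedAddCommGroup FV] [NormedSpace ℝ FV]
  {V : G → Type*} [∀ g, AddCommGroup (V g)] [∀ g, Module ℝ (V g)]
  [∀ g, TopologicalSpace (V g)] [TopologicalSpace (TotalSpace FV V)]
  [FiberBundle FV V] [VectorBundle ℝ FV V] [ContMDiffVectorBundle ∞ FV V J]
  {W : LieGroupoid (I.prod 𝓘(ℝ, FE)) (J.prod 𝓘(ℝ, FV)) (TotalSpace FE E) (TotalSpace FV V)}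
  (𝒱 : IsVBGroupoid K W)

/-- A smooth unital homogeneous operation that moves an arrow `v` of a VB-groupoid, within its
fiber, to an arrow with the target `e`. -/
structure IsRetargeting (_ : IsVBGroupoid K W)
    (Λ : TotalSpace FV V → TotalSpace FE E → TotalSpace FV V) : Prop where
  proj : ∀ v e, K.tgt v.proj = e.proj → (Λ v e).proj = v.proj
  tgt : ∀ v e, K.tgt v.proj = e.proj → W.tgt (Λ v e) = e
  self : ∀ v, Λ v (W.tgt v) = v
  one : ∀ e' e : TotalSpace FE E, e'.proj = e.proj → Λ (W.one e') e = W.one e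
  scale : ∀ c : ℝ, 0 ≤ c → ∀ v e, K.tgt v.proj = e.proj →
    Λ (fiberScale c v) (fiberScale c e) = fiberScale c (Λ v e)
  smooth : SmoothOnSubset ((J.prod 𝓘(ℝ, FV)).prod (I.prod 𝓘(ℝ, FE))) (J.prod 𝓘(ℝ, FV))
    {p : TotalSpace FV V × TotalSpace FE E | K.tgt p.1.proj = p.2.proj} (fun p => Λ p.1.1 p.1.2)

namespace IsRetargeting

variable {𝒱} {Λ : TotalSpace FV V → TotalSpace FE E → TotalSpace FV V}

variable (Λ) in
/-- The objects of the chain obtained from `η` by moving its first object to zero. -/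
def zeroedObj {n : ℕ} (η : W.Nerve n) : Fin (n + 1) → TotalSpace FE E :=
  Fin.induction (fiberScale 0 (η.obj 0)) (fun k e => W.src (Λ (η.arr k) e))

theorem zeroedObj_zero {n : ℕ} (η : W.Nerve n) : zeroedObj Λ η 0 = fiberScale 0 (η.obj 0) := rfl

theorem zeroedObj_succ {n : ℕ} (η : W.Nerve n) (k : Fin n) :
    zeroedObj Λ η k.succ = W.src (Λ (η.arr k) (zeroedObj Λ η k.castSucc)) := rfl

variable (hΛ : 𝒱.IsRetargeting Λ)
include hΛ

theorem tgt_proj_arr {n : ℕ} (η : W.Nerve n) (k : Fin n) :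
    K.tgt (η.arr k).proj = (η.obj k.castSucc).proj := by
  rw [𝒱.proj.tgt, η.tgt_arr]

theorem proj_zeroedObj {n : ℕ} (η : W.Nerve n) (k : Fin (n + 1)) :
    (zeroedObj Λ η k).proj = (η.obj k).proj := by
  induction k using Fin.induction with
  | zero => rfl
  | succ k ih =>
    rw [zeroedObj_succ, ← η.src_arr, ← 𝒱.proj.src, ← 𝒱.proj.src, hΛ.proj]
    rw [tgt_proj_arr hΛ, ih]

theorem compatible {n : ℕ} (η : W.Nerve n) (k : Fin n) :
    K.tgt (η.arr k).proj = (zeroedObj Λ η k.castSucc).proj := by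
  rw [tgt_proj_arr hΛ, proj_zeroedObj hΛ]

/-- The chain obtained from `η` by moving its first object to zero. -/
def zeroed {n : ℕ} (η : W.Nerve n) : W.Nerve n :=
  ⟨(zeroedObj Λ η, fun k => Λ (η.arr k) (zeroedObj Λ η k.castSucc)),
    fun k => ⟨hΛ.tgt _ _ (compatible hΛ η k), rfl⟩⟩

theorem obj_zeroed {n : ℕ} (η : W.Nerve n) (k) : (zeroed hΛ η).obj k = zeroedObj Λ η k := rfl

theorem arr_zeroed {n : ℕ} (η : W.Nerve n) (k : Fin n) :
    (zeroed hΛ η).arr k = Λ (η.arr k) (zeroedObj Λ η k.castSucc) := rfl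

theorem obj_zero_zeroed {n : ℕ} (η : W.Nerve n) :
    (zeroed hΛ η).obj 0 = ⟨(η.obj 0).proj, 0⟩ := fiberScale_zero _

/-- Retargeting to the given target does nothing, so no object moves if the first one is already
zero. Hence `correction` extends the prism sum from the chains that start at a zero. -/
theorem zeroed_eq_self {n : ℕ} (η : W.Nerve n) {x : M} (hx : η.obj 0 = ⟨x, 0⟩) :
    zeroed hΛ η = η := by
  have h : ∀ k, zeroedObj Λ η k = η.obj k := by
    intro k
    induction k using Fin.induction with
    | zero => rw [zeroedObj_zero, hx, fiberScale_zero]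
    | succ k ih => rw [zeroedObj_succ, ih, ← η.tgt_arr, hΛ.self, η.src_arr]
  refine Nerve.ext' h fun k => ?_
  rw [arr_zeroed, h, ← η.tgt_arr, hΛ.self]

/-- Homogeneity of `Λ`, propagated along the chain; it makes `correction` homogeneous. -/
theorem zeroed_map_scale {n : ℕ} (c : ℝ) (hc : 0 ≤ c) (η : W.Nerve n) :
    zeroed hΛ (Nerve.map (𝒱.scale c hc) η) = Nerve.map (𝒱.scale c hc) (zeroed hΛ η) := by
  have h : ∀ k, zeroedObj Λ (Nerve.map (𝒱.scale c hc) η) k = fiberScale c (zeroedObj Λ η k) := by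
    intro k
    induction k using Fin.induction with
    | zero =>
      rw [zeroedObj_zero, zeroedObj_zero, Nerve.obj_map, fiberScale_zero_fiberScale,
        fiberScale_fiberScale_zero]
    | succ k ih =>
      rw [zeroedObj_succ, ih, Nerve.arr_map, hΛ.scale c hc _ _ (compatible hΛ η k),
        (𝒱.scale c hc).src, zeroedObj_succ]
  refine Nerve.ext' h fun k => ?_
  rw [arr_zeroed, h, Nerve.arr_map, hΛ.scale c hc _ _ (compatible hΛ η k)]
  rfl

/-- Because `Λ` takes units to units, `correction` will be normalized. -/
theorem arr_zeroed_of_unit {n : ℕ} (η : W.Nerve n) (k : Fin n) {e : TotalSpace FE E}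
    (he : η.arr k = W.one e) : (zeroed hΛ η).arr k = W.one (zeroedObj Λ η k.castSucc) := by
  rw [arr_zeroed, he, hΛ.one]
  have h := compatible hΛ η k
  rw [𝒱.proj.tgt, he, W.tgt_one] at h
  exact h

theorem smooth_zeroedObj {n : ℕ} (k : Fin (n + 1)) :
    SmoothOnSubset (nerveModel (I.prod 𝓘(ℝ, FE)) (J.prod 𝓘(ℝ, FV)) n) (I.prod 𝓘(ℝ, FE))
      (W.nerveSet n) (fun η => zeroedObj Λ η k) := by
  induction k using Fin.induction with
  | zero =>
    simp only [zeroedObj_zero]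
    exact SmoothOnSubset.contMDiff_comp (𝒱.scale 0 le_rfl).contMDiff_base (smooth_obj 0)
  | succ k ih =>
    simp only [zeroedObj_succ]
    exact SmoothOnSubset.contMDiff_comp W.contMDiff_src
      (hΛ.smooth.comp (g := fun η : W.Nerve n =>
        ⟨(η.arr k, zeroedObj Λ η k.castSucc), compatible hΛ η k⟩)
        ((smooth_arr k).prodMk ih))

theorem smooth_zeroed {n : ℕ} :
    SmoothOnSubset (nerveModel (I.prod 𝓘(ℝ, FE)) (J.prod 𝓘(ℝ, FV)) n)
      (nerveModel (I.prod 𝓘(ℝ, FE)) (J.prod 𝓘(ℝ, FV)) n) (W.nerveSet n)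
      (fun η => ((zeroed hΛ η).1)) :=
  SmoothOnSubset.prodMk (SmoothOnSubset.piMk fun k => smooth_zeroedObj hΛ k)
    (SmoothOnSubset.piMk fun k =>
      hΛ.smooth.comp (g := fun η : W.Nerve n =>
        ⟨(η.arr k, zeroedObj Λ η k.castSucc), compatible hΛ η k⟩)
        ((smooth_arr k).prodMk (smooth_zeroedObj hΛ _)))

end IsRetargeting

/-! ### Cochains on tuples of arrows with target `0_x`, and their prism sums. -/

/-- The arrows of `V` whose target is the zero of `E_x`. -/
abbrev ZeroTarget (_ : IsVBGroupoid K W) (x : M) : Type _ :=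
  {v : TotalSpace FV V // W.tgt v = ⟨x, 0⟩}

/-- The zero arrow over the same arrow of `G`. -/
def zeroMap (x : M) (v : 𝒱.ZeroTarget x) : 𝒱.ZeroTarget x :=
  ⟨fiberScale 0 v.1, by rw [(𝒱.scale 0 le_rfl).tgt, v.2, fiberScale_zero]⟩

/-- The cone of a tuple of arrows with target `0_x`. -/
def zeroTargetCone {x : M} {n : ℕ} (a : Fin (n + 1) → 𝒱.ZeroTarget x) : W.coneSet n :=
  ⟨fun k => (a k).1, fun j k => (a j).2.trans (a k).2.symm⟩

/-- A cochain, as a function of tuples of arrows with target `0_x`. -/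
def coneFun {n : ℕ} (φ : W.Nerve n → ℝ) {x : M} (a : Fin (n + 1) → 𝒱.ZeroTarget x) : ℝ :=
  φ (ofCone (𝒱.zeroTargetCone a))

/-- The partial products of a chain that starts at `0_x`. -/
def baseCone {n : ℕ} {x : M} (y : W.Nerve n) (hy : y.obj 0 = ⟨x, 0⟩) (k : Fin (n + 1)) :
    𝒱.ZeroTarget x :=
  ⟨partialProd y k, (src_tgt_partialProd y k).2.trans hy⟩

theorem coneFun_baseCone {n : ℕ} (φ : W.Nerve n → ℝ) {x : M} (y : W.Nerve n)
    (hy : y.obj 0 = ⟨x, 0⟩) : 𝒱.coneFun φ (𝒱.baseCone y hy) = φ y :=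
  congrArg φ (ofCone_toCone y)

theorem coneFun_delta {n : ℕ} (φ : W.Nerve n → ℝ) {x : M} :
    𝒱.coneFun (W.delta n φ) (x := x) = omitSum (𝒱.coneFun φ) := by
  funext a
  rw [coneFun, delta_apply, omitSum]
  exact Finset.sum_congr rfl fun i _ => by rw [face_ofCone]; rfl

theorem prism_map {S S' : Type*} {z : S → S} {z' : S' → S'} {f : S → S'}
    (h : ∀ v, f (z v) = z' (f v)) {n : ℕ} (i : Fin n) (a : Fin n → S) (k : Fin (n + 1)) :
    f (prism z i a k) = prism z' i (fun k => f (a k)) k := by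
  unfold prism; split_ifs <;> simp [h]

/-- A repeated pair lies either in the part to which `z` is applied or, shifted by one, in the part
left alone. The prism thus takes degenerate chains to degenerate chains. -/
theorem exists_prism_eq {S : Type*} (z : S → S) {n : ℕ} (i : Fin (n + 1)) (a : Fin (n + 1) → S)
    {k : Fin n} (h : a k.castSucc = a k.succ) :
    ∃ j : Fin (n + 1), prism z i a j.castSucc = prism z i a j.succ := by
  rcases le_or_gt i k.castSucc with hik | hik
  · refine ⟨k.succ, ?_⟩
    have h1 : i.castSucc < k.succ.castSucc := by
      rw [Fin.lt_def]; rw [Fin.le_def] at hik; simp at hik ⊢; omega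
    have h2 : i.castSucc < k.succ.succ := h1.trans (Fin.castSucc_lt_succ)
    rw [prism, prism, if_neg h1.not_ge, if_neg h2.not_ge, Fin.predAbove_of_castSucc_lt _ _ h1,
      Fin.predAbove_of_castSucc_lt _ _ h2]
    simpa using h
  · refine ⟨k.castSucc, ?_⟩
    have h2 : k.castSucc.succ ≤ i.castSucc := by
      rw [Fin.le_def]; rw [Fin.lt_def] at hik; simp at hik ⊢; omega
    have h1 : k.castSucc.castSucc ≤ i.castSucc := (Fin.castSucc_lt_succ).le.trans h2
    rw [prism, prism, if_pos h1, if_pos h2, Fin.predAbove_of_le_castSucc _ _ h1,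
      Fin.predAbove_of_le_castSucc _ _ h2]
    rw [Fin.castPred_castSucc, h]
    rfl

theorem coe_prism {x : M} {n : ℕ} (i : Fin n) (a : Fin n → 𝒱.ZeroTarget x) (k : Fin (n + 1)) :
    (prism (𝒱.zeroMap x) i a k).1 = prism (fiberScale 0) i (fun k => (a k).1) k :=
  prism_map (f := Subtype.val) (z' := fiberScale 0) (fun _ => rfl) i a k

/-- The prism sum of a cochain is invariant under left multiplication by zero arrows. -/
theorem prismSum_coneFun_mul_left {n : ℕ} (φ : W.Nerve n → ℝ) {x x' : M}
    (a : Fin n → 𝒱.ZeroTarget x) (b : Fin n → 𝒱.ZeroTarget x') (g : G)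
    (hg : W.src (𝒱.zeroArr g) = ⟨x', 0⟩)
    (h : ∀ k, (a k).1 = W.mul (𝒱.zeroArr g) (b k).1) :
    prismSum (𝒱.zeroMap x) (𝒱.coneFun φ) a = prismSum (𝒱.zeroMap x') (𝒱.coneFun φ) b := by
  refine Finset.sum_congr rfl fun i _ => ?_
  congr 1
  refine congrArg φ (ofCone_mul_left (𝒱.zeroArr g) _ _ (fun k => ?_) fun k => ?_)
  · exact hg.trans (prism (𝒱.zeroMap x') i b k).2.symm
  · change (prism (𝒱.zeroMap x) i a k).1 = W.mul _ (prism (𝒱.zeroMap x') i b k).1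
    -- Since `z` is multiplicative and fixes `0_g`, it commutes with left multiplication by `0_g`.
    -- Every entry of the prism is therefore multiplied by the same arrow.
    have hz : fiberScale 0 (𝒱.zeroArr g) = 𝒱.zeroArr g := by simp [fiberScale]
    have hm : ∀ k, fiberScale 0 (W.mul (𝒱.zeroArr g) (b k).1) =
        W.mul (𝒱.zeroArr g) (fiberScale 0 (b k).1) := fun k => by
      rw [(𝒱.scale 0 le_rfl).mul _ _ (hg.trans (b k).2.symm), hz]
    rw [coe_prism, coe_prism, prism, prism]
    split_ifs
    · rw [h, hm]
    · rw [h]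

/-- Absorbs the dependence of `ZeroTarget x` on the base point, which is often known only up to a
propositional equality. -/
theorem prismSum_coneFun_congr {n : ℕ} (φ : W.Nerve n → ℝ) {x x' : M} (hx : x = x')
    (a : Fin n → 𝒱.ZeroTarget x) (b : Fin n → 𝒱.ZeroTarget x') (h : ∀ k, (a k).1 = (b k).1) :
    prismSum (𝒱.zeroMap x) (𝒱.coneFun φ) a = prismSum (𝒱.zeroMap x') (𝒱.coneFun φ) b := by
  subst hx
  rw [show a = b from funext fun k => Subtype.ext (h k)]

/-! ### The correcting cochain. -/

section Correction

variable {Λ : TotalSpace FV V → TotalSpace FE E → TotalSpace FV V}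
  (hΛ : 𝒱.IsRetargeting Λ) {q : ℕ} (ψ : W.Nerve (q + 1) → ℝ)

/-- The cochain whose coboundary makes `ψ` left-projectable. -/
def correction (η : W.Nerve q) : ℝ :=
  prismSum (𝒱.zeroMap (η.obj 0).proj) (𝒱.coneFun ψ)
    (𝒱.baseCone (hΛ.zeroed η) (hΛ.obj_zero_zeroed η))

theorem correction_of_zero (η : W.Nerve q) {x : M} (hx : η.obj 0 = ⟨x, 0⟩) :
    𝒱.correction hΛ ψ η =
      prismSum (𝒱.zeroMap x) (𝒱.coneFun ψ) (𝒱.baseCone η hx) := by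
  refine 𝒱.prismSum_coneFun_congr ψ (by rw [hx]) _ _ fun k => ?_
  change partialProd (hΛ.zeroed η) k = partialProd η k
  rw [hΛ.zeroed_eq_self η hx]

/-- The homotopy formula on the partial products of `y`, after the terms with `δψ` and with `z^*ψ`
have vanished. The right side is what remains because the zeroth face of `y` need not start at a
zero: there the simplicial differential sees the bare tail of the cone, and `δ` sees the retargeted
chain. -/
theorem sub_delta_correction (hψ : ψ ∈ (𝒱.homCochains 1).carrier (q + 1))
    (hδ : 𝒱.IsLeftProjectable (q + 2) (W.delta (q + 1) ψ)) (y : W.Nerve (q + 1)) {x : M}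
    (hy : y.obj 0 = ⟨x, 0⟩) :
    ψ y - W.delta q (𝒱.correction hΛ ψ) y =
      prismSum (𝒱.zeroMap x) (𝒱.coneFun ψ) (fun k => 𝒱.baseCone y hy k.succ) -
        𝒱.correction hΛ ψ (Nerve.face 0 y) := by
  have key := prismSum_omitSum (𝒱.zeroMap x) (𝒱.coneFun ψ) (𝒱.baseCone y hy)
  -- The first two entries of every prism are zero arrows, hence so is the first arrow `P₀⁻¹ P₁` of
  -- its chain, and the first condition on `δψ` applies.
  have h1 : prismSum (𝒱.zeroMap x) (omitSum (𝒱.coneFun ψ)) (𝒱.baseCone y hy) = 0 := by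
    refine Finset.sum_eq_zero fun i _ => ?_
    rw [← coneFun_delta]
    refine mul_eq_zero_of_right _ ?_
    set P := prism (𝒱.zeroMap x) i (𝒱.baseCone y hy) with hP
    have hz : ∀ v : TotalSpace FV V, fiberScale 0 v = v → v = 𝒱.zeroArr v.proj := fun v hv => by
      conv_lhs => rw [← hv]
      exact fiberScale_zero v
    have h0 : fiberScale 0 (P 0).1 = (P 0).1 := by
      rw [hP, coe_prism, prism, if_pos (Fin.zero_le _), fiberScale_fiberScale_zero]
    have hc : W.src (W.inv (P 0).1) = W.tgt (P 1).1 := by rw [W.src_inv, (P 0).2, (P 1).2]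
    have h1 : fiberScale 0 (P 1).1 = (P 1).1 := by
      rw [hP, coe_prism, prism]
      split_ifs with hi
      · rw [fiberScale_fiberScale_zero]
      -- Only for `i = 0` is the second entry untouched by `z`. It is then the initial partial
      -- product, the unit at `0_x`, which is a zero arrow anyway.
      · have e : i.predAbove 1 = 0 := by
          have : i = 0 := by simpa [Fin.lt_one_iff] using hi
          rw [this]; rfl
        rw [e]
        change fiberScale 0 (partialProd y 0) = partialProd y 0
        rw [partialProd_zero, (𝒱.scale 0 le_rfl).one, hy, fiberScale_zero]
    refine hδ.1 _ (W.mul (W.inv (P 0).1) (P 1).1).proj ?_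
    rw [arr_ofCone]
    refine hz (W.mul (W.inv (P 0).1) (P 1).1) ?_
    rw [(𝒱.scale 0 le_rfl).mul _ _ hc, (𝒱.scale 0 le_rfl).inv, h0, h1]
  -- The chain of the zeroed tuple is `0` times a chain, so homogeneity of degree one gives the
  -- value zero.
  have h2 : 𝒱.coneFun ψ (fun k => 𝒱.zeroMap x (𝒱.baseCone y hy k)) = 0 := by
    have e : ofCone (𝒱.zeroTargetCone fun k => 𝒱.zeroMap x (𝒱.baseCone y hy k)) =
        Nerve.map (𝒱.scale 0 le_rfl) (ofCone (𝒱.zeroTargetCone (𝒱.baseCone y hy))) :=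
      (map_ofCone _ _ _ fun _ => rfl).symm
    rw [coneFun, e, hψ.2 0 le_rfl]
    simp
  -- The faces with index at least one keep the first object `0_x`. On them `correction` involves no
  -- retargeting and agrees term by term with the simplicial differential of the prism sum.
  have h3 : W.delta q (𝒱.correction hΛ ψ) y - 𝒱.correction hΛ ψ (Nerve.face 0 y) =
      omitSum (prismSum (𝒱.zeroMap x) (𝒱.coneFun ψ)) (𝒱.baseCone y hy) -
        prismSum (𝒱.zeroMap x) (𝒱.coneFun ψ) (fun k => 𝒱.baseCone y hy k.succ) := by
    rw [delta_apply, omitSum, Fin.sum_univ_succ, Fin.sum_univ_succ (n := q + 1)]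
    simp only [Fin.val_zero, pow_zero, one_mul, add_sub_cancel_left, Fin.succAbove_zero]
    refine Finset.sum_congr rfl fun j _ => ?_
    congr 1
    rw [𝒱.correction_of_zero hΛ ψ (Nerve.face j.succ y) (x := x)
      (by rw [Nerve.obj_face, Fin.succ_succAbove_zero, hy])]
    refine 𝒱.prismSum_coneFun_congr ψ rfl _ _ fun k => ?_
    exact congrFun (partialProd_face_succ y j) k
  rw [coneFun_baseCone, h1, h2] at key
  linarith

/-- Both conditions involve only chains that start at a zero, where `sub_delta_correction` applies.
They reduce to the invariance of the prism sum under left multiplication by `0_g`. -/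
theorem isLeftProjectable_sub_delta_correction (hψ : ψ ∈ (𝒱.homCochains 1).carrier (q + 1))
    (hδ : 𝒱.IsLeftProjectable (q + 2) (W.delta (q + 1) ψ)) :
    𝒱.IsLeftProjectable (q + 1) (ψ - W.delta q (𝒱.correction hΛ ψ)) := by
  refine ⟨fun y g hg => ?_, fun y y' g hc h0 hs => ?_⟩
  · have hy : y.obj 0 = ⟨K.tgt g, 0⟩ := by
      rw [← 𝒱.tgt_zeroArr, ← hg, y.tgt_arr]; rfl
    have hy1 : (Nerve.face 0 y).obj 0 = ⟨K.src g, 0⟩ := by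
      rw [← 𝒱.src_zeroArr, ← hg, y.src_arr]; rfl
    rw [Pi.sub_apply, 𝒱.sub_delta_correction hΛ ψ hψ hδ y hy,
      𝒱.correction_of_zero hΛ ψ _ hy1, sub_eq_zero]
    -- With first arrow `0_g`, the tail of the partial products of `y` is `0_g` times the partial
    -- products of `∂₀ y`.
    refine 𝒱.prismSum_coneFun_mul_left ψ _ _ g (𝒱.src_zeroArr g) fun k => ?_
    change partialProd y k.succ = _
    rw [partialProd_succ_eq, hg]; rfl
  · have hy : y.obj 0 = ⟨K.src g, 0⟩ := by
      rw [← 𝒱.src_zeroArr, hc, y.tgt_arr]; rfl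
    have hy' : y'.obj 0 = ⟨K.tgt g, 0⟩ := by
      rw [← 𝒱.tgt_zeroArr, ← W.tgt_mul _ _ hc, ← h0, y'.tgt_arr]; rfl
    have e : Nerve.face 0 y' = Nerve.face 0 y := by
      refine Nerve.ext' (fun j => ?_) fun j => hs j
      simpa using 𝒱.obj_succ_eq hc h0 hs j
    rw [Pi.sub_apply, Pi.sub_apply, 𝒱.sub_delta_correction hΛ ψ hψ hδ y hy,
      𝒱.sub_delta_correction hΛ ψ hψ hδ y' hy', e]
    congr 1
    -- The zeroth faces coincide, and the tails of the partial products differ by left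
    -- multiplication by `0_g`.
    refine 𝒱.prismSum_coneFun_mul_left ψ _ _ g (𝒱.src_zeroArr g) fun k => ?_
    change partialProd y' k.succ = W.mul _ (partialProd y k.succ)
    rw [partialProd_succ_eq, partialProd_succ_eq, e, h0, W.mul_assoc _ _ _ hc]
    rw [(src_tgt_partialProd _ _).2, y.src_arr]; rfl

/-- Moving the first object to zero, forming partial products and taking prisms are smooth, commute
with scaling and preserve degeneracy, so each property of `ψ` passes to its correction. -/
theorem correction_mem (hψ : ψ ∈ (𝒱.homCochains 1).carrier (q + 1)) :
    𝒱.correction hΛ ψ ∈ (𝒱.homCochains 1).carrier q := by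
  refine ⟨⟨?_, fun η k e hk => ?_⟩, fun c hc η => ?_⟩
  · refine SmoothOnSubset.sum Finset.univ fun i : Fin (q + 1) =>
      (SmoothOnSubset.const _ ((-1) ^ (i : ℕ))).mul ?_
    refine hψ.1.1.comp (g := fun η => ofCone (𝒱.zeroTargetCone (prism _ i _)))
      (smooth_ofCone _ fun k => ?_)
    simp only [zeroTargetCone, coe_prism]
    have hs : ∀ k, SmoothOnSubset (nerveModel (I.prod 𝓘(ℝ, FE)) (J.prod 𝓘(ℝ, FV)) q)
        (J.prod 𝓘(ℝ, FV)) (W.nerveSet q) (fun η => partialProd (hΛ.zeroed η) k) :=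
      fun k => (smooth_partialProd k).comp hΛ.smooth_zeroed
    unfold prism
    split_ifs
    · exact SmoothOnSubset.contMDiff_comp (𝒱.scale 0 le_rfl).contMDiff (hs _)
    · exact hs _
  · rw [correction, prismSum]
    refine Finset.sum_eq_zero fun i _ => mul_eq_zero_of_right _ ?_
    set a := 𝒱.baseCone (hΛ.zeroed η) (hΛ.obj_zero_zeroed η) with ha
    -- A unit in the chain repeats a partial product. The repetition survives in each prism and
    -- yields a unit arrow, on which `ψ` vanishes.
    have hak : a k.castSucc = a k.succ := by
      refine Subtype.ext ?_
      change partialProd (hΛ.zeroed η) k.castSucc = partialProd (hΛ.zeroed η) k.succ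
      rw [partialProd_succ, hΛ.arr_zeroed_of_unit η k hk, ← hΛ.obj_zeroed,
        ← (src_tgt_partialProd (hΛ.zeroed η) k.castSucc).1, W.mul_one]
    obtain ⟨j, hj⟩ := exists_prism_eq (𝒱.zeroMap (η.obj 0).proj) i a hak
    refine hψ.1.2 _ j (W.src (prism (𝒱.zeroMap (η.obj 0).proj) i a j.succ).1) ?_
    rw [arr_ofCone]
    change W.mul (W.inv (prism (𝒱.zeroMap (η.obj 0).proj) i a j.castSucc).1)
      (prism (𝒱.zeroMap (η.obj 0).proj) i a j.succ).1 = _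
    rw [hj, W.inv_mul]
  · simp only [correction, prismSum, Finset.mul_sum]
    refine Finset.sum_congr rfl fun i _ => ?_
    have e : ofCone (𝒱.zeroTargetCone (prism (𝒱.zeroMap _) i
        (𝒱.baseCone (hΛ.zeroed (Nerve.map (𝒱.scale c hc) η)) (hΛ.obj_zero_zeroed _)))) =
        Nerve.map (𝒱.scale c hc) (ofCone (𝒱.zeroTargetCone (prism (𝒱.zeroMap _) i
          (𝒱.baseCone (hΛ.zeroed η) (hΛ.obj_zero_zeroed _))))) := by
      refine (map_ofCone _ _ _ fun k => ?_).symm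
      simp only [zeroTargetCone, coe_prism]
      rw [prism_map (f := fiberScale c) (z' := fiberScale 0)]
      · congr 1
        funext k
        change partialProd (hΛ.zeroed (Nerve.map (𝒱.scale c hc) η)) k =
          fiberScale c (partialProd (hΛ.zeroed η) k)
        rw [hΛ.zeroed_map_scale c hc, partialProd_map]
      · intro v
        rw [fiberScale_fiberScale_zero, fiberScale_zero_fiberScale]
    rw [coneFun, e, hψ.2 c hc, coneFun]
    ring

end Correction

end IsVBGroupoid

end VB

/-! ### Homogeneous smooth maps of vector bundles. -/

section BundleMaps

open Filter Topology

/-- Differentiate `g (t v) = t g v` at `t = 0`. Homogeneity is known only for `t ≥ 0`, but a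
one-sided derivative suffices. -/
theorem eq_fderiv_of_homogeneous {F₁ F₂ : Type*} [NormedAddCommGroup F₁] [NormedSpace ℝ F₁]
    [NormedAddCommGroup F₂] [NormedSpace ℝ F₂] {g : F₁ → F₂} (hg : DifferentiableAt ℝ g 0)
    (h : ∀ c : ℝ, 0 ≤ c → ∀ v, g (c • v) = c • g v) (v : F₁) : g v = fderiv ℝ g 0 v := by
  have h1 : HasDerivAt (fun t : ℝ => g (t • v)) (fderiv ℝ g 0 v) 0 := by
    have hl : HasDerivAt (fun t : ℝ => t • v) v 0 := by
      simpa using (hasDerivAt_id (0 : ℝ)).smul_const v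
    have hg' : HasFDerivAt g (fderiv ℝ g 0) ((0 : ℝ) • v) := by
      rw [zero_smul]; exact hg.hasFDerivAt
    exact hg'.comp_hasDerivAt (0 : ℝ) hl
  have h2 : HasDerivWithinAt (fun t : ℝ => g (t • v)) (g v) (Ici 0) 0 := by
    have hl : HasDerivWithinAt (fun t : ℝ => t • g v) (g v) (Ici 0) 0 := by
      simpa using ((hasDerivAt_id (0 : ℝ)).smul_const (g v)).hasDerivWithinAt
    exact hl.congr (fun t ht => h t ht v) (h 0 le_rfl v)
  exact (uniqueDiffWithinAt_Ici (0 : ℝ)).eq_deriv _ h2 h1.hasDerivWithinAt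

variable {EB₁ H₁ B₁ EB₂ H₂ B₂ F₁ F₂ : Type*} {E₁ : B₁ → Type*} {E₂ : B₂ → Type*}
  [NormedAddCommGroup EB₁] [NormedSpace ℝ EB₁] [TopologicalSpace H₁] [TopologicalSpace B₁]
  [ChartedSpace H₁ B₁] {I₁ : ModelWithCorners ℝ EB₁ H₁}
  [NormedAddCommGroup EB₂] [NormedSpace ℝ EB₂] [TopologicalSpace H₂] [TopologicalSpace B₂]
  [ChartedSpace H₂ B₂] {I₂ : ModelWithCorners ℝ EB₂ H₂}
  [NormedAddCommGroup F₁] [NormedSpace ℝ F₁] [∀ x, AddCommGroup (E₁ x)] [∀ x, Module ℝ (E₁ x)]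
  [∀ x, TopologicalSpace (E₁ x)] [TopologicalSpace (TotalSpace F₁ E₁)]
  [FiberBundle F₁ E₁] [VectorBundle ℝ F₁ E₁] [ContMDiffVectorBundle ∞ F₁ E₁ I₁]
  [NormedAddCommGroup F₂] [NormedSpace ℝ F₂] [∀ x, AddCommGroup (E₂ x)] [∀ x, Module ℝ (E₂ x)]
  [∀ x, TopologicalSpace (E₂ x)] [TopologicalSpace (TotalSpace F₂ E₂)]
  [FiberBundle F₂ E₂] [VectorBundle ℝ F₂ E₂] [ContMDiffVectorBundle ∞ F₂ E₂ I₂]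
  {f : TotalSpace F₁ E₁ → TotalSpace F₂ E₂} {f₀ : B₁ → B₂}

/-- A smooth map of vector bundles that commutes with the multiplications by nonnegative numbers
is fiberwise linear. -/
theorem exists_clm_of_homogeneous (hf : ContMDiff (I₁.prod 𝓘(ℝ, F₁)) (I₂.prod 𝓘(ℝ, F₂)) ∞ f)
    (hp : ∀ v, (f v).proj = f₀ v.proj)
    (hs : ∀ c : ℝ, 0 ≤ c → ∀ v, f (fiberScale c v) = fiberScale c (f v)) :
    ∃ A : ∀ x, E₁ x →L[ℝ] E₂ (f₀ x), ∀ x v, f ⟨x, v⟩ = ⟨f₀ x, A x v⟩ := by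
  have h0 : ∀ x (v : E₁ x), ∃ w : E₂ (f₀ x), f ⟨x, v⟩ = ⟨f₀ x, w⟩ := by
    intro x v
    have h := hp ⟨x, v⟩
    rcases hfx : f ⟨x, v⟩ with ⟨y, w⟩
    rw [hfx] at h
    change y = f₀ x at h
    subst h
    exact ⟨w, rfl⟩
  choose A hA using h0
  have hA1 : ∀ x (c : ℝ), 0 ≤ c → ∀ v, A x (c • v) = c • A x v := by
    intro x c hc v
    have h := hs c hc ⟨x, v⟩
    rw [hA, fiberScale, fiberScale, hA] at h
    exact TotalSpace.mk_inj.1 h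
  have h1 : ∀ x, ∃ L : E₁ x →L[ℝ] E₂ (f₀ x), ∀ v, A x v = L v := by
    intro x
    have hx : x ∈ (trivializationAt F₁ E₁ x).baseSet := mem_baseSet_trivializationAt _ _ _
    have hy : f₀ x ∈ (trivializationAt F₂ E₂ (f₀ x)).baseSet := mem_baseSet_trivializationAt _ _ _
    set e₁ := (trivializationAt F₁ E₁ x).continuousLinearEquivAt ℝ x hx
    set e₂ := (trivializationAt F₂ E₂ (f₀ x)).continuousLinearEquivAt ℝ (f₀ x) hy
    -- The map of one fiber, read in trivializations, is smooth and homogeneous, hence equal to its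
    -- derivative at zero.
    let g : F₁ → F₂ := fun v => e₂ (A x (e₁.symm v))
    have hg : ∀ c : ℝ, 0 ≤ c → ∀ v, g (c • v) = c • g v := by
      intro c hc v
      simp only [g, map_smul, hA1 x c hc]
    have hd : ContMDiff 𝓘(ℝ, F₁) 𝓘(ℝ, F₂) ∞ g := by
      have hi : ContMDiff 𝓘(ℝ, F₁) (I₁.prod 𝓘(ℝ, F₁)) ∞
          (fun v => (⟨x, e₁.symm v⟩ : TotalSpace F₁ E₁)) := by
        refine ((trivializationAt F₁ E₁ x).contMDiff_iff fun v => ?_).2 ⟨contMDiff_const, ?_⟩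
        · rwa [Trivialization.mem_source]
        · refine contMDiff_id.congr fun v => ?_
          exact e₁.apply_symm_apply v
      have := ((trivializationAt F₂ E₂ (f₀ x)).contMDiff_iff (f := fun v => f ⟨x, e₁.symm v⟩)
        fun v => by rw [Trivialization.mem_source, hA]; exact hy).1 (hf.comp hi)
      refine this.2.congr fun v => ?_
      rw [hA]; rfl
    have hg' := eq_fderiv_of_homogeneous (hd.contDiff.differentiable (by simp) 0) hg
    refine ⟨(e₂.symm : F₂ →L[ℝ] E₂ (f₀ x)) ∘L (fderiv ℝ g 0) ∘L (e₁ : E₁ x →L[ℝ] F₁), fun v => ?_⟩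
    simp only [ContinuousLinearMap.comp_apply, ContinuousLinearEquiv.coe_coe, ← hg', g,
      ContinuousLinearEquiv.symm_apply_apply]
  choose L hL using h1
  exact ⟨L, fun x v => by rw [hA, hL]⟩

/-- In finite dimension, `L x` is a fixed linear expression in its values on a basis. -/
theorem contMDiffOn_clm_of_apply {X EX HX : Type*} [NormedAddCommGroup EX] [NormedSpace ℝ EX]
    [TopologicalSpace HX] [TopologicalSpace X] [ChartedSpace HX X] {IX : ModelWithCorners ℝ EX HX}
    [FiniteDimensional ℝ F₁] {s : Set X} {L : X → F₁ →L[ℝ] F₂}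
    (h : ∀ v, ContMDiffOn IX 𝓘(ℝ, F₂) ∞ (fun x => L x v) s) :
    ContMDiffOn IX 𝓘(ℝ, F₁ →L[ℝ] F₂) ∞ L s := by
  let b := Module.finBasis ℝ F₁
  have e : ∀ x, L x = ∑ i, ContinuousLinearMap.smulRightL ℝ F₁ F₂
      (LinearMap.toContinuousLinearMap (b.coord i)) (L x (b i)) := by
    intro x
    ext v
    have : L x v = ∑ i, b.repr v i • L x (b i) := by
      conv_lhs => rw [← b.sum_repr v, map_sum]
      simp only [map_smul]
    simpa using this
  have : ContMDiffOn IX 𝓘(ℝ, F₁ →L[ℝ] F₂) ∞ (fun x => ∑ i, ContinuousLinearMap.smulRightL ℝ F₁ F₂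
      (LinearMap.toContinuousLinearMap (b.coord i)) (L x (b i))) s :=
    contMDiffOn_finsetSum fun i _ => (ContinuousLinearMap.contMDiff _).comp_contMDiffOn (h (b i))
  exact this.congr fun x _ => e x

variable {A : ∀ x, E₁ x →L[ℝ] E₂ (f₀ x)}

/-- A smooth map of vector bundles is smooth when read in trivializations. -/
theorem contMDiffOn_inTrivializations [FiniteDimensional ℝ F₁]
    (hf : ContMDiff (I₁.prod 𝓘(ℝ, F₁)) (I₂.prod 𝓘(ℝ, F₂)) ∞ f)
    (hA : ∀ x v, f ⟨x, v⟩ = ⟨f₀ x, A x v⟩)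
    (e₁ : Trivialization F₁ (TotalSpace.proj : TotalSpace F₁ E₁ → B₁)) [MemTrivializationAtlas e₁]
    (e₂ : Trivialization F₂ (TotalSpace.proj : TotalSpace F₂ E₂ → B₂)) [MemTrivializationAtlas e₂] :
    ContMDiffOn I₁ 𝓘(ℝ, F₁ →L[ℝ] F₂) ∞
      (fun x => e₂.continuousLinearMapAt ℝ (f₀ x) ∘L A x ∘L e₁.symmL ℝ x)
      (e₁.baseSet ∩ f₀ ⁻¹' e₂.baseSet) := by
  refine contMDiffOn_clm_of_apply fun v => ?_
  have h1 : ContMDiffOn I₁ (I₁.prod 𝓘(ℝ, F₁)) ∞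
      (fun x => (⟨x, e₁.symmL ℝ x v⟩ : TotalSpace F₁ E₁)) e₁.baseSet := by
    refine e₁.contMDiffOn_section_baseSet_iff.2 (contMDiffOn_const (c := v) |>.congr fun x hx => ?_)
    rw [← e₁.continuousLinearMapAt_apply_of_mem (R := ℝ) hx, e₁.continuousLinearMapAt_symmL hx]
  have h2 := hf.comp_contMDiffOn (h1.mono (inter_subset_left (t := f₀ ⁻¹' e₂.baseSet)))
  have h3 := ((e₂.contMDiffOn_iff fun x hx => by
    rw [Trivialization.mem_source, Function.comp, hA]; exact hx.2).1 h2).2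
  refine h3.congr fun x hx => ?_
  simp only [Function.comp, hA, ContinuousLinearMap.comp_apply]
  rw [e₂.continuousLinearMapAt_apply_of_mem (R := ℝ) hx.2]

/-- A submersive map of vector bundles is fiberwise surjective. -/
theorem surjective_of_submersion
    (hf : ContMDiff (I₁.prod 𝓘(ℝ, F₁)) (I₂.prod 𝓘(ℝ, F₂)) ∞ f)
    (hA : ∀ x v, f ⟨x, v⟩ = ⟨f₀ x, A x v⟩) (x : B₁)
    (hs : Function.Surjective
      (mfderiv (I₁.prod 𝓘(ℝ, F₁)) (I₂.prod 𝓘(ℝ, F₂)) f (⟨x, 0⟩ : TotalSpace F₁ E₁))) :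
    Function.Surjective (A x) := by
  have hx : x ∈ (trivializationAt F₁ E₁ x).baseSet := mem_baseSet_trivializationAt _ _ _
  have hy : f₀ x ∈ (trivializationAt F₂ E₂ (f₀ x)).baseSet := mem_baseSet_trivializationAt _ _ _
  set e₁ := trivializationAt F₁ E₁ x
  set e₂ := trivializationAt F₂ E₂ (f₀ x)
  have d₁ : e₁.toOpenPartialHomeomorph.MDifferentiable (I₁.prod 𝓘(ℝ, F₁)) (I₁.prod 𝓘(ℝ, F₁)) :=
    ⟨(e₁.contMDiffOn (n := ∞)).mdifferentiableOn (by simp),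
      (e₁.contMDiffOn_symm (n := ∞)).mdifferentiableOn (by simp)⟩
  have d₂ : e₂.toOpenPartialHomeomorph.MDifferentiable (I₂.prod 𝓘(ℝ, F₂)) (I₂.prod 𝓘(ℝ, F₂)) :=
    ⟨(e₂.contMDiffOn (n := ∞)).mdifferentiableOn (by simp),
      (e₂.contMDiffOn_symm (n := ∞)).mdifferentiableOn (by simp)⟩
  have hsymm : ∀ z ∈ e₁.baseSet, ∀ v,
      e₁.toOpenPartialHomeomorph.symm (z, v) = ⟨z, e₁.symmL ℝ z v⟩ := fun z hz v => by
    rw [e₁.symmL_apply hz, e₁.mk_symm hz]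
  have hp : ((x, 0) : B₁ × F₁) ∈ e₁.target := by rw [e₁.mem_target]; exact hx
  have hj : e₁.toOpenPartialHomeomorph.symm (x, 0) = ⟨x, 0⟩ := by
    rw [hsymm x hx, map_zero]
  have hf0 : f ⟨x, 0⟩ ∈ e₂.source := by rw [e₂.mem_source, hA]; exact hy
  -- The fiber component of `f` in trivializations. It is submersive at `(x, 0)`, and its derivative
  -- along the base vanishes there because `f` maps zeros to zeros. Hence its derivative along the
  -- fiber, which is `A x` in trivializations, is surjective.
  set Ψ : B₁ × F₁ → F₂ := fun p => (e₂ (f (e₁.toOpenPartialHomeomorph.symm p))).2 with hΨ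
  have m1 : MDifferentiableAt (I₁.prod 𝓘(ℝ, F₁)) (I₁.prod 𝓘(ℝ, F₁))
    e₁.toOpenPartialHomeomorph.symm (x, (0 : F₁)) := d₁.symm.mdifferentiableAt hp
  have m2 : MDifferentiableAt (I₁.prod 𝓘(ℝ, F₁)) (I₂.prod 𝓘(ℝ, F₂)) f
    (e₁.toOpenPartialHomeomorph.symm (x, (0 : F₁))) := (hf.mdifferentiable (by simp)) _
  have m3 : MDifferentiableAt (I₂.prod 𝓘(ℝ, F₂)) (I₂.prod 𝓘(ℝ, F₂)) e₂
    (f (e₁.toOpenPartialHomeomorph.symm (x, (0 : F₁)))) := by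
    rw [hj]; exact d₂.mdifferentiableAt hf0
  have m4 : MDifferentiableAt (I₂.prod 𝓘(ℝ, F₂)) 𝓘(ℝ, F₂) Prod.snd
    (e₂ (f (e₁.toOpenPartialHomeomorph.symm (x, (0 : F₁))))) := mdifferentiableAt_snd
  have m21 := m2.comp (x, (0 : F₁)) m1
  have m321 := m3.comp (x, (0 : F₁)) m21
  have hΨd : MDifferentiableAt (I₁.prod 𝓘(ℝ, F₁)) 𝓘(ℝ, F₂) Ψ (x, 0) := m4.comp (x, (0 : F₁)) m321
  have hΨs : Function.Surjective (mfderiv (I₁.prod 𝓘(ℝ, F₁)) 𝓘(ℝ, F₂) Ψ (x, 0)) := by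
    have c := mfderiv_comp (x, (0 : F₁)) m4 m321
    rw [mfderiv_comp (x, (0 : F₁)) m3 m21, mfderiv_comp (x, (0 : F₁)) m2 m1] at c
    have c' : mfderiv (I₁.prod 𝓘(ℝ, F₁)) 𝓘(ℝ, F₂) Ψ (x, 0) = _ := c
    rw [c']
    refine Function.Surjective.comp (g := mfderiv _ _ _ _) ?_
      (Function.Surjective.comp (g := mfderiv _ _ _ _) ?_
      (Function.Surjective.comp (g := mfderiv _ _ _ _) ?_ ?_))
    · rw [mfderiv_snd]
      exact Prod.snd_surjective
    · change Function.Surjective (mfderiv _ _ _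
        (f (e₁.toOpenPartialHomeomorph.symm (x, (0 : F₁)))))
      rw [hj]; exact d₂.mfderiv_surjective hf0
    · rw [hj]; exact hs
    · exact d₁.symm.mfderiv_surjective hp
  have hval : ∀ z ∈ e₁.baseSet ∩ f₀ ⁻¹' e₂.baseSet, ∀ v, Ψ (z, v) =
      (e₂.continuousLinearMapAt ℝ (f₀ z) ∘L A z ∘L e₁.symmL ℝ z) v := fun z hz v => by
    change (e₂ (f (e₁.toOpenPartialHomeomorph.symm (z, v)))).2 = _
    rw [hsymm z hz.1, hA, ← e₂.continuousLinearMapAt_apply_of_mem (R := ℝ) hz.2]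
    rfl
  -- Continuity of the base map is recovered from that of `f` along the zero section.
  have hcont : Continuous f₀ := by
    have : f₀ = fun z => (f (zeroSection F₁ E₁ z)).proj := by
      funext z; rw [zeroSection, hA]
    rw [this]
    exact (FiberBundle.continuous_proj F₂ E₂).comp
      (hf.continuous.comp (contMDiff_zeroSection (n := ∞) ℝ E₁ (IB := I₁)).continuous)
  intro w
  obtain ⟨u, hu⟩ := hΨs ((e₂.continuousLinearMapAt ℝ (f₀ x)) w)
  rw [mfderiv_prod_eq_add_apply hΨd] at hu
  have z1 : mfderiv I₁ 𝓘(ℝ, F₂) (fun z : B₁ => Ψ (z, (0 : F₁))) x = 0 := by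
    have : (fun z : B₁ => Ψ (z, (0 : F₁))) =ᶠ[𝓝 x] fun _ => 0 := by
      filter_upwards [(e₁.open_baseSet.inter (e₂.open_baseSet.preimage hcont)).mem_nhds ⟨hx, hy⟩]
        with z hz
      rw [hval z hz, map_zero]
    rw [this.mfderiv_eq, mfderiv_const]
    rfl
  have z2 : (fun v : F₁ => Ψ (x, v)) =
      (e₂.continuousLinearMapAt ℝ (f₀ x) ∘L A x ∘L e₁.symmL ℝ x) := funext (hval x ⟨hx, hy⟩)
  change mfderiv I₁ 𝓘(ℝ, F₂) (fun z : B₁ => Ψ (z, (0 : F₁))) x u.1 +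
    mfderiv 𝓘(ℝ, F₁) 𝓘(ℝ, F₂) (fun v : F₁ => Ψ (x, v)) 0 u.2 = _ at hu
  rw [z1, z2, mfderiv_eq_fderiv, ContinuousLinearMap.fderiv] at hu
  refine ⟨e₁.symmL ℝ x u.2, ?_⟩
  have hu' : e₂.continuousLinearMapAt ℝ (f₀ x) (A x (e₁.symmL ℝ x u.2)) =
    e₂.continuousLinearMapAt ℝ (f₀ x) w := (zero_add _).symm.trans hu
  have := congrArg (e₂.symmL ℝ (f₀ x)) hu'
  rwa [e₂.symmL_continuousLinearMapAt hy, e₂.symmL_continuousLinearMapAt hy] at this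

end BundleMaps

/-! ### Smooth families of linear maps, from local ones by convexity. -/

section HomSections

open Filter Topology

variable {EB H B F₁ F₂ : Type*} {E₁ E₂ : B → Type*}
  [NormedAddCommGroup EB] [NormedSpace ℝ EB] [FiniteDimensional ℝ EB] [TopologicalSpace H]
  [TopologicalSpace B] [ChartedSpace H B] {I : ModelWithCorners ℝ EB H} [IsManifold I ∞ B]
  [T2Space B] [SigmaCompactSpace B]
  [NormedAddCommGroup F₁] [NormedSpace ℝ F₁] [∀ x, AddCommGroup (E₁ x)] [∀ x, Module ℝ (E₁ x)]
  [∀ x, TopologicalSpace (E₁ x)] [TopologicalSpace (TotalSpace F₁ E₁)]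
  [FiberBundle F₁ E₁] [VectorBundle ℝ F₁ E₁] [ContMDiffVectorBundle ∞ F₁ E₁ I]
  [NormedAddCommGroup F₂] [NormedSpace ℝ F₂] [∀ x, AddCommGroup (E₂ x)] [∀ x, Module ℝ (E₂ x)]
  [∀ x, TopologicalSpace (E₂ x)] [TopologicalSpace (TotalSpace F₂ E₂)]
  [FiberBundle F₂ E₂] [VectorBundle ℝ F₂ E₂] [ContMDiffVectorBundle ∞ F₂ E₂ I]
  [∀ x, IsTopologicalAddGroup (E₂ x)] [∀ x, ContinuousSMul ℝ (E₂ x)]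

/-- Existence of a smooth family of fiberwise linear maps between two vector bundles, subject to
fiberwise convex conditions that can be met locally. -/
theorem exists_contMDiff_hom_forall_mem_convex_of_local
    (t : ∀ x, Set (E₁ x →L[ℝ] E₂ x)) (ht : ∀ x, Convex ℝ (t x))
    (hloc : ∀ x₀, ∃ U ∈ 𝓝 x₀,
      U ⊆ (trivializationAt F₁ E₁ x₀).baseSet ∩ (trivializationAt F₂ E₂ x₀).baseSet ∧
      ∃ L : B → F₁ →L[ℝ] F₂, ContMDiffOn I 𝓘(ℝ, F₁ →L[ℝ] F₂) ∞ L U ∧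
        ∀ x ∈ U, (trivializationAt F₂ E₂ x₀).symmL ℝ x ∘L L x ∘L
          (trivializationAt F₁ E₁ x₀).continuousLinearMapAt ℝ x ∈ t x) :
    ∃ h : ∀ x, E₁ x →L[ℝ] E₂ x, (∀ x, h x ∈ t x) ∧ ∀ x₀,
      ContMDiffOn I 𝓘(ℝ, F₁ →L[ℝ] F₂) ∞ (fun x =>
        (trivializationAt F₂ E₂ x₀).continuousLinearMapAt ℝ x ∘L h x ∘L
          (trivializationAt F₁ E₁ x₀).symmL ℝ x)
        ((trivializationAt F₁ E₁ x₀).baseSet ∩ (trivializationAt F₂ E₂ x₀).baseSet) := by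
  -- Such families are sections of the bundle of homomorphisms, for which the local-to-global
  -- principle with fiberwise convex conditions applies.
  obtain ⟨s, hs⟩ := exists_contMDiffSection_forall_mem_convex_of_local I (n := (⊤ : ℕ∞))
    (F_fiber := F₁ →L[ℝ] F₂) (fun x => E₁ x →L[ℝ] E₂ x) t ht (by
    intro x₀
    obtain ⟨U, hU, hUb, L, hL, hLt⟩ := hloc x₀
    set e₁ := trivializationAt F₁ E₁ x₀
    set e₂ := trivializationAt F₂ E₂ x₀
    refine ⟨interior U, interior_mem_nhds.2 hU, fun x => e₂.symmL ℝ x ∘L L x ∘L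
      e₁.continuousLinearMapAt ℝ x, ?_, fun y hy => hLt y (interior_subset hy)⟩
    refine ((e₁.continuousLinearMap (RingHom.id ℝ) e₂).contMDiffOn_section_iff isOpen_interior
      (interior_subset.trans hUb)).2 ((hL.mono interior_subset).congr fun x hx => ?_)
    have hx' := hUb (interior_subset hx)
    rw [Trivialization.continuousLinearMap_apply]
    ext v
    simp only [ContinuousLinearMap.comp_apply]
    rw [e₁.continuousLinearMapAt_symmL hx'.1, e₂.continuousLinearMapAt_symmL hx'.2])
  refine ⟨s, hs, fun x₀ => ?_⟩
  exact (((trivializationAt F₁ E₁ x₀).continuousLinearMap (RingHom.id ℝ)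
    (trivializationAt F₂ E₂ x₀)).contMDiffOn_section_baseSet_iff (s := s)).1 s.contMDiff.contMDiffOn

end HomSections

/-! ### The case of the source bundle `f^*E`. -/

section Pullback

open Filter Topology

variable {EM HM M EG HG G FE FV : Type*} {E : M → Type*} {V : G → Type*}
  [NormedAddCommGroup EM] [NormedSpace ℝ EM] [TopologicalSpace HM]
  [TopologicalSpace M] [ChartedSpace HM M] {I : ModelWithCorners ℝ EM HM}
  [NormedAddCommGroup EG] [NormedSpace ℝ EG] [FiniteDimensional ℝ EG] [TopologicalSpace HG]
  [TopologicalSpace G] [ChartedSpace HG G] {J : ModelWithCorners ℝ EG HG} [IsManifold J ∞ G]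
  [T2Space G] [SigmaCompactSpace G]
  [NormedAddCommGroup FE] [NormedSpace ℝ FE] [∀ x, AddCommGroup (E x)] [∀ x, Module ℝ (E x)]
  [∀ x, TopologicalSpace (E x)] [TopologicalSpace (TotalSpace FE E)]
  [FiberBundle FE E] [VectorBundle ℝ FE E] [ContMDiffVectorBundle ∞ FE E I]
  [NormedAddCommGroup FV] [NormedSpace ℝ FV] [∀ x, AddCommGroup (V x)] [∀ x, Module ℝ (V x)]
  [∀ x, TopologicalSpace (V x)] [TopologicalSpace (TotalSpace FV V)]
  [FiberBundle FV V] [VectorBundle ℝ FV V] [ContMDiffVectorBundle ∞ FV V J]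
  [∀ x, IsTopologicalAddGroup (V x)] [∀ x, ContinuousSMul ℝ (V x)]

instance pullbackAddCommGroup (f : C^∞⟮J, G; I, M⟯) (g : G) : AddCommGroup ((f *ᵖ E) g) :=
  inferInstanceAs (AddCommGroup (E (f g)))

/-- The trivialization of the pullback at `g₀` is the pullback of the one at `f g₀`. This and the
next lemma state the result without mentioning the pullback bundle. -/
theorem pullback_continuousLinearMapAt (f : C^∞⟮J, G; I, M⟯) (g₀ g : G)
    (hg : f g ∈ (trivializationAt FE E (f g₀)).baseSet) :
    (trivializationAt FE (f *ᵖ E) g₀).continuousLinearMapAt ℝ g =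
      (trivializationAt FE E (f g₀)).continuousLinearMapAt ℝ (f g) := by
  have hg' : g ∈ (trivializationAt FE (f *ᵖ E) g₀).baseSet := hg
  refine ContinuousLinearMap.ext fun v => ?_
  exact (Trivialization.continuousLinearMapAt_apply_of_mem (R := ℝ) _ hg' (y := v)).trans
    (Trivialization.continuousLinearMapAt_apply_of_mem (R := ℝ) _ hg (y := v)).symm

theorem pullback_symmL (f : C^∞⟮J, G; I, M⟯) (g₀ g : G)
    (hg : f g ∈ (trivializationAt FE E (f g₀)).baseSet) :
    (trivializationAt FE (f *ᵖ E) g₀).symmL ℝ g =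
      (trivializationAt FE E (f g₀)).symmL ℝ (f g) := by
  have hg' : g ∈ (trivializationAt FE (f *ᵖ E) g₀).baseSet := hg
  refine ContinuousLinearMap.ext fun v => ?_
  have h := DFunLike.congr_fun (pullback_continuousLinearMapAt f g₀ g hg)
    ((trivializationAt FE (f *ᵖ E) g₀).symmL ℝ g v)
  rw [Trivialization.continuousLinearMapAt_symmL _ hg'] at h
  exact ((Trivialization.symmL_continuousLinearMapAt (R := ℝ)
    (trivializationAt FE E (f g₀)) hg _).symm.trans (congrArg _ h.symm))

/-- Existence of a smooth family of linear maps `E_(f(g)) → V_g`, subject to fiberwise convex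
conditions that can be met locally. -/
theorem exists_contMDiff_pullback_hom_forall_mem_convex_of_local (f : C^∞⟮J, G; I, M⟯)
    (t : ∀ g, Set (E (f g) →L[ℝ] V g)) (ht : ∀ g, Convex ℝ (t g))
    (hloc : ∀ g₀, ∃ U ∈ 𝓝 g₀,
      U ⊆ f ⁻¹' (trivializationAt FE E (f g₀)).baseSet ∩ (trivializationAt FV V g₀).baseSet ∧
      ∃ L : G → FE →L[ℝ] FV, ContMDiffOn J 𝓘(ℝ, FE →L[ℝ] FV) ∞ L U ∧
        ∀ g ∈ U, (trivializationAt FV V g₀).symmL ℝ g ∘L L g ∘L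
          (trivializationAt FE E (f g₀)).continuousLinearMapAt ℝ (f g) ∈ t g) :
    ∃ h : ∀ g, E (f g) →L[ℝ] V g, (∀ g, h g ∈ t g) ∧ ∀ g₀,
      ContMDiffOn J 𝓘(ℝ, FE →L[ℝ] FV) ∞ (fun g =>
        (trivializationAt FV V g₀).continuousLinearMapAt ℝ g ∘L h g ∘L
          (trivializationAt FE E (f g₀)).symmL ℝ (f g))
        (f ⁻¹' (trivializationAt FE E (f g₀)).baseSet ∩ (trivializationAt FV V g₀).baseSet) := by
  obtain ⟨h, hh, hs⟩ := exists_contMDiff_hom_forall_mem_convex_of_local (I := J) (F₁ := FE)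
    (E₁ := f *ᵖ E) (F₂ := FV) (E₂ := V) t ht (by
      intro g₀
      obtain ⟨U, hU, hUb, L, hL, hLt⟩ := hloc g₀
      refine ⟨U, hU, hUb, L, hL, fun g hg => ?_⟩
      rw [pullback_continuousLinearMapAt f g₀ g (hUb hg).1]
      exact hLt g hg)
  refine ⟨h, hh, fun g₀ => (hs g₀).congr fun g hg => ?_⟩
  rw [pullback_symmL f g₀ g hg.1]
  rfl

end Pullback

/-! ### Unital splittings of the target map, and the retargeting they define. -/

section Retargeting

open Filter Topology

variable {EM EG M G : Type*}
  [NormedAddCommGroup EM] [NormedSpace ℝ EM] [FiniteDimensional ℝ EM]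
  [NormedAddCommGroup EG] [NormedSpace ℝ EG] [FiniteDimensional ℝ EG]
  [TopologicalSpace M] [ChartedSpace EM M] [IsManifold 𝓘(ℝ, EM) ∞ M]
  [T2Space M] [SecondCountableTopology M]
  [TopologicalSpace G] [ChartedSpace EG G] [IsManifold 𝓘(ℝ, EG) ∞ G]
  [T2Space G] [SecondCountableTopology G]
  (K : LieGroupoid 𝓘(ℝ, EM) 𝓘(ℝ, EG) M G)
  {FE : Type*} [NormedAddCommGroup FE] [NormedSpace ℝ FE] [FiniteDimensional ℝ FE]
  {E : M → Type*} [∀ x, AddCommGroup (E x)] [∀ x, Module ℝ (E x)]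
  [∀ x, TopologicalSpace (E x)] [TopologicalSpace (TotalSpace FE E)]
  [FiberBundle FE E] [VectorBundle ℝ FE E] [ContMDiffVectorBundle ∞ FE E 𝓘(ℝ, EM)]
  {FV : Type*} [NormedAddCommGroup FV] [NormedSpace ℝ FV] [FiniteDimensional ℝ FV]
  {V : G → Type*} [∀ g, AddCommGroup (V g)] [∀ g, Module ℝ (V g)]
  [∀ g, TopologicalSpace (V g)] [TopologicalSpace (TotalSpace FV V)]
  [FiberBundle FV V] [VectorBundle ℝ FV V] [ContMDiffVectorBundle ∞ FV V 𝓘(ℝ, EG)]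
  (W : LieGroupoid (𝓘(ℝ, EM).prod 𝓘(ℝ, FE)) (𝓘(ℝ, EG).prod 𝓘(ℝ, FV))
    (TotalSpace FE E) (TotalSpace FV V))

/-- The right inverses `E_(t(g)) → V_g` of the target map of a VB-groupoid, which
are required to agree with the unit map of the VB-groupoid if `g` is a unit. -/
def unitalSplittings (g : G) : Set (E (K.tgt g) →L[ℝ] V g) :=
  {L | (∀ e, W.tgt ⟨g, L e⟩ = ⟨K.tgt g, e⟩) ∧
    (g = K.one (K.tgt g) → ∀ e, (⟨g, L e⟩ : TotalSpace FV V) = W.one ⟨K.tgt g, e⟩)}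

variable {K W}

/-- Being a right inverse of the linear map `A g` is an affine condition, and over a unit the second
condition determines the splitting completely. -/
theorem convex_unitalSplittings [∀ g, IsTopologicalAddGroup (V g)] [∀ g, ContinuousSMul ℝ (V g)]
    {A : ∀ g, V g →L[ℝ] E (K.tgt g)} (hA : ∀ g v, W.tgt ⟨g, v⟩ = ⟨K.tgt g, A g v⟩) (g : G) :
    Convex ℝ (unitalSplittings K W g) := by
  have hA' : ∀ v e, W.tgt ⟨g, v⟩ = ⟨K.tgt g, e⟩ ↔ A g v = e := fun v e => by
    rw [hA]; exact ⟨fun h => by simpa using h, fun h => by rw [h]⟩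
  rintro L₁ ⟨h₁, u₁⟩ L₂ ⟨h₂, u₂⟩ a b - - hab
  refine ⟨fun e => (hA' _ _).2 ?_, fun hg e => ?_⟩
  · have e₁ := (hA' _ _).1 (h₁ e)
    have e₂ := (hA' _ _).1 (h₂ e)
    simp only [_root_.add_apply, _root_.smul_apply, map_add, map_smul,
      e₁, e₂]
    rw [← add_smul, hab, one_smul]
  · have e₁ := u₁ hg e
    have e₂ : L₂ e = L₁ e := by simpa using (u₂ hg e).trans e₁.symm
    rw [← e₁]
    simp only [_root_.add_apply, _root_.smul_apply, e₂]
    rw [← add_smul, hab, one_smul]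

theorem mk_symmL_continuousLinearMapAt {g g' : G} (e : Trivialization FV (TotalSpace.proj (E := V)))
    [e.IsLinear ℝ] (hg' : g' ∈ e.baseSet) (w : V g') (h : g = g') :
    (⟨g, e.symmL ℝ g (e.continuousLinearMapAt ℝ g' w)⟩ : TotalSpace FV V) = ⟨g', w⟩ := by
  subst h
  rw [e.symmL_continuousLinearMapAt hg']

/-- A local splitting of the target map near an arrow `g₀`, obtained by correcting a family that
splits the target map at `g₀` and at the units. -/
theorem exists_local_splitting_of {A : ∀ g, V g →L[ℝ] E (K.tgt g)}
    (hA : ∀ g v, W.tgt ⟨g, v⟩ = ⟨K.tgt g, A g v⟩) (g₀ : G)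
    (eV : Trivialization FV (TotalSpace.proj (E := V))) [MemTrivializationAtlas eV]
    (eE : Trivialization FE (TotalSpace.proj (E := E))) [MemTrivializationAtlas eE]
    {U₀ : Set G} (hU₀ : IsOpen U₀) (hg₀ : g₀ ∈ U₀)
    (hUb : U₀ ⊆ K.tgt ⁻¹' eE.baseSet ∩ eV.baseSet) {L : G → FE →L[ℝ] FV}
    (hL : ContMDiffOn 𝓘(ℝ, EG) 𝓘(ℝ, FE →L[ℝ] FV) ∞ L U₀)
    (hL₀ : (eE.continuousLinearMapAt ℝ (K.tgt g₀) ∘L A g₀ ∘L eV.symmL ℝ g₀) ∘L L g₀ =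
      ContinuousLinearMap.id ℝ FE)
    (hLu : ∀ g ∈ U₀, g = K.one (K.tgt g) → ∀ e,
      (⟨g, eV.symmL ℝ g (L g (eE.continuousLinearMapAt ℝ (K.tgt g) e))⟩ : TotalSpace FV V) =
        W.one ⟨K.tgt g, e⟩) :
    ∃ U ∈ 𝓝 g₀, U ⊆ K.tgt ⁻¹' eE.baseSet ∩ eV.baseSet ∧ ∃ L : G → FE →L[ℝ] FV,
      ContMDiffOn 𝓘(ℝ, EG) 𝓘(ℝ, FE →L[ℝ] FV) ∞ L U ∧
      ∀ g ∈ U, eV.symmL ℝ g ∘L L g ∘L eE.continuousLinearMapAt ℝ (K.tgt g) ∈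
        unitalSplittings K W g := by
  have : CompleteSpace FE := FiniteDimensional.complete ℝ FE
  -- `B` measures the failure of `L` to split the target map. It is the identity at `g₀`, hence
  -- invertible nearby, and `L ∘ B⁻¹` is a splitting. Over the units `B = 1`, so the correction
  -- preserves the prescribed values there.
  set B : G → FE →L[ℝ] FE := fun g =>
    (eE.continuousLinearMapAt ℝ (K.tgt g) ∘L A g ∘L eV.symmL ℝ g) ∘L L g with hB
  have hBs : ContMDiffOn 𝓘(ℝ, EG) 𝓘(ℝ, FE →L[ℝ] FE) ∞ B U₀ :=
    ((contMDiffOn_inTrivializations W.contMDiff_tgt hA eV eE).mono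
      fun g hg => ⟨(hUb hg).2, (hUb hg).1⟩).clm_comp hL
  have hinv : ∀ u : FE →L[ℝ] FE, IsUnit u → ∀ v, u (Ring.inverse u v) = v := fun u hu v =>
    DFunLike.congr_fun (Ring.mul_inverse_cancel u hu) v
  have htgt : ∀ g ∈ U₀, ∀ v : FV, ∀ e,
      eE.continuousLinearMapAt ℝ (K.tgt g) (A g (eV.symmL ℝ g v)) =
        eE.continuousLinearMapAt ℝ (K.tgt g) e → W.tgt ⟨g, eV.symmL ℝ g v⟩ = ⟨K.tgt g, e⟩ := by
    intro g hg v e h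
    rw [hA, ← eE.symmL_continuousLinearMapAt (R := ℝ) (hUb hg).1 (A g _), h,
      eE.symmL_continuousLinearMapAt (R := ℝ) (hUb hg).1]
  have hBu : ∀ g ∈ U₀, g = K.one (K.tgt g) → B g = 1 := by
    intro g hg hu
    ext v
    have h := congrArg W.tgt (hLu g hg hu (eE.symmL ℝ (K.tgt g) v))
    rw [W.tgt_one, hA, eE.continuousLinearMapAt_symmL (hUb hg).1] at h
    have h' : A g (eV.symmL ℝ g (L g v)) = eE.symmL ℝ (K.tgt g) v := by simpa using h
    simp only [hB, ContinuousLinearMap.comp_apply]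
    rw [h', eE.continuousLinearMapAt_symmL (hUb hg).1]
    rfl
  refine ⟨U₀ ∩ B ⁻¹' {u | IsUnit u}, (hBs.continuousOn.isOpen_inter_preimage hU₀
    Units.isOpen).mem_nhds ⟨hg₀, ?_⟩, inter_subset_left.trans hUb,
    fun g => L g ∘L Ring.inverse (B g), ?_, ?_⟩
  · have h : B g₀ = 1 := hL₀
    change IsUnit (B g₀)
    rw [h]
    exact isUnit_one
  · refine (hL.mono inter_subset_left).clm_comp fun g hg => ?_
    obtain ⟨u, hu⟩ : IsUnit (B g) := hg.2
    have h := contDiffAt_ringInverse (n := ∞) ℝ u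
    rw [hu] at h
    exact h.contMDiffAt.comp_contMDiffWithinAt g ((hBs g hg.1).mono inter_subset_left)
  · rintro g ⟨hg, hgu⟩
    refine ⟨fun e => htgt g hg _ e ?_, fun hu e => ?_⟩
    · exact hinv (B g) hgu _
    · have h1 : Ring.inverse (B g) = 1 := by rw [hBu g hg hu, Ring.inverse_one]
      rw [← hLu g hg hu e]
      simp only [ContinuousLinearMap.comp_apply, h1]
      rfl

/-- Near a unit, the unit map of the VB-groupoid provides the initial family. Near any other arrow
the units can be avoided, and a right inverse at `g₀` in fixed coordinates is enough. -/
theorem exists_local_splitting {A : ∀ g, V g →L[ℝ] E (K.tgt g)}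
    (hA : ∀ g v, W.tgt ⟨g, v⟩ = ⟨K.tgt g, A g v⟩) (𝒱 : IsVBGroupoid K W) (g₀ : G) :
    ∃ U ∈ 𝓝 g₀, U ⊆ K.tgt ⁻¹' (trivializationAt FE E (K.tgt g₀)).baseSet ∩
        (trivializationAt FV V g₀).baseSet ∧ ∃ L : G → FE →L[ℝ] FV,
      ContMDiffOn 𝓘(ℝ, EG) 𝓘(ℝ, FE →L[ℝ] FV) ∞ L U ∧
      ∀ g ∈ U, (trivializationAt FV V g₀).symmL ℝ g ∘L L g ∘L
        (trivializationAt FE E (K.tgt g₀)).continuousLinearMapAt ℝ (K.tgt g) ∈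
          unitalSplittings K W g := by
  have hV₀ : g₀ ∈ (trivializationAt FV V g₀).baseSet := mem_baseSet_trivializationAt _ _ _
  have hE₀ : K.tgt g₀ ∈ (trivializationAt FE E (K.tgt g₀)).baseSet :=
    mem_baseSet_trivializationAt _ _ _
  set eV := trivializationAt FV V g₀
  set eE := trivializationAt FE E (K.tgt g₀)
  have ht := K.contMDiff_tgt.continuous
  have hS : IsOpen (K.tgt ⁻¹' eE.baseSet ∩ eV.baseSet) :=
    (eE.open_baseSet.preimage ht).inter eV.open_baseSet
  have hot : Continuous fun g => K.one (K.tgt g) := K.contMDiff_one.continuous.comp ht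
  by_cases hu₀ : g₀ = K.one (K.tgt g₀)
  · obtain ⟨u, hu⟩ := exists_clm_of_homogeneous (f₀ := K.one) W.contMDiff_one 𝒱.proj.one
      (fun c hc v => (𝒱.scale c hc).one v |>.symm)
    -- The unit map takes values over `1_(t(g))` and not over `g`. Passing through the
    -- trivialization around `g₀` carries them to the fiber over `g`, and changes nothing if `g` is
    -- a unit.
    have key : ∀ g ∈ eV.baseSet, K.tgt g ∈ eE.baseSet → K.one (K.tgt g) ∈ eV.baseSet →
        g = K.one (K.tgt g) → ∀ e, (⟨g, eV.symmL ℝ g ((eV.continuousLinearMapAt ℝ (K.one (K.tgt g))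
          ∘L u (K.tgt g) ∘L eE.symmL ℝ (K.tgt g)) (eE.continuousLinearMapAt ℝ (K.tgt g) e))⟩ :
            TotalSpace FV V) = W.one ⟨K.tgt g, e⟩ := by
      intro g _ hgE hg' hg e
      simp only [ContinuousLinearMap.comp_apply]
      rw [eE.symmL_continuousLinearMapAt hgE, mk_symmL_continuousLinearMapAt eV hg' _ hg, hu]
    refine exists_local_splitting_of hA g₀ eV eE
      (U₀ := (K.tgt ⁻¹' eE.baseSet ∩ eV.baseSet) ∩ (fun g => K.one (K.tgt g)) ⁻¹' eV.baseSet)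
      (hS.inter (eV.open_baseSet.preimage hot)) ⟨⟨hE₀, hV₀⟩, ?_⟩ inter_subset_left
      (L := fun g => eV.continuousLinearMapAt ℝ (K.one (K.tgt g)) ∘L u (K.tgt g) ∘L
        eE.symmL ℝ (K.tgt g)) ?_ ?_ ?_
    · change K.one (K.tgt g₀) ∈ eV.baseSet
      rw [← hu₀]; exact hV₀
    · exact (contMDiffOn_inTrivializations W.contMDiff_one hu eE eV).comp
        K.contMDiff_tgt.contMDiffOn fun g hg => ⟨hg.1.1, hg.2⟩
    · ext v
      have h := congrArg W.tgt (key g₀ hV₀ hE₀ (by rw [← hu₀]; exact hV₀) hu₀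
        (eE.symmL ℝ (K.tgt g₀) v))
      rw [W.tgt_one, hA, eE.continuousLinearMapAt_symmL hE₀] at h
      have h' := (TotalSpace.mk_inj).1 h
      exact (congrArg (eE.continuousLinearMapAt ℝ (K.tgt g₀)) h').trans
        (eE.continuousLinearMapAt_symmL hE₀ v)
    · exact fun g hg hgu e => key g hg.1.2 hg.1.1 hg.2 hgu e
  -- The units form the closed set where `g = 1_(t(g))`, as `G` is Hausdorff. On its complement the
  -- condition at units is vacuous, and a constant family serves.
  · have hsurj : Function.Surjective
        (eE.continuousLinearMapAt ℝ (K.tgt g₀) ∘L A g₀ ∘L eV.symmL ℝ g₀) := by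
      intro w
      obtain ⟨v, hv⟩ := surjective_of_submersion W.contMDiff_tgt hA g₀ (W.submersion_tgt _)
        (eE.symmL ℝ (K.tgt g₀) w)
      refine ⟨eV.continuousLinearMapAt ℝ g₀ v, ?_⟩
      simp only [ContinuousLinearMap.comp_apply]
      rw [eV.symmL_continuousLinearMapAt hV₀, hv, eE.continuousLinearMapAt_symmL hE₀]
    obtain ⟨R, hR⟩ := LinearMap.exists_rightInverse_of_surjective _
      (LinearMap.range_eq_top.2 hsurj)
    refine exists_local_splitting_of hA g₀ eV eE
      (U₀ := (K.tgt ⁻¹' eE.baseSet ∩ eV.baseSet) ∩ {g | g ≠ K.one (K.tgt g)})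
      (hS.inter (isOpen_ne_fun continuous_id hot)) ⟨⟨hE₀, hV₀⟩, hu₀⟩ inter_subset_left
      (L := fun _ => R.toContinuousLinearMap) contMDiffOn_const ?_ fun g hg hg' => absurd hg' hg.2
    ext v
    exact DFunLike.congr_fun hR v

open Classical in
/-- The operation that changes the target of `v` to `e` by adding `h (e - t(v))`. -/
def retarget (A : ∀ g, V g →L[ℝ] E (K.tgt g)) (h : ∀ g, E (K.tgt g) →L[ℝ] V g)
    (v : TotalSpace FV V) (e : TotalSpace FE E) : TotalSpace FV V :=
  if hv : K.tgt v.proj = e.proj then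
    ⟨v.proj, v.2 + h v.proj (cast (congrArg E hv.symm) e.2 - A v.proj v.2)⟩
  else v

theorem retarget_mk (A : ∀ g, V g →L[ℝ] E (K.tgt g)) (h : ∀ g, E (K.tgt g) →L[ℝ] V g)
    (g : G) (v : V g) (e : E (K.tgt g)) :
    retarget A h ⟨g, v⟩ (⟨K.tgt g, e⟩ : TotalSpace FE E) =
      (⟨g, v + h g (e - A g v)⟩ : TotalSpace FV V) := by
  simp [retarget]

theorem smoothOnSubset_retarget {A : ∀ g, V g →L[ℝ] E (K.tgt g)}
    (hA : ∀ g v, W.tgt ⟨g, v⟩ = ⟨K.tgt g, A g v⟩) {h : ∀ g, E (K.tgt g) →L[ℝ] V g}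
    (hs : ∀ g₀, ContMDiffOn 𝓘(ℝ, EG) 𝓘(ℝ, FE →L[ℝ] FV) ∞ (fun g =>
        (trivializationAt FV V g₀).continuousLinearMapAt ℝ g ∘L h g ∘L
          (trivializationAt FE E (K.tgt g₀)).symmL ℝ (K.tgt g))
        (K.tgt ⁻¹' (trivializationAt FE E (K.tgt g₀)).baseSet ∩
          (trivializationAt FV V g₀).baseSet)) :
    SmoothOnSubset ((𝓘(ℝ, EG).prod 𝓘(ℝ, FV)).prod (𝓘(ℝ, EM).prod 𝓘(ℝ, FE)))
      (𝓘(ℝ, EG).prod 𝓘(ℝ, FV))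
      {p : TotalSpace FV V × TotalSpace FE E | K.tgt p.1.proj = p.2.proj}
      (fun p => retarget A h p.1.1 p.1.2) := by
  rintro ⟨⟨⟨g₀, v₀⟩, e₀⟩, hp⟩
  have hH := hs g₀
  have hV₀ : g₀ ∈ (trivializationAt FV V g₀).baseSet := mem_baseSet_trivializationAt _ _ _
  have hE₀ : K.tgt g₀ ∈ (trivializationAt FE E (K.tgt g₀)).baseSet :=
    mem_baseSet_trivializationAt _ _ _
  set eV := trivializationAt FV V g₀
  set eE := trivializationAt FE E (K.tgt g₀)
  set H : G → FE →L[ℝ] FV := fun g =>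
    eV.continuousLinearMapAt ℝ g ∘L h g ∘L eE.symmL ℝ (K.tgt g) with hHdef
  have ht := K.contMDiff_tgt.continuous
  have hS : IsOpen (K.tgt ⁻¹' eE.baseSet ∩ eV.baseSet) :=
    (eE.open_baseSet.preimage ht).inter eV.open_baseSet
  have hπV : Continuous (TotalSpace.proj : TotalSpace FV V → G) := FiberBundle.continuous_proj _ _
  have hπE : Continuous (TotalSpace.proj : TotalSpace FE E → M) := FiberBundle.continuous_proj _ _
  -- The extension to an open set computes `e - t(v)` in the coordinates of `FE`, where it makes
  -- sense even if the base points of `e` and `t(v)` differ.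
  refine ⟨(fun p => p.1.proj) ⁻¹' (K.tgt ⁻¹' eE.baseSet ∩ eV.baseSet) ∩
      (fun p => p.2.proj) ⁻¹' eE.baseSet,
    (hS.preimage (hπV.comp continuous_fst)).inter
      (eE.open_baseSet.preimage (hπE.comp continuous_snd)),
    ⟨⟨hE₀, hV₀⟩, (congrArg (· ∈ eE.baseSet) hp).mp hE₀⟩,
    fun p => eV.toOpenPartialHomeomorph.symm (p.1.proj,
      (eV p.1).2 + H p.1.proj ((eE p.2).2 - (eE (W.tgt p.1)).2)), ?_, ?_⟩
  · set P : Set (TotalSpace FV V × TotalSpace FE E) :=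
      (fun p => p.1.proj) ⁻¹' (K.tgt ⁻¹' eE.baseSet ∩ eV.baseSet) ∩
        (fun p => p.2.proj) ⁻¹' eE.baseSet
    have hcV : ContMDiffOn (𝓘(ℝ, EG).prod 𝓘(ℝ, FV)) (𝓘(ℝ, EG).prod 𝓘(ℝ, FV)) ∞ eV eV.source :=
      eV.contMDiffOn
    have hcE : ContMDiffOn (𝓘(ℝ, EM).prod 𝓘(ℝ, FE)) (𝓘(ℝ, EM).prod 𝓘(ℝ, FE)) ∞ eE eE.source :=
      eE.contMDiffOn
    have h1 : ContMDiffOn ((𝓘(ℝ, EG).prod 𝓘(ℝ, FV)).prod (𝓘(ℝ, EM).prod 𝓘(ℝ, FE)))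
        (𝓘(ℝ, EG).prod 𝓘(ℝ, FV)) ∞
        (fun p : TotalSpace FV V × TotalSpace FE E => eV p.1) P :=
      hcV.comp contMDiff_fst.contMDiffOn fun p hp => eV.mem_source.2 hp.1.2
    have h2 : ContMDiffOn ((𝓘(ℝ, EG).prod 𝓘(ℝ, FV)).prod (𝓘(ℝ, EM).prod 𝓘(ℝ, FE)))
        (𝓘(ℝ, EM).prod 𝓘(ℝ, FE)) ∞
        (fun p : TotalSpace FV V × TotalSpace FE E => eE p.2) P :=
      hcE.comp contMDiff_snd.contMDiffOn fun p hp => eE.mem_source.2 hp.2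
    have h3 : ContMDiffOn ((𝓘(ℝ, EG).prod 𝓘(ℝ, FV)).prod (𝓘(ℝ, EM).prod 𝓘(ℝ, FE)))
        (𝓘(ℝ, EM).prod 𝓘(ℝ, FE)) ∞
        (fun p : TotalSpace FV V × TotalSpace FE E => eE (W.tgt p.1)) P :=
      hcE.comp (W.contMDiff_tgt.comp contMDiff_fst).contMDiffOn fun p hp => by
        refine eE.mem_source.2 ?_
        have := hp.1.1
        obtain ⟨⟨g, v⟩, e⟩ := p
        change (W.tgt ⟨g, v⟩).proj ∈ eE.baseSet
        rw [hA]
        exact this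
    have h4 : ContMDiffOn ((𝓘(ℝ, EG).prod 𝓘(ℝ, FV)).prod (𝓘(ℝ, EM).prod 𝓘(ℝ, FE)))
        𝓘(ℝ, EG) ∞ (fun p : TotalSpace FV V × TotalSpace FE E => p.1.proj) P :=
      ((Bundle.contMDiff_proj V).comp contMDiff_fst).contMDiffOn
    have h5 := (hH.comp h4 fun p hp => hp.1).clm_apply ((contMDiff_snd.comp_contMDiffOn h2).sub
      (contMDiff_snd.comp_contMDiffOn h3))
    exact (eV.contMDiffOn_symm (IB := 𝓘(ℝ, EG)) (n := ∞)).comp (h4.prodMk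
      ((contMDiff_snd.comp_contMDiffOn h1).add h5))
      fun p hp => eV.mem_target.2 hp.1.2
  · rintro ⟨⟨⟨g, v⟩, ⟨x, e⟩⟩, hx⟩ ⟨⟨hgE, hgV⟩, -⟩
    change K.tgt g = x at hx
    subst hx
    change K.tgt g ∈ eE.baseSet at hgE
    change g ∈ eV.baseSet at hgV
    have c1 : ∀ w : V g, (eV ⟨g, w⟩).2 = eV.continuousLinearMapAt ℝ g w := fun w =>
      (eV.continuousLinearMapAt_apply_of_mem (R := ℝ) hgV _).symm
    have c2 : ∀ w : E (K.tgt g), (eE ⟨K.tgt g, w⟩).2 = eE.continuousLinearMapAt ℝ (K.tgt g) w :=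
      fun w => (eE.continuousLinearMapAt_apply_of_mem (R := ℝ) hgE _).symm
    simp only [retarget_mk, hA, c1, c2, hHdef, ContinuousLinearMap.comp_apply]
    rw [← map_sub, eE.symmL_continuousLinearMapAt hgE, ← map_add, ← c1]
    have e1 : (g, (eV ⟨g, v + h g (e - A g v)⟩).2) = eV ⟨g, v + h g (e - A g v)⟩ :=
      Prod.ext (eV.coe_fst (x := ⟨g, v + h g (e - A g v)⟩) (eV.mem_source.2 hgV)).symm rfl
    rw [e1]
    exact eV.toOpenPartialHomeomorph.left_inv (eV.mem_source.2 hgV)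

variable (K W) in
-- With a unital splitting `h`, adding `h (e - t(v))` changes the target from `t(v)` to `e` because
-- `h` splits the target map. Linearity of `h` gives homogeneity, and unitality of `h` takes units
-- to units.
theorem IsVBGroupoid.exists_isRetargeting (𝒱 : IsVBGroupoid K W) : ∃ Λ, 𝒱.IsRetargeting Λ := by
  -- The topological vector space structure of the fibers comes from the model fiber.
  have : ∀ g, IsTopologicalAddGroup (V g) := fun g =>
    (VectorBundle.continuousLinearEquivAt ℝ FV V g).toContinuousAddEquiv.isTopologicalAddGroup
  have : ∀ g, ContinuousSMul ℝ (V g) := fun g =>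
    (VectorBundle.continuousLinearEquivAt ℝ FV V g).continuousSMul
  have : LocallyCompactSpace G := ChartedSpace.locallyCompactSpace EG G
  obtain ⟨A, hA⟩ := exists_clm_of_homogeneous (f₀ := K.tgt) W.contMDiff_tgt
    (fun v => (𝒱.proj.tgt v).symm) (fun c hc v => (𝒱.scale c hc).tgt v)
  obtain ⟨h, hh, hs⟩ := exists_contMDiff_pullback_hom_forall_mem_convex_of_local
    (⟨K.tgt, K.contMDiff_tgt⟩ : C^∞⟮𝓘(ℝ, EG), G; 𝓘(ℝ, EM), M⟯) (unitalSplittings K W)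
    (convex_unitalSplittings hA) (exists_local_splitting hA 𝒱)
  have hh1 : ∀ g e, A g (h g e) = e := fun g e =>
    TotalSpace.mk_inj.1 ((hA _ _).symm.trans ((hh g).1 e))
  refine ⟨retarget A h, ?_, ?_, ?_, ?_, ?_, smoothOnSubset_retarget hA hs⟩
  · rintro ⟨g, v⟩ ⟨x, e⟩ hx
    change K.tgt g = x at hx
    subst hx
    rw [retarget_mk]
  · rintro ⟨g, v⟩ ⟨x, e⟩ hx
    change K.tgt g = x at hx
    subst hx
    rw [retarget_mk, hA, map_add, hh1, add_sub_cancel]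
  · rintro ⟨g, v⟩
    rw [hA, retarget_mk, sub_self, map_zero, add_zero]
  · rintro ⟨x', f⟩ ⟨x, e⟩ (hx : x' = x)
    -- The unit at `f` is given a name so that its base point can be substituted. Over a unit `v = h
    -- f`, so retargeting gives `h f + h (e - f) = h e`, the unit at `e`.
    obtain ⟨⟨g, v⟩, hgv⟩ : ∃ w, w = W.one ⟨x', f⟩ := ⟨_, rfl⟩
    have hg : g = K.one x' := (congrArg TotalSpace.proj hgv).trans (𝒱.proj.one _)
    have hgx' : K.tgt g = x' := by rw [hg, K.tgt_one]
    subst hx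
    subst hgx'
    obtain rfl : v = h g f := TotalSpace.mk_inj.1 (hgv.trans ((hh g).2 hg f).symm)
    rw [← hgv, retarget_mk, hh1, ← map_add, add_sub_cancel]
    exact (hh g).2 hg e
  · rintro c hc ⟨g, v⟩ ⟨x, e⟩ hx
    change K.tgt g = x at hx
    subst hx
    simp only [fiberScale]
    rw [retarget_mk, retarget_mk, map_smul, ← smul_sub, map_smul, ← smul_add]

end Retargeting

/-! ### From cochains to cohomology. -/

namespace LieGroupoid.CochainSubcomplex

variable {EM HM M EG HG G EM' HM' M' EG' HG' G' : Type*}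
  [NormedAddCommGroup EM] [NormedSpace ℝ EM] [TopologicalSpace HM]
  [NormedAddCommGroup EG] [NormedSpace ℝ EG] [TopologicalSpace HG]
  [TopologicalSpace M] [ChartedSpace HM M] [TopologicalSpace G] [ChartedSpace HG G]
  [NormedAddCommGroup EM'] [NormedSpace ℝ EM'] [TopologicalSpace HM']
  [NormedAddCommGroup EG'] [NormedSpace ℝ EG'] [TopologicalSpace HG']
  [TopologicalSpace M'] [ChartedSpace HM' M'] [TopologicalSpace G'] [ChartedSpace HG' G']
  {I : ModelWithCorners ℝ EM HM} {J : ModelWithCorners ℝ EG HG}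
  {I' : ModelWithCorners ℝ EM' HM'} {J' : ModelWithCorners ℝ EG' HG'}
  {K : LieGroupoid I J M G} {L : LieGroupoid I' J' M' G'}

theorem inclusionH_toH {S T : K.CochainSubcomplex} (h : S ≤ T) (p : ℕ) (φ : S.cocycles p) :
    inclusionH h p (S.toH p φ) = T.toH p ⟨φ.1, cocycles_mono h p φ.2⟩ := rfl

/-- An inclusion of subcomplexes is a quasi-isomorphism if every cochain with coboundary in the
smaller complex lies in the smaller complex up to a coboundary. -/
theorem bijective_inclusionH {S T : K.CochainSubcomplex} (h : S ≤ T)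
    (H : ∀ p, ∀ ψ ∈ T.carrier p, K.delta p ψ ∈ S.carrier (p + 1) →
      ∃ β ∈ T.coboundaries p, ψ - β ∈ S.carrier p) (p : ℕ) :
    Function.Bijective (inclusionH h p) := by
  constructor
  · rw [injective_iff_map_eq_zero]
    intro a ha
    obtain ⟨φ, rfl⟩ := toH_surjective _ _ a
    rw [inclusionH_toH, toH_eq_zero] at ha
    rw [toH_eq_zero]
    cases p with
    | zero => exact ha
    | succ p =>
      obtain ⟨ψ, hψ, e⟩ := ha
      -- The hypothesis is applied to a primitive `ψ` of `φ` in the larger complex: subtracting the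
      -- coboundary `β` moves it into the smaller complex without changing `δψ = φ`.
      obtain ⟨β, hβ, hβ'⟩ := H p ψ hψ (by rw [e]; exact φ.2.1)
      refine ⟨ψ - β, hβ', ?_⟩
      have h0 : K.delta p β = 0 := (T.coboundaries_le p hβ).2
      rw [map_sub, h0, sub_zero, e]
  · intro a
    obtain ⟨ψ, rfl⟩ := toH_surjective _ _ a
    have h0 : K.delta p ψ.1 = 0 := ψ.2.2
    -- A cocycle has coboundary zero, which lies in every subcomplex.
    obtain ⟨β, hβ, hβ'⟩ := H p ψ.1 ψ.2.1 (by rw [h0]; exact zero_mem _)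
    have hc : ψ.1 - β ∈ S.cocycles p :=
      ⟨hβ', sub_mem ψ.2.2 (T.coboundaries_le p hβ).2⟩
    refine ⟨S.toH p ⟨_, hc⟩, ?_⟩
    rw [inclusionH_toH, ← sub_eq_zero, ← map_sub, toH_eq_zero]
    change ψ.1 - β - ψ.1 ∈ _
    rw [sub_sub_cancel_left]
    exact neg_mem hβ

theorem bijective_totalInclusionH {S T : K.CochainSubcomplex} (h : S ≤ T)
    (H : ∀ p, Function.Bijective (inclusionH h p)) :
    Function.Bijective (totalInclusionH h) :=
  ⟨DFinsupp.mapRange_injective _ (fun _ => map_zero _) |>.2 fun p => (H p).1,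
    DFinsupp.mapRange_surjective _ (fun _ => map_zero _) |>.2 fun p => (H p).2⟩

theorem totalInclusionH_act {ρ : G → G'} {ρ₀ : M → M'} {hρ : IsLieGroupoidMorphism K L ρ ρ₀}
    {S S' : K.CochainSubcomplex} {T : L.CochainSubcomplex} (h : S ≤ S')
    (hs : CupStable hρ S T) (hs' : CupStable hρ S' T) (x : ⨁ p, S.H p) (y : ⨁ q, T.H q) :
    totalInclusionH h (act hs x y) = act hs' (totalInclusionH h x) y := by
  induction x using DirectSum.induction_on with
  | zero => simp
  | add x x' hx hx' => simp only [map_add, LinearMap.add_apply, hx, hx']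
  | of p a =>
  induction y using DirectSum.induction_on with
  | zero => simp
  | add x x' hx hx' => simp only [map_add, hx, hx']
  | of q b =>
  change totalInclusionH h (act hs (DirectSum.lof ℝ ℕ (fun n => S.H n) p a)
    (DirectSum.lof ℝ ℕ (fun n => T.H n) q b)) =
    act hs' (totalInclusionH h (DirectSum.lof ℝ ℕ (fun n => S.H n) p a))
      (DirectSum.lof ℝ ℕ (fun n => T.H n) q b)
  rw [act_lof hs rfl, totalInclusionH, DirectSum.lmap_lof, DirectSum.lmap_lof, act_lof hs' rfl]
  congr 1
  obtain ⟨φ, rfl⟩ := toH_surjective _ _ a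
  obtain ⟨f, rfl⟩ := toH_surjective _ _ b
  rfl

end LieGroupoid.CochainSubcomplex

/-! ### Application to the VB-groupoid cochains. -/

section VB

variable {EM HM M EG HG G : Type*}
  [NormedAddCommGroup EM] [NormedSpace ℝ EM] [TopologicalSpace HM]
  [NormedAddCommGroup EG] [NormedSpace ℝ EG] [TopologicalSpace HG]
  [TopologicalSpace M] [ChartedSpace HM M] [TopologicalSpace G] [ChartedSpace HG G]
  {I : ModelWithCorners ℝ EM HM} {J : ModelWithCorners ℝ EG HG}
  {K : LieGroupoid I J M G}
  {FE : Type*} [NormedAddCommGroup FE] [NormedSpace ℝ FE]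
  {E : M → Type*} [∀ x, AddCommGroup (E x)] [∀ x, Module ℝ (E x)]
  [∀ x, TopologicalSpace (E x)] [TopologicalSpace (TotalSpace FE E)]
  [FiberBundle FE E] [VectorBundle ℝ FE E] [ContMDiffVectorBundle ∞ FE E I]
  {FV : Type*} [NormedAddCommGroup FV] [NormedSpace ℝ FV]
  {V : G → Type*} [∀ g, AddCommGroup (V g)] [∀ g, Module ℝ (V g)]
  [∀ g, TopologicalSpace (V g)] [TopologicalSpace (TotalSpace FV V)]
  [FiberBundle FV V] [VectorBundle ℝ FV V] [ContMDiffVectorBundle ∞ FV V J]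
  {W : LieGroupoid (I.prod 𝓘(ℝ, FE)) (J.prod 𝓘(ℝ, FV)) (TotalSpace FE E) (TotalSpace FV V)}
  (𝒱 : IsVBGroupoid K W)

open LieGroupoid

/-- In degree zero there is no projectability condition and nothing to subtract. In positive degree
the coboundary of `correction` is subtracted. -/
theorem IsVBGroupoid.exists_sub_mem_vbCochains
    {Λ : TotalSpace FV V → TotalSpace FE E → TotalSpace FV V} (hΛ : 𝒱.IsRetargeting Λ) (p : ℕ)
    (ψ : W.Nerve p → ℝ) (hψ : ψ ∈ (𝒱.homCochains 1).carrier p)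
    (hδ : W.delta p ψ ∈ 𝒱.vbCochains.carrier (p + 1)) :
    ∃ β ∈ (𝒱.homCochains 1).coboundaries p, ψ - β ∈ 𝒱.vbCochains.carrier p := by
  cases p with
  | zero => exact ⟨0, zero_mem _, by rw [sub_zero]; exact ⟨hψ, trivial⟩⟩
  | succ q =>
    have hm := 𝒱.correction_mem hΛ ψ hψ
    exact ⟨W.delta q (𝒱.correction hΛ ψ), ⟨_, hm, rfl⟩,
      sub_mem hψ ((𝒱.homCochains 1).delta_mem q _ hm),
      𝒱.isLeftProjectable_sub_delta_correction hΛ ψ hψ hδ.2⟩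

/-- The inclusion of the VB-groupoid cochains into the linear cochains, in total cohomology, as a
homomorphism of right modules. -/
def IsVBGroupoid.inclusionLinear :
    (⨁ p, 𝒱.vbCochains.H p) →ₗ[(K.Cohomology)ᵐᵒᵖ] (⨁ p, (𝒱.homCochains 1).H p) where
  toFun := CochainSubcomplex.totalInclusionH 𝒱.vbCochains_le
  map_add' := map_add _
  map_smul' a x := CochainSubcomplex.totalInclusionH_act _ 𝒱.vbCochains_cupStable
    (𝒱.homCochains_cupStable 1) x a.unop

end VB

end

theorem lemma3p1
    {EM EG M G : Type*}
    [NormedAddCommGroup EM] [NormedSpace ℝ EM] [FiniteDimensional ℝ EM]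
    [NormedAddCommGroup EG] [NormedSpace ℝ EG] [FiniteDimensional ℝ EG]
    [TopologicalSpace M] [ChartedSpace EM M] [IsManifold 𝓘(ℝ, EM) ∞ M]
    [T2Space M] [SecondCountableTopology M]
    [TopologicalSpace G] [ChartedSpace EG G] [IsManifold 𝓘(ℝ, EG) ∞ G]
    [T2Space G] [SecondCountableTopology G]
    (K : LieGroupoid 𝓘(ℝ, EM) 𝓘(ℝ, EG) M G)
    {FE : Type*} [NormedAddCommGroup FE] [NormedSpace ℝ FE] [FiniteDimensional ℝ FE]
    {E : M → Type*} [∀ x, AddCommGroup (E x)] [∀ x, Module ℝ (E x)]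
    [∀ x, TopologicalSpace (E x)] [TopologicalSpace (TotalSpace FE E)]
    [FiberBundle FE E] [VectorBundle ℝ FE E] [ContMDiffVectorBundle ∞ FE E 𝓘(ℝ, EM)]
    {FV : Type*} [NormedAddCommGroup FV] [NormedSpace ℝ FV] [FiniteDimensional ℝ FV]
    {V : G → Type*} [∀ g, AddCommGroup (V g)] [∀ g, Module ℝ (V g)]
    [∀ g, TopologicalSpace (V g)] [TopologicalSpace (TotalSpace FV V)]
    [FiberBundle FV V] [VectorBundle ℝ FV V] [ContMDiffVectorBundle ∞ FV V 𝓘(ℝ, EG)]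
    (W : LieGroupoid (𝓘(ℝ, EM).prod 𝓘(ℝ, FE)) (𝓘(ℝ, EG).prod 𝓘(ℝ, FV))
      (TotalSpace FE E) (TotalSpace FV V))
    (𝒱 : IsVBGroupoid K W) :
    (∀ p : ℕ, Function.Bijective
      (LieGroupoid.CochainSubcomplex.inclusionH 𝒱.vbCochains_le p)) ∧
    ∃ e : (⨁ p, 𝒱.vbCochains.H p) ≃ₗ[(K.Cohomology)ᵐᵒᵖ] (⨁ p, (𝒱.homCochains 1).H p),
      ∀ x, e x = LieGroupoid.CochainSubcomplex.totalInclusionH 𝒱.vbCochains_le x := by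
  obtain ⟨Λ, hΛ⟩ := IsVBGroupoid.exists_isRetargeting K W 𝒱
  have h := LieGroupoid.CochainSubcomplex.bijective_inclusionH 𝒱.vbCochains_le
    (𝒱.exists_sub_mem_vbCochains hΛ)
  exact ⟨h, LinearEquiv.ofBijective 𝒱.inclusionLinear
    (LieGroupoid.CochainSubcomplex.bijective_totalInclusionH 𝒱.vbCochains_le h), fun _ => rfl⟩
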